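/- A trigraph $T$ is a finite set $V(T)$ of vertices with a map $\theta$ from the unordered pairs of distinct vertices to $\{-1,0,1\}$. A pair $uv$ is a strong edge, a switchable pair or a strong antiedge if $\theta(uv)$ is $1$, $0$ or $-1$; it is an edge if $\theta(uv)\ge 0$ and an antiedge if $\theta(uv)\le 0$, and then $u,v$ are adjacent, respectively antiadjacent. The complement $\overline T$ has adjacency function $-\theta$. The full realization of $T$ is the graph on $V(T)$ whose edges are the edges of $T$. A clique (strong clique, strong stable set) is a set of vertices any two of which are adjacent (joined by a strong edge, joined by a strong antiedge). A component of $X\subseteq V(T)$ is a maximal nonempty subset of $X$ in which the pairs that are edges form a connected graph; an anticomponent is a maximal nonempty subset in which the pairs that are antiedges form a connected graph. * $T$ is bipartite if $V(T)$ can be partitioned into two (possibly empty) strong stable sets, and co-bipartite if $\overline T$ is bipartite. * $T$ is line if its full realization is the line graph of a bipartite graph and every clique of $T$ with at least $3$ vertices is a strong clique, and co-line if $\overline T$ is line. * $T$ is doubled if $V(T)$ has a partition $(X,Y)$ (possibly with an empty part) such that every component of $X$ and every anticomponent of $Y$ has at most two vertices, no switchable pair meets both $X$ and $Y$, and for every component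 $C$ of $X$, every anticomponent $D$ of $Y$ and every $v\in C\cup D$, at most one strong edge and at most one strong antiedge between $C$ and $D$ is incident to $v$. $T$ is basic if it belongs to at least one of these five classes. Consider a random-access machine in which integer operations, and additions, subtractions and comparisons of vertex weights, take one step each, and in which a run on $n$ vertices writes no integer larger than $O(n^4)$ into memory (weights are kept in a separate memory). **Theorem.** There is an algorithm that runs in $O(n^4)$ steps on this machine, whose input is a trigraph $T$ with $n$ vertices, given by its adjacency matrix, with non-negative vertex weights, and whose output is either the true statement "$T$ is not basic", or the name of one of the five basic classes to which $T$ belongs together with the maximum weight of a strong stable set of $T$. The weights may be taken from any linearly ordered abelian group, in particular from $\mathbb{Z}$ or $\mathbb{R}$; the algorithm and the constant in $O(n^4)$ depend neither on this group nor on the input. -/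

import Mathlib

/-! ### Trigraphs -/

/-- A trigraph on the vertex set `V`. For `u ≠ v` the value `adj u v` is `1` (strongly adjacent),
`0` (semiadjacent) or `-1` (strongly antiadjacent). Only pairs of distinct vertices carry
information; the diagonal has the fixed value `-1`. -/
structure Trigraph (V : Type*) where
  adj : V → V → SignType
  symm : ∀ u v, adj u v = adj v u
  diag : ∀ v, adj v v = -1

namespace Trigraph

variable {V : Type*} (T : Trigraph V)

/-- The complement: the adjacency function changes its sign on pairs of distinct vertices. -/
noncomputable def compl : Trigraph V where
  adj u v := by
    classical exact if u = v then -1 else -(T.adj u v)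
  symm u v := by
    by_cases h : u = v
    · simp [h]
    · simp [h, Ne.symm h, T.symm u v]
  diag v := by simp

/-- `u` and `v` are distinct and strongly adjacent. -/
def StronglyAdjacent (u v : V) : Prop := u ≠ v ∧ T.adj u v = 1

/-- `u` and `v` are distinct and semiadjacent, that is, `uv` is a switchable pair. -/
def Semiadjacent (u v : V) : Prop := u ≠ v ∧ T.adj u v = 0

/-- `u` and `v` are distinct and strongly antiadjacent. -/
def StronglyAntiadjacent (u v : V) : Prop := u ≠ v ∧ T.adj u v = -1

/-- `u` and `v` are strongly adjacent or semiadjacent. -/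
def Adjacent (u v : V) : Prop := T.StronglyAdjacent u v ∨ T.Semiadjacent u v

/-- A set of pairwise adjacent vertices. -/
def IsClique (X : Set V) : Prop := X.Pairwise T.Adjacent

/-- A set of pairwise strongly adjacent vertices. -/
def IsStrongClique (X : Set V) : Prop := X.Pairwise T.StronglyAdjacent

/-- A set of pairwise strongly antiadjacent vertices. -/
def IsStrongStable (X : Set V) : Prop := X.Pairwise T.StronglyAntiadjacent

/-- The graph in which every switchable pair becomes an edge. -/
def fullRealization : SimpleGraph V where
  Adj u v := T.Adjacent u v
  symm := ⟨fun u v h => by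
    simpa [Adjacent, StronglyAdjacent, Semiadjacent, T.symm u v, ne_comm] using h⟩
  loopless := ⟨fun u h => by simp [Adjacent, StronglyAdjacent, Semiadjacent] at h⟩

/-- The graph in which every switchable pair becomes a non-edge. -/
def strongRealization : SimpleGraph V where
  Adj u v := T.StronglyAdjacent u v
  symm := ⟨fun u v h => by simpa [StronglyAdjacent, T.symm u v, ne_comm] using h⟩
  loopless := ⟨fun u h => by simp [StronglyAdjacent] at h⟩

/-- `X` is connected: the full realization of the trigraph induced on `X` is connected. -/
def IsConnectedSet (X : Set V) : Prop := (T.fullRealization.induce X).Connected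

/-- `X` is anticonnected: the complement of the realization of the trigraph induced on `X` in which
all switchable pairs are non-edges is connected. -/
def IsAnticonnectedSet (X : Set V) : Prop := ((T.strongRealization.induce X)ᶜ).Connected

/-- `C` is a maximal connected subset of `X`. -/
def IsComponent (X C : Set V) : Prop := Maximal (fun D => D ⊆ X ∧ T.IsConnectedSet D) C

/-- `C` is a maximal anticonnected subset of `X`. -/
def IsAnticomponent (X C : Set V) : Prop := Maximal (fun D => D ⊆ X ∧ T.IsAnticonnectedSet D) C

/-- `uv` is a pair of vertices with one end in `A` and the other in `B`. -/
def Between (A B : Set V) (u v : V) : Prop := (u ∈ A ∧ v ∈ B) ∨ (u ∈ B ∧ v ∈ A)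

/-- A good partition `(X, Y)` of the vertex set; a part may be empty. -/
structure IsGoodPartition (X Y : Set V) : Prop where
  partition : IsCompl X Y
  component_le : ∀ C, T.IsComponent X C → C.encard ≤ 2
  anticomponent_le : ∀ C, T.IsAnticomponent Y C → C.encard ≤ 2
  no_switchable : ∀ x ∈ X, ∀ y ∈ Y, ¬ T.Semiadjacent x y
  strong_edge : ∀ C D, T.IsComponent X C → T.IsAnticomponent Y D → ∀ v ∈ C ∪ D,
    {u | Between C D v u ∧ T.StronglyAdjacent v u}.Subsingleton
  strong_antiedge : ∀ C D, T.IsComponent X C → T.IsAnticomponent Y D → ∀ v ∈ C ∪ D,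
    {u | Between C D v u ∧ T.StronglyAntiadjacent v u}.Subsingleton

/-- The vertex set can be partitioned into two strongly stable sets. -/
def IsBipartite : Prop := ∃ X Y : Set V, IsCompl X Y ∧ T.IsStrongStable X ∧ T.IsStrongStable Y

/-- The full realization is the line graph of a bipartite graph, and every clique with at least
three vertices is a strong clique. -/
def IsLine : Prop :=
  (∃ (W : Type) (_ : Finite W) (R : SimpleGraph W),
    R.IsBipartite ∧ Nonempty (T.fullRealization ≃g R.lineGraph)) ∧
  ∀ X : Set V, T.IsClique X → 3 ≤ X.encard → T.IsStrongClique X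

/-- There is a good partition. -/
def IsDoubled : Prop := ∃ X Y : Set V, T.IsGoodPartition X Y

end Trigraph

/-- The names of the five basic classes. -/
inductive BasicClass
  | bipartite
  | coBipartite
  | line
  | coLine
  | doubled

namespace Trigraph

variable {V : Type*} (T : Trigraph V)

/-- The trigraph is a member of the basic class with the given name. -/
def InClass : BasicClass → Prop
  | .bipartite => T.IsBipartite
  | .coBipartite => T.compl.IsBipartite
  | .line => T.IsLine
  | .coLine => T.compl.IsLine
  | .doubled => T.IsDoubled

/-- The trigraph is basic: it is in at least one of the five basic classes. -/
def IsBasic : Prop := ∃ N : BasicClass, T.InClass N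

/-- `a` is the maximum weight of a strongly stable set, for the vertex weights `w`. -/
def IsMaxStrongStableWeight {K : Type*} [AddCommMonoid K] [LinearOrder K] (w : V → K) (a : K) :
    Prop :=
  IsGreatest {x | ∃ S : Finset V, T.IsStrongStable (S : Set V) ∧ x = ∑ v ∈ S, w v} a

end Trigraph

/-! ### Random-access programs with a step count

Programs are finite and refer to finitely many arrays by number. An array has cells `0, 1, 2, …`
with random access. Integer arrays hold natural numbers, weight arrays hold elements of an ordered
abelian group `K`. The program does not depend on `K`, and all that it can do with weights is to
add, subtract, copy and compare them. -/

namespace RAM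

/-- Integer expressions: constants, cell `i` of integer array number `a`, and arithmetic
(subtraction is truncated at `0`). -/
inductive IExp
  | lit (k : ℕ)
  | get (a : ℕ) (i : IExp)
  | add (e f : IExp)
  | sub (e f : IExp)
  | mul (e f : IExp)

/-- Weight expressions: zero, cell `i` of weight array number `a`, sums and differences. -/
inductive WExp
  | zero
  | get (a : ℕ) (i : IExp)
  | add (e f : WExp)
  | sub (e f : WExp)

/-- Tests: comparisons of integers and of weights, negation and conjunction. -/
inductive Test
  | ile (e f : IExp)
  | wle (e f : WExp)
  | neg (b : Test)
  | conj (b c : Test)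

/-- Programs. `iset a i e` writes `e` into cell `i` of integer array `a`; `wset` does the same for
weight arrays; `loop b p` repeats `p` as long as `b` holds. -/
inductive Program
  | skip
  | iset (a : ℕ) (i e : IExp)
  | wset (a : ℕ) (i : IExp) (e : WExp)
  | seq (p q : Program)
  | ite (b : Test) (p q : Program)
  | loop (b : Test) (p : Program)

/-- Memory contents: `int a i` and `wt a i` are cell `i` of integer (weight) array `a`. -/
@[ext]
structure Store (K : Type*) where
  int : ℕ → ℕ → ℕ
  wt : ℕ → ℕ → K

namespace Store

variable {K : Type*}

/-- Write `x` into cell `i` of integer array `a`. -/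
def setInt (s : Store K) (a i x : ℕ) : Store K :=
  { s with int := Function.update s.int a (Function.update (s.int a) i x) }

/-- Write `x` into cell `i` of weight array `a`. -/
def setWt (s : Store K) (a i : ℕ) (x : K) : Store K :=
  { s with wt := Function.update s.wt a (Function.update (s.wt a) i x) }

end Store

/-- Value of an integer expression. -/
def IExp.eval {K : Type*} (s : Store K) : IExp → ℕ
  | .lit k => k
  | .get a i => s.int a (i.eval s)
  | .add e f => e.eval s + f.eval s
  | .sub e f => e.eval s - f.eval s
  | .mul e f => e.eval s * f.eval s

/-- Number of steps for evaluating an integer expression: one for every operation. -/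
def IExp.cost : IExp → ℕ
  | .lit _ => 1
  | .get _ i => i.cost + 1
  | .add e f => e.cost + f.cost + 1
  | .sub e f => e.cost + f.cost + 1
  | .mul e f => e.cost + f.cost + 1

/-- Value of a weight expression. -/
def WExp.eval {K : Type*} [AddCommGroup K] (s : Store K) : WExp → K
  | .zero => 0
  | .get a i => s.wt a (i.eval s)
  | .add e f => e.eval s + f.eval s
  | .sub e f => e.eval s - f.eval s

/-- Number of steps for evaluating a weight expression. -/
def WExp.cost : WExp → ℕ
  | .zero => 1
  | .get _ i => i.cost + 1
  | .add e f => e.cost + f.cost + 1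
  | .sub e f => e.cost + f.cost + 1

/-- Truth value of a test. -/
def Test.Holds {K : Type*} [AddCommGroup K] [LinearOrder K] (s : Store K) : Test → Prop
  | .ile e f => e.eval s ≤ f.eval s
  | .wle e f => e.eval s ≤ f.eval s
  | .neg b => ¬ b.Holds s
  | .conj b c => b.Holds s ∧ c.Holds s

/-- Number of steps for evaluating a test. -/
def Test.cost : Test → ℕ
  | .ile e f => e.cost + f.cost + 1
  | .wle e f => e.cost + f.cost + 1
  | .neg b => b.cost + 1
  | .conj b c => b.cost + c.cost + 1

/-- `Exec B p s t s'`: started in memory `s`, the program `p` halts after exactly `t` steps in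
memory `s'`, and every natural number that it writes into memory is at most `B`. There is no rule
for writing a larger number, so such a run does not count as a halting one. -/
inductive Exec {K : Type*} [AddCommGroup K] [LinearOrder K] (B : ℕ) :
    Program → Store K → ℕ → Store K → Prop
  | skip (s : Store K) : Exec B .skip s 1 s
  | iset (a : ℕ) (i e : IExp) (s : Store K) (h : e.eval s ≤ B) :
      Exec B (.iset a i e) s (i.cost + e.cost + 1) (s.setInt a (i.eval s) (e.eval s))
  | wset (a : ℕ) (i : IExp) (e : WExp) (s : Store K) :
      Exec B (.wset a i e) s (i.cost + e.cost + 1) (s.setWt a (i.eval s) (e.eval s))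
  | seq {p q : Program} {s s' s'' : Store K} {t t' : ℕ}
      (hp : Exec B p s t s') (hq : Exec B q s' t' s'') :
      Exec B (.seq p q) s (t + t') s''
  | ite_true {b : Test} {p q : Program} {s s' : Store K} {t : ℕ}
      (hb : b.Holds s) (hp : Exec B p s t s') :
      Exec B (.ite b p q) s (b.cost + t) s'
  | ite_false {b : Test} {p q : Program} {s s' : Store K} {t : ℕ}
      (hb : ¬ b.Holds s) (hq : Exec B q s t s') :
      Exec B (.ite b p q) s (b.cost + t) s'
  | loop_stop {b : Test} {p : Program} {s : Store K}
      (hb : ¬ b.Holds s) :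
      Exec B (.loop b p) s b.cost s
  | loop_step {b : Test} {p : Program} {s s' s'' : Store K} {t t' : ℕ}
      (hb : b.Holds s) (hp : Exec B p s t s') (hl : Exec B (.loop b p) s' t' s'') :
      Exec B (.loop b p) s (b.cost + t + t') s''

end RAM

/-! ### Input and output of the algorithm -/

/-- The entry of the adjacency matrix for a value of the adjacency function:
`-1, 0, 1` are written as `0, 1, 2`. -/
def signCode : SignType → ℕ
  | .neg => 0
  | .zero => 1
  | .pos => 2

/-- The initial memory for the input `(T, w)`: cell `0` of integer array `0` holds the number `n` of
vertices, integer array `1` the adjacency matrix row by row, and weight array `0` the weights. All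
other cells hold `0`. -/
def inputStore {K : Type*} [Zero K] {n : ℕ} (T : Trigraph (Fin n)) (w : Fin n → K) :
    RAM.Store K where
  int a i :=
    if a = 0 ∧ i = 0 then n
    else if h : a = 1 ∧ i < n * n then
      signCode (T.adj ⟨i / n, Nat.div_lt_of_lt_mul h.2⟩
        ⟨i % n, Nat.mod_lt _ (Nat.pos_of_ne_zero fun h0 => by simp [h0] at h)⟩)
    else 0
  wt a i := if h : a = 0 ∧ i < n then w ⟨i, h.2⟩ else 0

/-- The number by which the algorithm names a basic class; `0` is left for "not basic". -/
def BasicClass.code : BasicClass → ℕ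
  | .bipartite => 1
  | .coBipartite => 2
  | .line => 3
  | .coLine => 4
  | .doubled => 5

/-- The final memory `s` is a correct answer for `(T, w)`. Cell `0` of integer array `2` either is
`0`, and `T` is not basic, or it is the name of a basic class that contains `T`, and cell `0` of
weight array `1` is the maximum weight of a strongly stable set. -/
def IsCorrectOutput {K : Type*} [AddCommGroup K] [LinearOrder K] {n : ℕ}
    (T : Trigraph (Fin n)) (w : Fin n → K) (s : RAM.Store K) : Prop :=
  (s.int 2 0 = 0 ∧ ¬ T.IsBasic) ∨
  ∃ N : BasicClass, s.int 2 0 = N.code ∧ T.InClass N ∧ T.IsMaxStrongStableWeight w (s.wt 1 0)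

/-! The algorithm is written in a structured language `Cmd` whose loops all count up to a power of
`n` or `n + 1`. Its cost is therefore at most `factor * (n + 1) ^ deg`, where both numbers are read
off from the text, and `exec_compile` turns the functional meaning `run` into a run of the machine
with small integers. It remains to prove the functional specification `solveBasic_spec`; the
exponent `4` is found by evaluation in `deg_solveBasic`.

Recognition. Bipartite and line trigraphs are both recognized by a 2-colouring of the arcs of the
full realization in which consecutive arcs `(u, v)` and `(v, j)` differ exactly under a local
condition. In mode `0` they always differ; the colour is then the side of the tail. In mode `1` they
differ if and only if `u` and `j` are distinct and nonadjacent; the colour then tells on which side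
of the bipartite root graph the edges `u` and `v` meet. The colour of an arc forces the colours of
its successors, so that propagation is free only up to a swap of the two colours on parts that are
still uncoloured, and a final check decides existence (`colourArcs_spec`). A line trigraph must in
addition have no triangle with a switchable pair. The co-classes are treated in the complement.

A good partition of a doubled trigraph is determined by any edge inside the first part or any
antiedge inside the second. If there is neither, then the trigraph is a split graph, and some
partition into a stable set and a clique is a degree threshold. This leaves about `n ^ 2`
candidates, each checked in quadratic time (`GoodSide.exists_candidate`, `findSide_spec`).

Weights. In the bipartite case the vertices of the two sides get excess `w` and `-w`, the edges
become arcs of capacity the total weight, and a highest-label preflow algorithm pushes excess into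
deficits. It needs fewer than `(n + 1) ^ 3` rounds of linear work (`discharge_spec`), and at the end
an empty height level gives a minimum cut, hence a heaviest stable set
(`FlowInvariant.isMaxStableWeight`). In the line case stable sets are matchings of the root graph,
and a primal-dual method handles one left vertex after the other (`matchVertex_spec`), optimality
being complementary slackness (`DualInvariant.isMaxStableWeight`).

In the co-classes one wants a strong clique of the complement. An arc colouring excludes diamonds,
so a strong edge with all its common neighbours is a clique, strong because triangles are strong,
and it contains every strong clique through that edge (`solvePairs_spec`). In a doubled trigraph a
stable set has at most two vertices in the second part, and each of the three cases has an explicit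
optimum (`GoodSide.isMaxStableWeight`). -/

namespace RAM

/-! ### Notation for expressions and tests -/

instance (k : ℕ) : OfNat IExp k := ⟨.lit k⟩
instance : Add IExp := ⟨.add⟩
instance : Sub IExp := ⟨.sub⟩
instance : Mul IExp := ⟨.mul⟩
instance : Zero WExp := ⟨.zero⟩
instance : Add WExp := ⟨.add⟩
instance : Sub WExp := ⟨.sub⟩

/-- The number of vertices. -/
abbrev IExp.size : IExp := .get 0 0

/-- Cell `0` of an integer array, used as a register. -/
abbrev IExp.reg (x : ℕ) : IExp := .get x 0

/-- Cell `0` of a weight array, used as a register. -/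
abbrev WExp.reg (x : ℕ) : WExp := .get x 0

/-- The index of the entry `(e, f)` in an array that holds a square matrix. -/
abbrev IExp.entry (e f : IExp) : IExp := e * IExp.size + f

namespace Test

/-- `e < f` for integers. -/
def ilt (e f : IExp) : Test := .ile (e + 1) f

/-- `e = f` for integers. -/
def ieq (e f : IExp) : Test := .conj (.ile e f) (.ile f e)

/-- `e < f` for weights. -/
def wlt (e f : WExp) : Test := .neg (.wle f e)

/-- Disjunction. -/
def disj (b c : Test) : Test := .neg (.conj (.neg b) (.neg c))

end Test

section Eval

variable {K : Type*} (s : Store K)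

@[simp] theorem IExp.eval_lit (k : ℕ) : (IExp.lit k).eval s = k := rfl
@[simp] theorem IExp.eval_ofNat (k : ℕ) : IExp.eval s (no_index (OfNat.ofNat k)) = OfNat.ofNat k := rfl
@[simp] theorem IExp.eval_get (a : ℕ) (i : IExp) : (IExp.get a i).eval s = s.int a (i.eval s) := rfl
@[simp] theorem IExp.eval_add (e f : IExp) : (e + f).eval s = e.eval s + f.eval s := rfl
@[simp] theorem IExp.eval_sub (e f : IExp) : (e - f).eval s = e.eval s - f.eval s := rfl
@[simp] theorem IExp.eval_mul (e f : IExp) : (e * f).eval s = e.eval s * f.eval s := rfl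

variable [AddCommGroup K]

@[simp] theorem WExp.eval_zero : (0 : WExp).eval s = 0 := rfl
@[simp] theorem WExp.eval_get (a : ℕ) (i : IExp) : (WExp.get a i).eval s = s.wt a (i.eval s) := rfl
@[simp] theorem WExp.eval_add (e f : WExp) : (e + f).eval s = e.eval s + f.eval s := rfl
@[simp] theorem WExp.eval_sub (e f : WExp) : (e - f).eval s = e.eval s - f.eval s := rfl

variable [LinearOrder K]

@[simp] theorem Test.holds_ile (e f : IExp) : (Test.ile e f).Holds s ↔ e.eval s ≤ f.eval s :=
  Iff.rfl
@[simp] theorem Test.holds_ilt (e f : IExp) : (Test.ilt e f).Holds s ↔ e.eval s < f.eval s :=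
  Iff.rfl
@[simp] theorem Test.holds_ieq (e f : IExp) : (Test.ieq e f).Holds s ↔ e.eval s = f.eval s :=
  le_antisymm_iff.symm
@[simp] theorem Test.holds_wle (e f : WExp) : (Test.wle e f).Holds s ↔ e.eval s ≤ f.eval s :=
  Iff.rfl
@[simp] theorem Test.holds_wlt (e f : WExp) : (Test.wlt e f).Holds s ↔ e.eval s < f.eval s :=
  not_le
@[simp] theorem Test.holds_neg (b : Test) : (Test.neg b).Holds s ↔ ¬ b.Holds s := Iff.rfl
@[simp] theorem Test.holds_conj (b c : Test) : (Test.conj b c).Holds s ↔ b.Holds s ∧ c.Holds s :=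
  Iff.rfl
@[simp] theorem Test.holds_disj (b c : Test) : (Test.disj b c).Holds s ↔ b.Holds s ∨ c.Holds s := by
  simp [disj]; tauto

end Eval

namespace Store

variable {K : Type*} (s : Store K)

@[simp] theorem int_setInt (a i x b j : ℕ) :
    (s.setInt a i x).int b j = if b = a ∧ j = i then x else s.int b j := by
  by_cases hb : b = a
  · subst hb
    by_cases hj : j = i <;> simp [setInt, hj]
  · simp [setInt, hb]

theorem int_setInt_of_ne {a b : ℕ} (h : b ≠ a) (i x : ℕ) : (s.setInt a i x).int b = s.int b :=
  Function.update_of_ne h _ _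

@[simp] theorem wt_setInt (a i x b j : ℕ) : (s.setInt a i x).wt b j = s.wt b j := rfl

@[simp] theorem int_setWt (a i b j : ℕ) (x : K) : (s.setWt a i x).int b j = s.int b j := rfl

@[simp] theorem wt_setWt (a i b j : ℕ) (x : K) :
    (s.setWt a i x).wt b j = if b = a ∧ j = i then x else s.wt b j := by
  by_cases hb : b = a
  · subst hb
    by_cases hj : j = i <;> simp [setWt, hj]
  · simp [setWt, hb]

end Store

/-! ### Structured programs

All loops of a structured program run a register through an initial segment of the integers, so that
its running time can be read off from its text. -/

/-- Structured programs. `incr a i` adds one to a cell that is at most the number `n` of vertices,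
and `rep x o d p` repeats `p` with register `x` running through the integers below `(n + o) ^ d`. -/
inductive Cmd
  | skip
  | iset (a : ℕ) (i e : IExp)
  | incr (a : ℕ) (i : IExp)
  | wset (a : ℕ) (i : IExp) (e : WExp)
  | seq (p q : Cmd)
  | ite (b : Test) (p q : Cmd)
  | rep (x o d : ℕ) (p : Cmd)

infixr:60 " ;; " => Cmd.seq

namespace Cmd

/-- Execution of a program without an alternative. -/
abbrev when (b : Test) (p : Cmd) : Cmd := .ite b p .skip

/-- Assignment to a register. -/
abbrev rset (x : ℕ) (e : IExp) : Cmd := .iset x 0 e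

/-- The loop in which register `x` runs through the vertices. -/
abbrev each (x : ℕ) (p : Cmd) : Cmd := .rep x 0 1 p

section Run

variable {K : Type*}

/-- The memory after `k` rounds of a loop with body `f` and loop register `x`. -/
def iter (f : Store K → Store K) (x : ℕ) : ℕ → Store K → Store K
  | 0, s => s.setInt x 0 0
  | k + 1, s => (f (iter f x k s)).setInt x 0 (k + 1)

variable [AddCommGroup K] [LinearOrder K]

open Classical in
/-- The memory after the execution of a structured program. -/
noncomputable def run (n : ℕ) : Cmd → Store K → Store K
  | .skip, s => s
  | .iset a i e, s => s.setInt a (i.eval s) (e.eval s)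
  | .incr a i, s =>
    if s.int a (i.eval s) ≤ n then s.setInt a (i.eval s) (s.int a (i.eval s) + 1) else s
  | .wset a i e, s => s.setWt a (i.eval s) (e.eval s)
  | .seq p q, s => q.run n (p.run n s)
  | .ite b p q, s => if b.Holds s then p.run n s else q.run n s
  | .rep x o d p, s => iter (p.run n) x ((n + o) ^ d) s

variable (n : ℕ) (s : Store K)

@[simp] theorem run_skip : Cmd.skip.run n s = s := rfl
@[simp] theorem run_iset (a : ℕ) (i e : IExp) :
    (Cmd.iset a i e).run n s = s.setInt a (i.eval s) (e.eval s) := rfl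
@[simp] theorem run_wset (a : ℕ) (i : IExp) (e : WExp) :
    (Cmd.wset a i e).run n s = s.setWt a (i.eval s) (e.eval s) := rfl
@[simp] theorem run_seq (p q : Cmd) : (p ;; q).run n s = q.run n (p.run n s) := rfl

open Classical in
@[simp] theorem run_ite (b : Test) (p q : Cmd) :
    (Cmd.ite b p q).run n s = if b.Holds s then p.run n s else q.run n s := rfl

@[simp] theorem run_incr (a : ℕ) (i : IExp) :
    (Cmd.incr a i).run n s = if s.int a (i.eval s) ≤ n then
      s.setInt a (i.eval s) (s.int a (i.eval s) + 1) else s := by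
  simp only [run]

end Run

/-- The integer arrays that a program writes. -/
def imods : Cmd → List ℕ
  | .skip => []
  | .iset a _ _ => [a]
  | .incr a _ => [a]
  | .wset _ _ _ => []
  | .seq p q => p.imods ++ q.imods
  | .ite _ p q => p.imods ++ q.imods
  | .rep x _ _ p => x :: p.imods

/-- The weight arrays that a program writes. -/
def wmods : Cmd → List ℕ
  | .skip => []
  | .iset _ _ _ => []
  | .incr _ _ => []
  | .wset a _ _ => [a]
  | .seq p q => p.wmods ++ q.wmods
  | .ite _ p q => p.wmods ++ q.wmods
  | .rep _ _ _ p => p.wmods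

/-! ### Frame rules and the basic loop invariant rule. -/

section Frame

variable {K : Type*} [AddCommGroup K] [LinearOrder K]

/-- The frame rule that carries facts from one stage of the algorithm to the next. For a concrete
program `imods` is a closed list, so its hypothesis is settled by `decide` or `simp`. -/
theorem int_run_of_notMem (n : ℕ) (c : Cmd) (s : Store K) (a : ℕ) (h : a ∉ c.imods) (i : ℕ) :
    (c.run n s).int a i = s.int a i := by
  induction c generalizing s i with
  | skip => rfl
  | iset b j e => simp_all [run, imods]
  | incr b j =>
    simp only [imods, List.mem_singleton] at h
    by_cases hc : s.int b (j.eval s) ≤ n <;> simp [run, hc, h]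
  | wset b j e => rfl
  | seq p q hp hq => simp_all [run, imods]
  | ite b p q hp hq =>
    simp only [imods, List.mem_append, not_or] at h
    by_cases hb : b.Holds s <;> simp [run, hb, hp _ h.1, hq _ h.2]
  | rep x o d p hp =>
    simp only [imods, List.mem_cons, not_or] at h
    simp only [run]
    generalize (n + o) ^ d = m
    induction m with
    | zero => simp [iter, h.1]
    | succ m ih => simp [iter, h.1, hp _ h.2, ih]

theorem wt_run_of_notMem (n : ℕ) (c : Cmd) (s : Store K) (a : ℕ) (h : a ∉ c.wmods) (i : ℕ) :
    (c.run n s).wt a i = s.wt a i := by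
  induction c generalizing s i with
  | skip => rfl
  | iset b j e => rfl
  | incr b j => by_cases hc : s.int b (j.eval s) ≤ n <;> simp [run, hc]
  | wset b j e => simp_all [run, wmods]
  | seq p q hp hq => simp_all [run, wmods]
  | ite b p q hp hq =>
    simp only [wmods, List.mem_append, not_or] at h
    by_cases hb : b.Holds s <;> simp [run, hb, hp _ h.1, hq _ h.2]
  | rep x o d p hp =>
    simp only [wmods] at h
    simp only [run]
    generalize (n + o) ^ d = m
    induction m with
    | zero => simp [iter]
    | succ m ih => simp [iter, hp _ h, ih]

/-- The invariant rule for loops. In the induction step all arrays that the body does not write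
still have their initial contents. -/
theorem run_rep_induction {n x o d : ℕ} {p : Cmd} {s : Store K} (P : ℕ → Store K → Prop)
    (zero : P 0 (s.setInt x 0 0))
    (succ : ∀ k s', k < (n + o) ^ d → s'.int x 0 = k →
      (∀ a, a ∉ x :: p.imods → ∀ i, s'.int a i = s.int a i) →
      (∀ a, a ∉ p.wmods → ∀ i, s'.wt a i = s.wt a i) → P k s' →
      P (k + 1) ((p.run n s').setInt x 0 (k + 1))) :
    P ((n + o) ^ d) ((Cmd.rep x o d p).run n s) := by
  simp only [run]
  suffices h : ∀ m ≤ (n + o) ^ d, P m (iter (p.run n) x m s) from h _ le_rfl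
  intro m
  induction m with
  | zero => exact fun _ => zero
  | succ m ih =>
    intro hm
    refine succ m (iter (p.run n) x m s) hm ?_ ?_ ?_ (ih (by omega))
    · cases m <;> simp [iter]
    · intro a ha i
      have ha' := ha
      simp only [List.mem_cons, not_or] at ha'
      clear ih hm
      induction m with
      | zero => simp [iter, ha'.1]
      | succ m ih => simp [iter, ha'.1, int_run_of_notMem _ _ _ _ ha'.2, ih]
    · intro a ha i
      clear ih hm
      induction m with
      | zero => simp [iter]
      | succ m ih => simp [iter, wt_run_of_notMem _ _ _ _ ha, ih]

end Frame

/-! ### Compilation -/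

/-- The expression for `(n + o) ^ d`. -/
def powSize (o : ℕ) : ℕ → IExp
  | 0 => .lit 1
  | d + 1 => .mul (powSize o d) (.add .size (.lit o))

theorem eval_powSize {K : Type*} (s : Store K) (o d : ℕ) :
    (powSize o d).eval s = (s.int 0 0 + o) ^ d := by
  induction d with
  | zero => rfl
  | succ d ih => rw [pow_succ, ← ih]; rfl

/-- The program of the random-access machine for a structured program. -/
def compile : Cmd → Program
  | .skip => .skip
  | .iset a i e => .iset a i e
  | .incr a i => .ite (.ile (.get a i) .size) (.iset a i (.add (.get a i) (.lit 1))) .skip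
  | .wset a i e => .wset a i e
  | .seq p q => .seq p.compile q.compile
  | .ite b p q => .ite b p.compile q.compile
  | .rep x o d p => .seq (.iset x (.lit 0) (.lit 0))
      (.loop (Test.ilt (.get x (.lit 0)) (powSize o d))
        (.seq p.compile (.iset x (.lit 0) (.add (.get x (.lit 0)) (.lit 1)))))

/-- The value of the expression is at most `5`, or at most that of some cell. -/
def small : IExp → Bool
  | .lit k => k ≤ 5
  | .get _ _ => true
  | .sub e _ => small e
  | _ => false

/-- The number of vertices is not overwritten, no loop overwrites its register, and no large number
is written. -/
def wf : Cmd → Bool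
  | .skip => true
  | .iset a _ e => a != 0 && small e
  | .incr a _ => a != 0
  | .wset _ _ _ => true
  | .seq p q => p.wf && q.wf
  | .ite _ p q => p.wf && q.wf
  | .rep x o d p => x != 0 && !p.imods.contains x && (o ≤ 1 : Bool) && (d ≤ 3 : Bool) && p.wf

/-- The exponent of `n + 1` in the bound for the running time. -/
def deg : Cmd → ℕ
  | .seq p q => max p.deg q.deg
  | .ite _ p q => max p.deg q.deg
  | .rep _ _ d p => d + p.deg
  | _ => 0

/-- The constant in the bound for the running time. -/
def factor : Cmd → ℕ
  | .skip => 1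
  | .iset _ i e => i.cost + e.cost + 1
  | .incr _ i => 3 * i.cost + 10
  | .wset _ i e => i.cost + e.cost + 1
  | .seq p q => p.factor + q.factor
  | .ite b p q => b.cost + p.factor + q.factor
  | .rep x o d p => 2 * (Test.ilt (.get x (.lit 0)) (powSize o d)).cost + p.factor + 9

variable {K : Type*}

/-- The compiled loops recompute their bound from the stored number of vertices in every round.
Since well-formed programs never write array `0`, the bound stays constant. -/
theorem zero_notMem_imods (c : Cmd) (hc : c.wf) : 0 ∉ c.imods := by
  induction c with
  | skip => simp [imods]
  | iset a i e =>
    simp only [wf, Bool.and_eq_true, bne_iff_ne] at hc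
    simpa [imods] using Ne.symm hc.1
  | incr a i =>
    simp only [wf, bne_iff_ne] at hc
    simpa [imods] using Ne.symm hc
  | wset a i e => simp [imods]
  | seq p q hp hq => simp_all [imods, wf]
  | ite b p q hp hq => simp_all [imods, wf]
  | rep x o d p hp =>
    simp only [wf, Bool.and_eq_true, bne_iff_ne] at hc
    simpa [imods] using ⟨Ne.symm hc.1.1.1.1, hp hc.2⟩

/-- Values assigned directly are small constants, copies of cells, or such values diminished by a
subtraction, so a bound on all cells reproduces itself. Products and sums occur only inside index
expressions and tests, or in the guarded increments and the loop registers. -/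
theorem eval_le_of_small {V : ℕ} (hV : 5 ≤ V) (s : Store K) (hs : ∀ a i, s.int a i ≤ V) (e : IExp)
    (h : small e) : e.eval s ≤ V := by
  induction e with
  | lit k => simp [small] at h; simp; omega
  | get a i => exact hs _ _
  | sub e f he _ => exact (Nat.sub_le _ _).trans (he h)
  | add e f => simp [small] at h
  | mul e f => simp [small] at h

theorem setInt_le {V : ℕ} {s : Store K} (hs : ∀ a i, s.int a i ≤ V) (a i : ℕ) {x : ℕ} (hx : x ≤ V)
    (b j : ℕ) : (s.setInt a i x).int b j ≤ V := by
  rw [Store.int_setInt]; split_ifs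
  · exact hx
  · exact hs _ _

/-- The compiled program computes what the structured program says, in the time that can be read off
from it, and it writes only small numbers. -/
theorem exec_compile [AddCommGroup K] [LinearOrder K] {n V B : ℕ} (hV : (n + 1) ^ 3 + 5 ≤ V)
    (hB : V ≤ B) (c : Cmd) (hc : c.wf)
    (s : Store K) (h0 : s.int 0 0 = n) (hs : ∀ a i, s.int a i ≤ V) :
    (∃ t ≤ c.factor * (n + 1) ^ c.deg, Exec B c.compile s t (c.run n s)) ∧
      ∀ a i, (c.run n s).int a i ≤ V := by
  have hn : n + 1 ≤ V := by
    have : (n + 1) ^ 1 ≤ (n + 1) ^ 3 := Nat.pow_le_pow_right (by omega) (by omega)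
    rw [pow_one] at this
    omega
  induction c generalizing s with
  | skip => exact ⟨⟨1, by simp [factor, deg], .skip s⟩, hs⟩
  | iset a i e =>
    simp only [wf, Bool.and_eq_true] at hc
    have := eval_le_of_small (by omega) s hs e hc.2
    exact ⟨⟨_, by simp [factor, deg], .iset a i e s (this.trans hB)⟩, setInt_le hs _ _ this⟩
  | incr a i =>
    by_cases h : s.int a (i.eval s) ≤ n
    · have hrun : run n (incr a i) s = s.setInt a (i.eval s) (s.int a (i.eval s) + 1) := by
        simp [run, h]
      rw [hrun]
      refine ⟨⟨_, ?_, Exec.ite_true (by simpa [h0] using h)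
        (.iset a i (.add (.get a i) (.lit 1)) s ?_)⟩, setInt_le hs _ _ (by omega)⟩
      · simp only [factor, deg, Test.cost, IExp.cost, pow_zero, mul_one]; omega
      · change s.int a (i.eval s) + 1 ≤ B; omega
    · have hrun : run n (incr a i) s = s := by simp [run, h]
      rw [hrun]
      refine ⟨⟨_, ?_, Exec.ite_false (by simpa [h0] using h) (.skip s)⟩, hs⟩
      simp only [factor, deg, Test.cost, IExp.cost, pow_zero, mul_one]; omega
  | wset a i e => exact ⟨⟨_, by simp [factor, deg], .wset a i e s⟩, hs⟩
  | seq p q hp hq =>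
    simp only [wf, Bool.and_eq_true] at hc
    obtain ⟨⟨t, ht, he⟩, hs'⟩ := hp hc.1 s h0 hs
    have h0' : (p.run n s).int 0 0 = n := by
      rw [int_run_of_notMem _ _ _ _ (zero_notMem_imods p hc.1), h0]
    obtain ⟨⟨t', ht', he'⟩, hs''⟩ := hq hc.2 _ h0' hs'
    refine ⟨⟨t + t', ?_, .seq he he'⟩, hs''⟩
    have h1 : (n + 1) ^ p.deg ≤ (n + 1) ^ max p.deg q.deg :=
      Nat.pow_le_pow_right (by omega) (le_max_left _ _)
    have h2 : (n + 1) ^ q.deg ≤ (n + 1) ^ max p.deg q.deg :=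
      Nat.pow_le_pow_right (by omega) (le_max_right _ _)
    simp only [factor, deg, add_mul]
    exact add_le_add (ht.trans (Nat.mul_le_mul_left _ h1)) (ht'.trans (Nat.mul_le_mul_left _ h2))
  | ite b p q hp hq =>
    simp only [wf, Bool.and_eq_true] at hc
    have hpos : 1 ≤ (n + 1) ^ max p.deg q.deg := Nat.one_le_pow _ _ (by omega)
    have hb : b.cost ≤ b.cost * (n + 1) ^ max p.deg q.deg := Nat.le_mul_of_pos_right _ hpos
    simp only [factor, deg, add_mul]
    by_cases h : b.Holds s
    · obtain ⟨⟨t, ht, he⟩, hs'⟩ := hp hc.1 s h0 hs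
      have h1 : (n + 1) ^ p.deg ≤ (n + 1) ^ max p.deg q.deg :=
        Nat.pow_le_pow_right (by omega) (le_max_left _ _)
      simp only [run, h, if_true]
      refine ⟨⟨_, ?_, .ite_true h he⟩, hs'⟩
      have := ht.trans (Nat.mul_le_mul_left _ h1)
      omega
    · obtain ⟨⟨t, ht, he⟩, hs'⟩ := hq hc.2 s h0 hs
      have h1 : (n + 1) ^ q.deg ≤ (n + 1) ^ max p.deg q.deg :=
        Nat.pow_le_pow_right (by omega) (le_max_right _ _)
      simp only [run, h, if_false]
      refine ⟨⟨_, ?_, .ite_false h he⟩, hs'⟩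
      have := ht.trans (Nat.mul_le_mul_left _ h1)
      omega
  | rep x o d p hp =>
    simp only [wf, Bool.and_eq_true, bne_iff_ne, Bool.not_eq_true', List.contains_eq_mem,
      decide_eq_true_eq, decide_eq_false_iff_not] at hc
    obtain ⟨⟨⟨⟨hx, hxp⟩, ho⟩, hd⟩, hw⟩ := hc
    set b := Test.ilt (.get x (.lit 0)) (powSize o d) with hb
    have hN : (n + o) ^ d ≤ (n + 1) ^ d := Nat.pow_le_pow_left (by omega) d
    have hN3 : (n + 1) ^ d ≤ (n + 1) ^ 3 := Nat.pow_le_pow_right (by omega) hd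
    -- At the start of every round the register agrees with the number of rounds done; this is what
    -- makes the machine's loop test stop at the right moment.
    have key : ∀ m ≤ (n + o) ^ d, (iter (p.run n) x m s).int 0 0 = n ∧
        (iter (p.run n) x m s).int x 0 = m ∧ ∀ a i, (iter (p.run n) x m s).int a i ≤ V := by
      intro m hm
      induction m with
      | zero => exact ⟨by simp [iter, Ne.symm hx, h0], by simp [iter],
          setInt_le hs _ _ (by omega)⟩
      | succ m ih =>
        obtain ⟨h1, h2, h3⟩ := ih (by omega)
        refine ⟨?_, by simp [iter], setInt_le (hp hw _ h1 h3).2 _ _ (by omega)⟩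
        simp [iter, Ne.symm hx, int_run_of_notMem _ _ _ _ (zero_notMem_imods p hw), h1]
    refine ⟨?_, (key _ le_rfl).2.2⟩
    -- The induction is on the number `j` of rounds still to come, because the rule for `loop`
    -- splits off the first round. The `6` is the cost of advancing the register, and the last
    -- `b.cost` is that of the failing test.
    have loop : ∀ j ≤ (n + o) ^ d, ∃ t ≤ j * (b.cost + p.factor * (n + 1) ^ p.deg + 6) + b.cost,
        Exec B (.loop b (.seq p.compile (.iset x (.lit 0) (.add (.get x (.lit 0)) (.lit 1)))))
          (iter (p.run n) x ((n + o) ^ d - j) s) t (iter (p.run n) x ((n + o) ^ d) s) := by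
      intro j hj
      induction j with
      | zero =>
        refine ⟨b.cost, by simp, ?_⟩
        constructor
        obtain ⟨h1, h2, -⟩ := key _ le_rfl
        simp [hb, eval_powSize, h1, h2]
      | succ j ih =>
        obtain ⟨t, ht, he⟩ := ih (by omega)
        obtain ⟨h1, h2, h3⟩ := key ((n + o) ^ d - (j + 1)) (by omega)
        obtain ⟨⟨t', ht', he'⟩, h4⟩ := hp hw _ h1 h3
        have h5 : (p.run n (iter (p.run n) x ((n + o) ^ d - (j + 1)) s)).int x 0
            = (n + o) ^ d - (j + 1) := by rw [int_run_of_notMem _ _ _ _ hxp, h2]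
        refine ⟨b.cost + (t' + 6) + t, ?_, .loop_step ?_ (.seq he' ?_) he⟩
        · rw [add_mul]; omega
        · simp only [hb, Test.holds_ilt, eval_powSize, h1, IExp.eval_get, IExp.eval_lit, h2]
          omega
        · have h6 : iter (p.run n) x ((n + o) ^ d - j) s
              = (p.run n (iter (p.run n) x ((n + o) ^ d - (j + 1)) s)).setInt x 0
                ((p.run n (iter (p.run n) x ((n + o) ^ d - (j + 1)) s)).int x 0 + 1) := by
            rw [h5, show (n + o) ^ d - j = (n + o) ^ d - (j + 1) + 1 by omega]
            rfl
          rw [h6]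
          refine Exec.iset x (.lit 0) (.add (.get x (.lit 0)) (.lit 1)) _ ?_
          change (p.run n _).int x 0 + 1 ≤ B
          omega
    obtain ⟨t, ht, he⟩ := loop _ le_rfl
    rw [Nat.sub_self] at he
    -- Resetting the register costs `3`.
    refine ⟨3 + t, ?_, .seq (.iset x (.lit 0) (.lit 0) s (Nat.zero_le _)) he⟩
    simp only [factor, deg, pow_add]
    rw [← hb]
    have hQ : 1 ≤ (n + 1) ^ p.deg := Nat.one_le_pow _ _ (by omega)
    have hR : 1 ≤ (n + 1) ^ d := Nat.one_le_pow _ _ (by omega)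
    generalize (n + 1) ^ p.deg = Q at *
    generalize (n + 1) ^ d = R at *
    have h7 : (n + o) ^ d * (b.cost + p.factor * Q + 6) ≤ R * ((b.cost + p.factor + 6) * Q) := by
      refine Nat.mul_le_mul hN ?_
      nlinarith
    have h8 : 1 ≤ R * Q := Nat.mul_pos hR hQ
    nlinarith

/-! ### Invariant rules for single and nested loops and for flags. -/

section Loops

variable [AddCommGroup K] [LinearOrder K] {n : ℕ} {s : Store K}

/-- The invariant rule for loops whose invariant does not mention the loop register. -/
theorem run_rep_invariant {x o d : ℕ} {p : Cmd} (P : ℕ → Store K → Prop)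
    (stab : ∀ k s' j, P k s' → P k (s'.setInt x 0 j)) (zero : P 0 s)
    (succ : ∀ k s', k < (n + o) ^ d → s'.int x 0 = k →
      (∀ a, a ∉ x :: p.imods → ∀ i, s'.int a i = s.int a i) →
      (∀ a, a ∉ p.wmods → ∀ i, s'.wt a i = s.wt a i) → P k s' → P (k + 1) (p.run n s')) :
    P ((n + o) ^ d) ((Cmd.rep x o d p).run n s) :=
  run_rep_induction P (stab _ _ _ zero) fun k s' hk hx hi hw hP =>
    stab _ _ _ (succ k s' hk hx hi hw hP)

/-- The invariant rule for loops through the vertices. -/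
theorem run_each_invariant {x : ℕ} {p : Cmd} (P : ℕ → Store K → Prop)
    (stab : ∀ k s' j, P k s' → P k (s'.setInt x 0 j)) (zero : P 0 s)
    (succ : ∀ k s', k < n → s'.int x 0 = k →
      (∀ a, a ∉ x :: p.imods → ∀ i, s'.int a i = s.int a i) →
      (∀ a, a ∉ p.wmods → ∀ i, s'.wt a i = s.wt a i) → P k s' → P (k + 1) (p.run n s')) :
    P n ((Cmd.each x p).run n s) := by
  have := run_rep_invariant (n := n) (o := 0) (d := 1) P stab zero (by simpa using succ)
  simpa using this

/-- The invariant rule for loops through the ordered pairs of vertices, in lexicographic order. -/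
theorem run_each_each_invariant {x y : ℕ} {p : Cmd} (hxy : x ∉ y :: p.imods)
    (P : ℕ → ℕ → Store K → Prop)
    (stabx : ∀ k l s' j, P k l s' → P k l (s'.setInt x 0 j))
    (staby : ∀ k l s' j, P k l s' → P k l (s'.setInt y 0 j)) (zero : P 0 0 s)
    (carry : ∀ k s', k < n → P k n s' → P (k + 1) 0 s')
    (succ : ∀ k l s', k < n → l < n → s'.int x 0 = k → s'.int y 0 = l →
      (∀ a, a ∉ x :: y :: p.imods → ∀ i, s'.int a i = s.int a i) →
      (∀ a, a ∉ p.wmods → ∀ i, s'.wt a i = s.wt a i) → P k l s' → P k (l + 1) (p.run n s')) :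
    P n 0 ((Cmd.each x (.each y p)).run n s) := by
  refine run_each_invariant (fun k => P k 0) (fun k s' j h => stabx _ _ _ _ h) zero ?_
  intro k s1 hk hx hi hw hP
  refine carry _ _ hk (run_each_invariant (P k) (fun l s' j h => staby _ _ _ _ h) hP ?_)
  intro l s2 hl hy hi' hw' hQ
  refine succ k l s2 hk hl ?_ hy ?_ ?_ hQ
  · rw [hi' _ hxy, hx]
  · intro a ha i
    rw [hi' a (fun h => ha (List.mem_cons_of_mem _ h)), hi a ha]
  · intro a ha i
    rw [hw' a ha, hw a ha]

/-- A loop that keeps a flag at `0` as long as its rounds pass a check. -/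
theorem run_each_flag {x f : ℕ} {p : Cmd} (hfx : f ≠ x) (C : ℕ → Prop)
    (step : ∀ k s', k < n → s'.int x 0 = k →
      (∀ a, a ∉ x :: p.imods → ∀ i, s'.int a i = s.int a i) →
      (∀ a, a ∉ p.wmods → ∀ i, s'.wt a i = s.wt a i) →
      ((p.run n s').int f 0 = 0 ↔ s'.int f 0 = 0 ∧ C k)) :
    ((Cmd.each x p).run n s).int f 0 = 0 ↔ s.int f 0 = 0 ∧ ∀ k < n, C k := by
  refine run_each_invariant (s := s) (x := x) (p := p)
    (fun k s' => s'.int f 0 = 0 ↔ s.int f 0 = 0 ∧ ∀ i < k, C i) (by simp [hfx]) (by simp) ?_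
  intro k s' hk hx hi hw hP
  rw [step k s' hk hx hi hw, hP, and_assoc]
  refine and_congr_right fun _ => ⟨fun h i hi => ?_, fun h => ⟨fun i hi => h i (by omega),
    h k (by omega)⟩⟩
  rcases Nat.lt_succ_iff_lt_or_eq.1 hi with h1 | rfl
  · exact h.1 i h1
  · exact h.2

end Loops

end Cmd

/-- Uniqueness of division with remainder: distinct entries of a matrix lie in distinct cells, so
that writing one leaves the others alone. -/
theorem entry_inj {n a b c d : ℕ} (hb : b < n) (hd : d < n) :
    a * n + b = c * n + d ↔ a = c ∧ b = d := by
  constructor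
  · intro h
    have h1 : (a * n + b) / n = (c * n + d) / n := by rw [h]
    rw [mul_comm a, mul_comm c, Nat.mul_add_div (by omega), Nat.mul_add_div (by omega),
      Nat.div_eq_of_lt hb, Nat.div_eq_of_lt hd] at h1
    have h2 : a = c := by simpa using h1
    subst h2
    exact ⟨rfl, by omega⟩
  · rintro ⟨rfl, rfl⟩
    rfl

end RAM

namespace RAM

open Cmd IExp Test

variable {K : Type*} [AddCommGroup K] [LinearOrder K]

/-! ### Colourings of the arcs of a graph

A graph on the integers below `n` is given by a function `g` with natural values: `u` and `v` are
adjacent if `1 ≤ g u v`. -/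

/-- The two arcs `(u, v)` and `(v, j)` are to be coloured differently. In mode `0` this is always
so, otherwise it means that `u` and `j` are distinct and not adjacent. -/
def Differ (mode : ℕ) (g : ℕ → ℕ → ℕ) (u j : ℕ) : Prop := mode = 0 ∨ (j ≠ u ∧ g u j = 0)

/-- `f` is a correct colouring of the arcs with the colours `1` and `2`. -/
structure IsArcColouring (n mode : ℕ) (g f : ℕ → ℕ → ℕ) : Prop where
  range : ∀ u < n, ∀ v < n, 1 ≤ g u v → f u v = 1 ∨ f u v = 2
  differ : ∀ u < n, ∀ v < n, ∀ j < n, 1 ≤ g u v → 1 ≤ g v j → (f u v ≠ f v j ↔ Differ mode g u j)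

/-- The memory holds the number of vertices, and the graph in array `4`. -/
structure HoldsGraph (n : ℕ) (g : ℕ → ℕ → ℕ) (s : Store K) : Prop where
  size : s.int 0 0 = n
  graph : ∀ u < n, ∀ v < n, s.int 4 (u * n + v) = g u v

omit [AddCommGroup K] [LinearOrder K] in
theorem HoldsGraph.congr {n : ℕ} {g : ℕ → ℕ → ℕ} {s s' : Store K} (h : HoldsGraph n g s)
    (h0 : ∀ i, s'.int 0 i = s.int 0 i) (h4 : ∀ i, s'.int 4 i = s.int 4 i) : HoldsGraph n g s' :=
  ⟨by rw [h0, h.size], fun u hu v hv => by rw [h4, h.graph u hu v hv]⟩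

/-- The test for `Differ`; the mode is in register `5`. -/
def differTest (u j : IExp) : Test :=
  disj (ieq (reg 5) 0) (conj (neg (ieq j u)) (ieq (get 4 (entry u j)) 0))

/-- No arc is coloured (array `6`) or processed (array `7`). -/
def clearColours : Cmd := each 10 (each 11 (
  iset 6 (entry (reg 10) (reg 11)) 0 ;; iset 7 (entry (reg 10) (reg 11)) 0))

/-- Choose an arc that is not processed (registers `15` and `16`), a coloured one if possible.
Register `14` becomes `2` if the arc is coloured, `1` if it is not, and `0` if there is none. -/
def pickArc : Cmd :=
  rset 14 0 ;;
  each 10 (each 11 (when (conj (ile 1 (get 4 (entry (reg 10) (reg 11))))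
      (ieq (get 7 (entry (reg 10) (reg 11))) 0))
    (.ite (ile 1 (get 6 (entry (reg 10) (reg 11))))
      (rset 14 2 ;; rset 15 (reg 10) ;; rset 16 (reg 11))
      (when (ieq (reg 14) 0) (rset 14 1 ;; rset 15 (reg 10) ;; rset 16 (reg 11))))))

/-- Process the chosen arc: colour the arcs that follow it. -/
def processArc : Cmd :=
  when (ile 1 (reg 14)) (
    when (ieq (reg 14) 1) (iset 6 (entry (reg 15) (reg 16)) 1) ;;
    iset 7 (entry (reg 15) (reg 16)) 1 ;;
    each 12 (when (conj (ile 1 (get 4 (entry (reg 16) (reg 12))))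
        (ieq (get 6 (entry (reg 16) (reg 12))) 0))
      (.ite (differTest (reg 15) (reg 12))
        (iset 6 (entry (reg 16) (reg 12)) (3 - get 6 (entry (reg 15) (reg 16))))
        (iset 6 (entry (reg 16) (reg 12)) (get 6 (entry (reg 15) (reg 16)))))))

/-- Register `8` becomes `1` if the colouring is wrong, and `0` otherwise. -/
def checkColours : Cmd :=
  rset 8 0 ;;
  each 10 (each 11 (when (ile 1 (get 4 (entry (reg 10) (reg 11))))
    (each 12 (when (ile 1 (get 4 (entry (reg 11) (reg 12))))
      (.ite (differTest (reg 10) (reg 12))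
        (when (ieq (get 6 (entry (reg 10) (reg 11))) (get 6 (entry (reg 11) (reg 12)))) (rset 8 1))
        (when (neg (ieq (get 6 (entry (reg 10) (reg 11))) (get 6 (entry (reg 11) (reg 12)))))
          (rset 8 1)))))))

/-- Colour the arcs, and report in register `8` whether the colouring is wrong. -/
def colourArcs : Cmd :=
  clearColours ;; .rep 13 0 2 (pickArc ;; processArc) ;; checkColours

/-- The invariant of the colouring algorithm, for the colours `col` and the set `proc` of processed
arcs. -/
structure ColourInvariant (n mode : ℕ) (g col proc : ℕ → ℕ → ℕ) : Prop where
  range : ∀ u < n, ∀ v < n, 1 ≤ g u v → col u v ≤ 2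
  closed : ∀ u < n, ∀ v < n, 1 ≤ g u v → proc u v ≠ 0 →
    col u v ≠ 0 ∧ ∀ j < n, 1 ≤ g v j → col v j ≠ 0
  extends_ : ∀ f, IsArcColouring n mode g f → ∃ f', IsArcColouring n mode g f' ∧
    ∀ u < n, ∀ v < n, 1 ≤ g u v → col u v ≠ 0 → f' u v = col u v

/-- When every coloured arc is processed, the coloured arcs are closed under successors, and under
predecessors too because every arc has its reverse. Swapping the two colours on all uncoloured arcs
thus keeps a colouring correct, and the first arc of a new portion may be given colour `1` without
loss of generality. -/
theorem ColourInvariant.start {n mode : ℕ} {g col proc : ℕ → ℕ → ℕ}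
    (h : ColourInvariant n mode g col proc) (hg : ∀ u < n, ∀ v < n, g u v = g v u)
    {x y : ℕ} (hx : x < n) (hy : y < n) (hxy : 1 ≤ g x y) (hc : col x y = 0)
    (hp : ∀ u < n, ∀ v < n, 1 ≤ g u v → col u v ≠ 0 → proc u v ≠ 0) :
    ColourInvariant n mode g (fun u v => if u = x ∧ v = y then 1 else col u v) proc := by
  have hz : ∀ u v, (if u = x ∧ v = y then 1 else col u v) ≠ 0 ↔ (u = x ∧ v = y) ∨ col u v ≠ 0 := by
    intro u v
    by_cases huv : u = x ∧ v = y <;> simp [huv]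
  refine ⟨fun u hu v hv huv => ?_, fun u hu v hv huv hq => ?_, fun f hf => ?_⟩
  · split_ifs
    · omega
    · exact h.range u hu v hv huv
  · obtain ⟨h1, h2⟩ := h.closed u hu v hv huv hq
    exact ⟨(hz _ _).2 (Or.inr h1), fun j hj hvj => (hz _ _).2 (Or.inr (h2 j hj hvj))⟩
  · obtain ⟨f', hf', hcol⟩ := h.extends_ f hf
    rcases hf'.range x hx y hy hxy with h1 | h2
    · refine ⟨f', hf', fun u hu v hv huv hne => ?_⟩
      rcases (hz _ _).1 hne with ⟨rfl, rfl⟩ | h3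
      · simp [h1]
      · have : ¬ (u = x ∧ v = y) := by rintro ⟨rfl, rfl⟩; exact h3 hc
        simp [this, hcol u hu v hv huv h3]
    · have step : ∀ u < n, ∀ v < n, ∀ j < n, 1 ≤ g u v → 1 ≤ g v j → col u v ≠ 0 →
          col v j ≠ 0 := fun u hu v hv j hj huv hvj hne =>
        (h.closed u hu v hv huv (hp u hu v hv huv hne)).2 j hj hvj
      -- The predecessor is reached by going forwards along `(v, j)`, `(j, v)`, `(v, u)`, `(u, v)`.
      have back : ∀ u < n, ∀ v < n, ∀ j < n, 1 ≤ g u v → 1 ≤ g v j → col v j ≠ 0 →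
          col u v ≠ 0 := by
        intro u hu v hv j hj huv hvj hne
        have hvu : 1 ≤ g v u := by rwa [hg v hv u hu]
        have hjv : 1 ≤ g j v := by rwa [hg j hj v hv]
        have h3 := step v hv j hj v hv hvj hjv hne
        have h4 := step j hj v hv u hu hjv hvu h3
        exact step v hv u hu v hv hvu huv h4
      refine ⟨fun u v => if col u v = 0 then 3 - f' u v else f' u v, ⟨?_, ?_⟩, ?_⟩
      · intro u hu v hv huv
        have := hf'.range u hu v hv huv
        split_ifs <;> omega
      · intro u hu v hv j hj huv hvj
        have h3 := hf'.range u hu v hv huv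
        have h4 := hf'.range v hv j hj hvj
        rw [← hf'.differ u hu v hv j hj huv hvj]
        have h5 := step u hu v hv j hj huv hvj
        have h6 := back u hu v hv j hj huv hvj
        split_ifs <;> omega
      · intro u hu v hv huv hne
        rcases (hz _ _).1 hne with ⟨rfl, rfl⟩ | h3
        · simp [hc, h2]
        · have : ¬ (u = x ∧ v = y) := by rintro ⟨rfl, rfl⟩; exact h3 hc
          simp [this, h3, hcol u hu v hv huv h3]

-- Here there is no choice: with only two colours, every correct colouring that agrees with `col` on
-- `(x, y)` must colour the successors of this arc as prescribed.
open Classical in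
theorem ColourInvariant.spread {n mode : ℕ} {g col proc col' proc' : ℕ → ℕ → ℕ}
    (h : ColourInvariant n mode g col proc)
    {x y : ℕ} (hx : x < n) (hy : y < n) (hxy : 1 ≤ g x y) (hc : col x y ≠ 0)
    (hcol : ∀ u < n, ∀ v < n, col' u v = if u = y ∧ 1 ≤ g y v ∧ col y v = 0 then
      (if Differ mode g x v then 3 - col x y else col x y) else col u v)
    (hproc : ∀ u < n, ∀ v < n, proc' u v = if u = x ∧ v = y then 1 else proc u v) :
    ColourInvariant n mode g col' proc' := by
  have hc2 := h.range x hx y hy hxy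
  have mono : ∀ u < n, ∀ v < n, col u v ≠ 0 → col' u v = col u v := by
    intro u hu v hv hne
    rw [hcol u hu v hv, if_neg]
    rintro ⟨rfl, -, h0⟩
    exact hne h0
  have mono' : ∀ u < n, ∀ v < n, col u v ≠ 0 → col' u v ≠ 0 := by
    intro u hu v hv hne
    rwa [mono u hu v hv hne]
  refine ⟨fun u hu v hv huv => ?_, fun u hu v hv huv hq => ?_, fun f hf => ?_⟩
  · have := h.range u hu v hv huv
    rw [hcol u hu v hv]
    split_ifs <;> omega
  · rw [hproc u hu v hv] at hq
    by_cases hxy' : u = x ∧ v = y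
    · obtain ⟨rfl, rfl⟩ := hxy'
      refine ⟨mono' _ hx _ hy hc, fun j hj hvj => ?_⟩
      rw [hcol v hv j hj]
      split_ifs with h1 h2
      · omega
      · omega
      · simpa [hvj] using h1
    · rw [if_neg hxy'] at hq
      obtain ⟨h1, h2⟩ := h.closed u hu v hv huv hq
      exact ⟨mono' u hu v hv h1, fun j hj hvj => mono' v hv j hj (h2 j hj hvj)⟩
  · obtain ⟨f', hf', hff⟩ := h.extends_ f hf
    refine ⟨f', hf', fun u hu v hv huv hne => ?_⟩
    rw [hcol u hu v hv]
    split_ifs with h1 h2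
    · obtain ⟨rfl, -, h0⟩ := h1
      have h3 := (hf'.differ x hx u hu v hv hxy huv).2 h2
      rw [hff x hx u hu hxy hc] at h3
      have := hf'.range u hu v hv huv
      omega
    · obtain ⟨rfl, -, h0⟩ := h1
      have h3 := mt (hf'.differ x hx u hu v hv hxy huv).1 h2
      rw [hff x hx u hu hxy hc] at h3
      omega
    · refine hff u hu v hv huv ?_
      intro h0
      rw [hcol u hu v hv, if_neg h1] at hne
      exact hne h0

/-! ### Correctness of the colouring program. -/

section Spec

variable {n : ℕ} {g : ℕ → ℕ → ℕ} {s : Store K}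

theorem holds_differTest (h : HoldsGraph n g s) {u j : IExp} (hu : u.eval s < n)
    (hj : j.eval s < n) :
    (differTest u j).Holds s ↔ Differ (s.int 5 0) g (u.eval s) (j.eval s) := by
  simp [differTest, Differ, h.size, h.graph _ hu _ hj]

theorem clearColours_spec (h : HoldsGraph n g s) : ∀ u < n, ∀ v < n,
    (clearColours.run n s).int 6 (u * n + v) = 0 ∧ (clearColours.run n s).int 7 (u * n + v) = 0 := by
  have := run_each_each_invariant (n := n) (s := s) (x := 10) (y := 11)
    (p := iset 6 (entry (reg 10) (reg 11)) 0 ;; iset 7 (entry (reg 10) (reg 11)) 0) (by decide)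
    (fun k l s' => ∀ u v, v < n → (u < k ∨ u = k ∧ v < l) →
      s'.int 6 (u * n + v) = 0 ∧ s'.int 7 (u * n + v) = 0)
    (by simp) (by simp) (by simp) (by grind) ?_
  · intro u hu v hv
    exact this u v hv (Or.inl hu)
  intro k l s2 hk hl hx hy hi hw hQ u v hv huv
  have e1 : s2.int 0 0 = n := by rw [hi 0 (by decide), h.size]
  have := hQ u v hv
  simp [e1, hx, hy, entry_inj hv hl] at this ⊢
  grind

/-- The outcome of the search for an arc that is not processed. -/
structure IsPick (n : ℕ) (g : ℕ → ℕ → ℕ) (s s' : Store K) : Prop where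
  lt : s'.int 14 0 ≠ 0 → s'.int 15 0 < n ∧ s'.int 16 0 < n
  arc : s'.int 14 0 ≠ 0 → 1 ≤ g (s'.int 15 0) (s'.int 16 0)
  fresh : s'.int 14 0 ≠ 0 → s.int 7 (s'.int 15 0 * n + s'.int 16 0) = 0
  coloured : s'.int 14 0 ≠ 0 → (s'.int 14 0 = 1 ↔ s.int 6 (s'.int 15 0 * n + s'.int 16 0) = 0)
  all : ∀ u < n, ∀ v < n, 1 ≤ g u v → s.int 7 (u * n + v) = 0 →
    s'.int 14 0 ≠ 0 ∧ (s.int 6 (u * n + v) ≠ 0 → s'.int 14 0 ≠ 1)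

/-- A coloured arc replaces whatever was chosen before, an uncoloured one is taken only if nothing
has been found. Hence an uncoloured arc is returned only if all coloured arcs are processed, which
is the situation required by `ColourInvariant.start`. -/
theorem pickArc_spec (h : HoldsGraph n g s) : IsPick n g s (pickArc.run n s) := by
  have key := run_each_each_invariant (n := n) (s := (rset 14 0).run n s) (x := 10) (y := 11)
    (p := when (conj (ile 1 (get 4 (entry (reg 10) (reg 11))))
      (ieq (get 7 (entry (reg 10) (reg 11))) 0))
    (.ite (ile 1 (get 6 (entry (reg 10) (reg 11))))
      (rset 14 2 ;; rset 15 (reg 10) ;; rset 16 (reg 11))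
      (when (ieq (reg 14) 0) (rset 14 1 ;; rset 15 (reg 10) ;; rset 16 (reg 11))))) (by decide)
    (fun k l s' => (s'.int 14 0 ≠ 0 → s'.int 15 0 < n ∧ s'.int 16 0 < n ∧
      1 ≤ g (s'.int 15 0) (s'.int 16 0) ∧ s.int 7 (s'.int 15 0 * n + s'.int 16 0) = 0 ∧
      (s'.int 14 0 = 1 ↔ s.int 6 (s'.int 15 0 * n + s'.int 16 0) = 0)) ∧
      (∀ u v, (u < k ∨ u = k ∧ v < l) → v < n → 1 ≤ g u v → s.int 7 (u * n + v) = 0 →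
        s'.int 14 0 ≠ 0 ∧ (s.int 6 (u * n + v) ≠ 0 → s'.int 14 0 ≠ 1)))
    (by simp) (by simp) (by simp) ?_ ?_
  · change IsPick n g s (Cmd.run n _ _)
    exact ⟨fun h => ⟨(key.1 h).1, (key.1 h).2.1⟩, fun h => (key.1 h).2.2.1,
      fun h => (key.1 h).2.2.2.1, fun h => (key.1 h).2.2.2.2,
      fun u hu v hv => key.2 u v (Or.inl hu) hv⟩
  · intro k s' hk hP
    exact ⟨hP.1, fun u v huv hv => hP.2 u v (by omega) hv⟩
  · intro k l s' hk hl hx hy hi hw ⟨hP, hQ⟩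
    have e0 : s'.int 0 0 = n := by rw [hi 0 (by decide)]; simp [h.size]
    have e4 : s'.int 4 (k * n + l) = g k l := by
      rw [hi 4 (by decide)]; simp [h.graph k hk l hl]
    have e6 : ∀ i, s'.int 6 i = s.int 6 i := fun i => by rw [hi 6 (by decide)]; simp
    have e7 : ∀ i, s'.int 7 i = s.int 7 i := fun i => by rw [hi 7 (by decide)]; simp
    clear hi hw
    simp only [run_ite, run_seq, run_iset, run_skip, holds_conj, holds_ile, holds_ieq, eval_get,
      eval_add, eval_mul, eval_ofNat, e0, hx, hy, e4, e6, e7]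
    have hQ' : ∀ u v, (u < k ∨ u = k ∧ v < l + 1) → (u < k ∨ u = k ∧ v < l) ∨ (u = k ∧ v = l) := by
      omega
    split_ifs with h1 h2 h3
    · simp only [Store.int_setInt, hx, hy]
      simp
      exact ⟨by omega, by omega, by omega, by omega, by omega⟩
    · simp only [Store.int_setInt, hx, hy]
      simp
      refine ⟨⟨hk, hl, h1.1, h1.2, by omega⟩, fun u v huv hv hg h7 => ?_⟩
      rcases hQ' u v (by omega) with h | ⟨rfl, rfl⟩
      · exact absurd h3 (hQ u v h hv hg h7).1
      · omega
    · refine ⟨hP, fun u v huv hv hg h7 => ?_⟩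
      rcases hQ' u v (by omega) with h | ⟨rfl, rfl⟩
      · exact hQ u v h hv hg h7
      · exact ⟨h3, fun h => absurd h (by omega)⟩
    · refine ⟨hP, fun u v huv hv hg h7 => ?_⟩
      rcases hQ' u v (by omega) with h | ⟨rfl, rfl⟩
      · exact hQ u v h hv hg h7
      · exact absurd ⟨hg, h7⟩ h1

open Classical in
theorem processArc_spec (h : HoldsGraph n g s) (hp : s.int 14 0 ≠ 0) (hx : s.int 15 0 < n)
    (hy : s.int 16 0 < n) (c : ℕ → ℕ → ℕ)
    (hc : ∀ u v, c u v = if s.int 14 0 = 1 ∧ u = s.int 15 0 ∧ v = s.int 16 0 then 1 else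
      s.int 6 (u * n + v))
    (hne : c (s.int 15 0) (s.int 16 0) ≠ 0) :
    ∀ u < n, ∀ v < n,
    (processArc.run n s).int 6 (u * n + v) =
      (if u = s.int 16 0 ∧ 1 ≤ g (s.int 16 0) v ∧ c (s.int 16 0) v = 0 then
        (if Differ (s.int 5 0) g (s.int 15 0) v then 3 - c (s.int 15 0) (s.int 16 0)
          else c (s.int 15 0) (s.int 16 0))
        else c u v) ∧
    (processArc.run n s).int 7 (u * n + v) =
      (if u = s.int 15 0 ∧ v = s.int 16 0 then 1 else s.int 7 (u * n + v)) := by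
  have h14 : 1 ≤ s.int 14 0 := by omega
  set s1 := Cmd.run n (when (ieq (reg 14) 1) (iset 6 (entry (reg 15) (reg 16)) 1) ;;
    iset 7 (entry (reg 15) (reg 16)) 1) s with hs1
  have k0 : ∀ a, a ≠ 6 → a ≠ 7 → ∀ i, s1.int a i = s.int a i := by
    intro a h6 h7 i
    exact int_run_of_notMem _ _ _ _ (by simp [imods, h6, h7]) _
  have k6 : ∀ u v, v < n → s1.int 6 (u * n + v) = c u v := by
    intro u v hv
    by_cases h1 : s.int 14 0 = 1
    · simp [hs1, h1, h.size, entry_inj hv hy, hc]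
    · simp [hs1, h1, h.size, entry_inj hv hy, hc]
  have k7 : ∀ u v, v < n → s1.int 7 (u * n + v) =
      if u = s.int 15 0 ∧ v = s.int 16 0 then 1 else s.int 7 (u * n + v) := by
    intro u v hv
    by_cases h1 : s.int 14 0 = 1
    · simp [hs1, h1, h.size, entry_inj hv hy]
    · simp [hs1, h1, h.size, entry_inj hv hy]
  have key := run_each_invariant (n := n) (s := s1) (x := 12)
    (p := when (conj (ile 1 (get 4 (entry (reg 16) (reg 12))))
        (ieq (get 6 (entry (reg 16) (reg 12))) 0))
      (.ite (differTest (reg 15) (reg 12))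
        (iset 6 (entry (reg 16) (reg 12)) (3 - get 6 (entry (reg 15) (reg 16))))
        (iset 6 (entry (reg 16) (reg 12)) (get 6 (entry (reg 15) (reg 16))))))
    (fun k s' => ∀ u v, v < n → s'.int 6 (u * n + v) =
      (if v < k ∧ u = s.int 16 0 ∧ 1 ≤ g (s.int 16 0) v ∧ c (s.int 16 0) v = 0 then
        (if Differ (s.int 5 0) g (s.int 15 0) v then 3 - c (s.int 15 0) (s.int 16 0)
          else c (s.int 15 0) (s.int 16 0))
        else c u v)) (by simp) (by simpa using k6) ?_
  · intro u hu v hv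
    have hrun : processArc.run n s = Cmd.run n (each 12 (when (conj
        (ile 1 (get 4 (entry (reg 16) (reg 12)))) (ieq (get 6 (entry (reg 16) (reg 12))) 0))
        (.ite (differTest (reg 15) (reg 12))
          (iset 6 (entry (reg 16) (reg 12)) (3 - get 6 (entry (reg 15) (reg 16))))
          (iset 6 (entry (reg 16) (reg 12)) (get 6 (entry (reg 15) (reg 16))))))) s1 := by
      rw [processArc, when, run_ite, if_pos (by simpa using h14)]
      rfl
    rw [hrun]
    refine ⟨?_, ?_⟩
    · have := key u v hv
      simpa only [hv, true_and] using this
    · rw [int_run_of_notMem _ _ _ _ (by decide), k7 u v hv]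
  · intro k s' hk hx' hi hw hP u v hv
    have hG : HoldsGraph n g s' := h.congr
      (fun i => by rw [hi 0 (by decide), k0 0 (by decide) (by decide)])
      (fun i => by rw [hi 4 (by decide), k0 4 (by decide) (by decide)])
    have e5 : s'.int 5 0 = s.int 5 0 := by rw [hi 5 (by decide), k0 5 (by decide) (by decide)]
    have e15 : s'.int 15 0 = s.int 15 0 := by
      rw [hi 15 (by decide), k0 15 (by decide) (by decide)]
    have e16 : s'.int 16 0 = s.int 16 0 := by
      rw [hi 16 (by decide), k0 16 (by decide) (by decide)]
    have hD : (differTest (reg 15) (reg 12)).Holds s' ↔ Differ (s.int 5 0) g (s.int 15 0) k := by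
      rw [holds_differTest hG (by simpa [e15] using hx) (by simpa [hx'] using hk)]
      simp [e15, e5, hx']
    have hA : s'.int 6 (s.int 16 0 * n + k) = c (s.int 16 0) k := by
      rw [hP _ _ hk]
      simp
    -- The loop reads the colour of the processed arc in every round. It never changes it, since
    -- only uncoloured arcs are written.
    have hB : s'.int 6 (s.int 15 0 * n + s.int 16 0) = c (s.int 15 0) (s.int 16 0) := by
      rw [hP _ _ hy, if_neg]
      rintro ⟨-, h1, -, h2⟩
      rw [h1] at hne
      exact hne h2
    have hg := hG.graph _ hy _ hk
    have hP' := hP u v hv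
    clear hi hw hP
    have hcases : v < k + 1 ↔ v < k ∨ v = k := by omega
    simp only [run_ite, run_iset, run_skip, holds_conj, holds_ile, holds_ieq, eval_get,
      eval_add, eval_mul, eval_sub, eval_ofNat, hG.size, hx', e15, e16, hD, hA, hB, hg]
    split_ifs with h1 h2 h3 h4 h5 h6 <;> (try simp only [Store.int_setInt, entry_inj hv hk]) <;> grind

theorem checkColours_spec (h : HoldsGraph n g s) :
    ((checkColours.run n s).int 8 0 = 0 ↔ ∀ u < n, ∀ v < n, ∀ j < n, 1 ≤ g u v → 1 ≤ g v j →
      (s.int 6 (u * n + v) ≠ s.int 6 (v * n + j) ↔ Differ (s.int 5 0) g u j)) := by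
  have key := run_each_flag (n := n) (s := (rset 8 0).run n s) (x := 10) (f := 8)
    (p := each 11 (when (ile 1 (get 4 (entry (reg 10) (reg 11))))
    (each 12 (when (ile 1 (get 4 (entry (reg 11) (reg 12))))
      (.ite (differTest (reg 10) (reg 12))
        (when (ieq (get 6 (entry (reg 10) (reg 11))) (get 6 (entry (reg 11) (reg 12)))) (rset 8 1))
        (when (neg (ieq (get 6 (entry (reg 10) (reg 11))) (get 6 (entry (reg 11) (reg 12)))))
          (rset 8 1))))))) (by decide)
    (fun u => ∀ v < n, 1 ≤ g u v → ∀ j < n, 1 ≤ g v j →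
      (s.int 6 (u * n + v) ≠ s.int 6 (v * n + j) ↔ Differ (s.int 5 0) g u j)) ?_
  · refine key.trans ⟨fun h u hu v hv j hj huv hvj => h.2 u hu v hv huv j hj hvj,
      fun h => ⟨by simp, fun u hu v hv huv j hj hvj => h u hu v hv j hj huv hvj⟩⟩
  intro u s1 hu hx1 hi1 _
  refine run_each_flag (by decide) _ ?_
  intro v s2 hv hx2 hi2 _
  have f2 : ∀ a, a ∉ [8, 10, 11, 12] → ∀ i, s2.int a i = s.int a i := by
    intro a ha i
    simp only [List.mem_cons, not_or] at ha
    rw [hi2 a (by simp [imods, ha]), hi1 a (by simp [imods, ha])]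
    simp [ha]
  have e10 : s2.int 10 0 = u := by rw [hi2 10 (by decide), hx1]
  have hG2 : HoldsGraph n g s2 := h.congr (f2 0 (by decide)) (f2 4 (by decide))
  clear hi2 hi1
  by_cases huv : 1 ≤ g u v
  · rw [when, run_ite, if_pos (by simpa [hG2.size, e10, hx2, hG2.graph u hu v hv] using huv)]
    simp only [huv, forall_const]
    refine run_each_flag (by decide) _ ?_
    intro j s3 hj hx3 hi3 _
    have f3 : ∀ a, a ∉ [8, 10, 11, 12] → ∀ i, s3.int a i = s.int a i := by
      intro a ha i
      rw [← f2 a ha]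
      simp only [List.mem_cons, not_or] at ha
      rw [hi3 a (by simp [imods, ha])]
    have e10' : s3.int 10 0 = u := by rw [hi3 10 (by decide), e10]
    have e11' : s3.int 11 0 = v := by rw [hi3 11 (by decide), hx2]
    have hG3 : HoldsGraph n g s3 := h.congr (f3 0 (by decide)) (f3 4 (by decide))
    have hD : (differTest (reg 10) (reg 12)).Holds s3 ↔ Differ (s.int 5 0) g u j := by
      rw [holds_differTest hG3 (by simpa [e10'] using hu) (by simpa [hx3] using hj)]
      simp [e10', hx3, f3 5 (by decide)]
    have h6 := f3 6 (by decide)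
    have hg := hG3.graph v hv j hj
    clear f3 f2 hi3
    simp only [when, run_ite, run_iset, run_skip, holds_neg, holds_ile, holds_ieq, eval_get,
      eval_add, eval_mul, eval_ofNat, hG3.size, hx3, e10', e11', hD, hg, h6]
    split_ifs with h1 h2 h3 h4
    · rw [hD] at h2; simp [h1, h2, h3]
    · rw [hD] at h2; simp [h1, h2, h3]
    · rw [hD] at h2; simp [h1, h2, h4]
    · rw [hD] at h2; simp [h1, h2]; tauto
    · simp [h1]
  · rw [when, run_ite, if_neg (by simpa [hG2.size, e10, hx2, hG2.graph u hu v hv] using huv)]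
    simp [huv]

/-- At the end all arcs are coloured. If some correct colouring exists, then the invariant
transforms it into one that agrees with the computed colours everywhere, so the final check cannot
fail. It is this check that makes propagation without any test for conflicts legitimate. -/
theorem colourArcs_spec (h : HoldsGraph n g s) (hg : ∀ u < n, ∀ v < n, g u v = g v u) :
    ((colourArcs.run n s).int 8 0 = 0 ↔ ∃ f, IsArcColouring n (s.int 5 0) g f) ∧
    ((colourArcs.run n s).int 8 0 = 0 → IsArcColouring n (s.int 5 0) g
      fun u v => (colourArcs.run n s).int 6 (u * n + v)) := by
  set s1 := clearColours.run n s with hs1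
  have f1 : ∀ a, a ∉ [6, 7, 10, 11] → ∀ i, s1.int a i = s.int a i := by
    intro a ha i
    simp only [List.mem_cons, not_or] at ha
    exact int_run_of_notMem _ _ _ _ (by simp [clearColours, imods, ha]) _
  have hz := clearColours_spec h
  rw [← hs1] at hz
  -- Each round processes a new arc or finds that none is left. Since there are at most `n ^ 2`
  -- arcs, either alternative shows after `n ^ 2` rounds that all arcs are processed.
  have main := run_rep_invariant (n := n) (o := 0) (d := 2) (s := s1) (x := 13)
    (p := pickArc ;; processArc)
    (fun k s' => ColourInvariant n (s.int 5 0) g (fun u v => s'.int 6 (u * n + v))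
      (fun u v => s'.int 7 (u * n + v)) ∧
      (k ≤ (((Finset.range n) ×ˢ (Finset.range n)).filter
        fun e => s'.int 7 (e.1 * n + e.2) ≠ 0).card ∨
      ∀ u < n, ∀ v < n, 1 ≤ g u v → s'.int 7 (u * n + v) ≠ 0)) (by simp) ?_ ?_
  · set s2 := Cmd.run n (.rep 13 0 2 (pickArc ;; processArc)) s1 with hs2
    have f2 : ∀ a, a ∉ [6, 7, 10, 11, 12, 13, 14, 15, 16] → ∀ i, s2.int a i = s.int a i := by
      intro a ha i
      simp only [List.mem_cons, not_or] at ha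
      rw [hs2, int_run_of_notMem _ _ _ _ (by simp [pickArc, processArc, imods, ha]), f1]
      simp [ha]
    have hrun : colourArcs.run n s = checkColours.run n s2 := rfl
    have h6 : ∀ i, (colourArcs.run n s).int 6 i = s2.int 6 i := fun i => by
      rw [hrun, int_run_of_notMem _ _ _ _ (by decide)]
    obtain ⟨hI, hall⟩ := main
    have hall : ∀ u < n, ∀ v < n, 1 ≤ g u v → s2.int 7 (u * n + v) ≠ 0 := by
      rcases hall with h1 | h1
      · have h2 : ((Finset.range n) ×ˢ (Finset.range n)).card ≤ (n + 0) ^ 2 := by simp [sq]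
        have h3 := Finset.eq_of_subset_of_card_le (Finset.filter_subset _ _) (h2.trans h1)
        intro u hu v hv _
        have : (u, v) ∈ (Finset.range n) ×ˢ (Finset.range n) := by simp [hu, hv]
        rw [← h3, Finset.mem_filter] at this
        exact this.2
      · exact h1
    have hcol : ∀ u < n, ∀ v < n, 1 ≤ g u v → s2.int 6 (u * n + v) ≠ 0 :=
      fun u hu v hv huv => (hI.closed u hu v hv huv (hall u hu v hv huv)).1
    have hcheck := checkColours_spec (h.congr (f2 0 (by decide)) (f2 4 (by decide)))
    rw [f2 5 (by decide), ← hrun] at hcheck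
    have hok : (colourArcs.run n s).int 8 0 = 0 → IsArcColouring n (s.int 5 0) g
        fun u v => (colourArcs.run n s).int 6 (u * n + v) := by
      intro h0
      simp only [h6]
      refine ⟨fun u hu v hv huv => ?_, hcheck.1 h0⟩
      have h1 := hcol u hu v hv huv
      have h2 := hI.range u hu v hv huv
      omega
    refine ⟨⟨fun h0 => ⟨_, hok h0⟩, fun ⟨f, hf⟩ => ?_⟩, hok⟩
    obtain ⟨f', hf', hff⟩ := hI.extends_ f hf
    rw [hcheck]
    intro u hu v hv j hj huv hvj
    rw [← hff u hu v hv huv (hcol u hu v hv huv), ← hff v hv j hj hvj (hcol v hv j hj hvj)]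
    exact hf'.differ u hu v hv j hj huv hvj
  · refine ⟨⟨fun u hu v hv huv => by simp [hz u hu v hv], fun u hu v hv huv hne => ?_,
      fun f hf => ⟨f, hf, fun u hu v hv huv hne => ?_⟩⟩, Or.inl (Nat.zero_le _)⟩
    · exact absurd (hz u hu v hv).2 hne
    · exact absurd (hz u hu v hv).1 hne
  · rintro k s2 hk hx hi - ⟨hI, hcard⟩
    have f2 : ∀ a, a ∉ [6, 7, 10, 11, 12, 13, 14, 15, 16] → ∀ i, s2.int a i = s.int a i := by
      intro a ha i
      simp only [List.mem_cons, not_or] at ha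
      rw [hi a (by simp [pickArc, processArc, imods, ha]), f1]
      simp [ha]
    clear hi
    have hG2 : HoldsGraph n g s2 := h.congr (f2 0 (by decide)) (f2 4 (by decide))
    have hpick := pickArc_spec hG2
    rw [run_seq]
    set s3 := pickArc.run n s2 with hs3
    have f3 : ∀ a, a ∉ [10, 11, 14, 15, 16] → ∀ i, s3.int a i = s2.int a i := by
      intro a ha i
      simp only [List.mem_cons, not_or] at ha
      exact int_run_of_notMem _ _ _ _ (by simp [pickArc, imods, ha]) _
    by_cases h14 : s3.int 14 0 = 0
    · have hrun : processArc.run n s3 = s3 := by simp [processArc, h14]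
      rw [hrun]
      simp only [f3 6 (by decide), f3 7 (by decide)]
      refine ⟨hI, Or.inr fun u hu v hv huv h0 => (hpick.all u hu v hv huv h0).1 h14⟩
    · obtain ⟨hx, hy⟩ := hpick.lt h14
      have harc := hpick.arc h14
      have hG3 : HoldsGraph n g s3 := hG2.congr (f3 0 (by decide)) (f3 4 (by decide))
      set c : ℕ → ℕ → ℕ := fun u v => if s3.int 14 0 = 1 ∧ u = s3.int 15 0 ∧ v = s3.int 16 0 then 1
        else s3.int 6 (u * n + v) with hc
      have h6 := f3 6 (by decide)
      have h7 := f3 7 (by decide)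
      have hcI : ColourInvariant n (s.int 5 0) g c (fun u v => s2.int 7 (u * n + v)) := by
        by_cases h1 : s3.int 14 0 = 1
        · have := hI.start hg hx hy harc ((hpick.coloured h14).1 h1)
            (fun u hu v hv huv hne h0 => (hpick.all u hu v hv huv h0).2 hne h1)
          simpa [hc, h1, h6] using this
        · simpa [hc, h1, h6] using hI
      have hne : c (s3.int 15 0) (s3.int 16 0) ≠ 0 := by
        by_cases h1 : s3.int 14 0 = 1
        · simp [hc, h1]
        · simpa [hc, h1, h6] using mt (hpick.coloured h14).2 h1
      have hspec := processArc_spec hG3 h14 hx hy c (fun u v => rfl) hne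
      have h5 : s3.int 5 0 = s.int 5 0 := by rw [f3 5 (by decide), f2 5 (by decide)]
      rw [h5] at hspec
      refine ⟨hcI.spread hx hy harc hne (fun u hu v hv => (hspec u hu v hv).1)
        (fun u hu v hv => by rw [(hspec u hu v hv).2, h7]), ?_⟩
      rcases hcard with hcard | hall
      · left
        refine Nat.succ_le_of_lt (hcard.trans_lt (Finset.card_lt_card ?_))
        rw [Finset.ssubset_iff_of_subset]
        · refine ⟨(s3.int 15 0, s3.int 16 0), ?_, ?_⟩
          · simp [hx, hy, (hspec _ hx _ hy).2]
          · simp [hpick.fresh h14]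
        · intro e he
          simp only [Finset.mem_filter, Finset.mem_product, Finset.mem_range] at he ⊢
          refine ⟨he.1, ?_⟩
          rw [(hspec _ he.1.1 _ he.1.2).2, h7]
          split_ifs
          · omega
          · exact he.2
      · exact absurd (hpick.fresh h14) (hall _ hx _ hy harc)

end Spec

end RAM

namespace RAM

open Cmd IExp Test

variable {K : Type*} [AddCommGroup K] [LinearOrder K]

/-! ### Stable sets of maximum weight in bipartite graphs -/

/-- `a` is the maximum weight of a stable set. -/
def IsMaxStableWeight (n : ℕ) (g : ℕ → ℕ → ℕ) (w : ℕ → K) (a : K) : Prop :=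
  IsGreatest {x | ∃ S ⊆ Finset.range n, (∀ u ∈ S, ∀ v ∈ S, u ≠ v → g u v = 0) ∧
    x = ∑ v ∈ S, w v} a

section Flow

open Finset

/-- The invariant of the preflow algorithm, for the excess `ex`, the residual capacities `r` and the
heights `h`, with initial excess `e` and capacities `c`. -/
structure FlowInvariant (n : ℕ) (e : ℕ → K) (c : ℕ → ℕ → K) (ex : ℕ → K) (r : ℕ → ℕ → K)
    (h : ℕ → ℕ) : Prop where
  nonneg : ∀ u < n, ∀ v < n, 0 ≤ r u v
  valid : ∀ u < n, ∀ v < n, 0 < r u v → h u ≤ h v + 1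
  deficit : ∀ u < n, ex u < 0 → h u = 0
  height_le : ∀ u < n, h u ≤ n + 1
  antisymm : ∀ u < n, ∀ v < n, r u v + r v u = c u v + c v u
  balance : ∀ u < n, ex u = e u - ∑ v ∈ range n, (c u v - r u v)

variable [IsOrderedAddMonoid K] {n : ℕ} {e ex : ℕ → K} {c r : ℕ → ℕ → K} {h : ℕ → ℕ}

omit [IsOrderedAddMonoid K] in
theorem FlowInvariant.congr (H : FlowInvariant n e c ex r h) {ex' : ℕ → K} {r' : ℕ → ℕ → K}
    {h' : ℕ → ℕ} (hex : ∀ u < n, ex' u = ex u) (hr : ∀ u < n, ∀ v < n, r' u v = r u v)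
    (hh : ∀ u < n, h' u = h u) : FlowInvariant n e c ex' r' h' where
  nonneg u hu v hv := by rw [hr u hu v hv]; exact H.nonneg u hu v hv
  valid u hu v hv := by rw [hr u hu v hv, hh u hu, hh v hv]; exact H.valid u hu v hv
  deficit u hu := by rw [hex u hu, hh u hu]; exact H.deficit u hu
  height_le u hu := by rw [hh u hu]; exact H.height_le u hu
  antisymm u hu v hv := by rw [hr u hu v hv, hr v hv u hu]; exact H.antisymm u hu v hv
  balance u hu := by
    rw [hex u hu, H.balance u hu]
    congr 1
    exact sum_congr rfl fun v hv => by rw [hr u hu v (mem_range.1 hv)]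

/-- The only arc that may newly get residual capacity leads one level up, so heights remain valid.
Since at most the excess of `x` is sent, `x` does not run into a deficit, and `y` has a deficit
afterwards only if it had one before. -/
theorem FlowInvariant.push (H : FlowInvariant n e c ex r h) {x y : ℕ} (hx : x < n) (hy : y < n)
    (hxy : h x = h y + 1) {d : K} (h0 : 0 ≤ d) (hr : d ≤ r x y) (hd : d ≤ ex x)
    {ex' : ℕ → K} {r' : ℕ → ℕ → K}
    (hex' : ∀ u < n, ex' u = if u = x then ex x - d else if u = y then ex y + d else ex u)
    (hr' : ∀ u < n, ∀ v < n, r' u v = if u = x ∧ v = y then r x y - d else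
      if u = y ∧ v = x then r y x + d else r u v) :
    FlowInvariant n e c ex' r' h := by
  have hne : x ≠ y := by rintro rfl; omega
  have hne' := hne.symm
  refine ⟨fun u hu v hv => ?_, fun u hu v hv => ?_, fun u hu => ?_, H.height_le,
    fun u hu v hv => ?_, fun u hu => ?_⟩
  · rw [hr' u hu v hv]
    split_ifs with h1 h2
    · exact sub_nonneg.2 hr
    · exact add_nonneg (H.nonneg y hy x hx) h0
    · exact H.nonneg u hu v hv
  · rw [hr' u hu v hv]
    split_ifs with h1 h2
    · intro _; rw [h1.1, h1.2]; omega
    · intro _; rw [h2.1, h2.2]; omega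
    · exact H.valid u hu v hv
  · rw [hex' u hu]
    split_ifs with h1 h2
    · intro hlt
      exact absurd (sub_nonneg.2 hd) (not_le.2 hlt)
    · intro hlt
      rw [h2]
      exact H.deficit y hy (lt_of_le_of_lt (le_add_of_nonneg_right h0) hlt)
    · exact H.deficit u hu
  · rw [← H.antisymm u hu v hv, hr' u hu v hv, hr' v hv u hu]
    by_cases h1 : u = x ∧ v = y
    · obtain ⟨rfl, rfl⟩ := h1
      simp [hne]
    · by_cases h2 : u = y ∧ v = x
      · obtain ⟨rfl, rfl⟩ := h2
        simp [hne]
      · simp [h1, h2, and_comm]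
  · rw [hex' u hu]
    by_cases h1 : u = x
    · subst h1
      have : ∀ v ∈ range n, c u v - r' u v = c u v - r u v + if v = y then d else 0 := by
        intro v hv
        rw [hr' u hu v (mem_range.1 hv)]
        by_cases h2 : v = y
        · subst h2; simp; abel
        · simp [h2, hne]
      rw [if_pos rfl, sum_congr rfl this, sum_add_distrib, H.balance u hu]
      simp [hy]
      abel
    · by_cases h1 : u = y
      · subst h1
        have : ∀ v ∈ range n, c u v - r' u v = c u v - r u v - if v = x then d else 0 := by
          intro v hv
          rw [hr' u hu v (mem_range.1 hv)]
          by_cases h2 : v = x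
          · subst h2; simp [hne']; abel
          · simp [h2, hne']
        rw [if_neg hne', if_pos rfl, sum_congr rfl this, sum_sub_distrib, H.balance u hu]
        simp [hx]
        abel
      · have : ∀ v ∈ range n, c u v - r' u v = c u v - r u v := by
          intro v hv
          rw [hr' u hu v (mem_range.1 hv), if_neg (by tauto), if_neg (by tauto)]
        rw [if_neg (by tauto), if_neg (by tauto), sum_congr rfl this, H.balance u hu]

-- A vertex whose admissible arcs are all saturated can go up by one level: its residual arcs do not
-- yet descend, so they descend by at most one level afterwards. Deficits stay at height `0` because
-- `x` has positive excess.
omit [IsOrderedAddMonoid K] in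
theorem FlowInvariant.relabel (H : FlowInvariant n e c ex r h) {x : ℕ} (hx : x < n)
    (hpos : 0 < ex x) (hle : h x ≤ n) (hadm : ∀ u < n, h x = h u + 1 → r x u = 0) {h' : ℕ → ℕ}
    (hh' : ∀ u < n, h' u = if u = x then h x + 1 else h u) : FlowInvariant n e c ex r h' := by
  refine ⟨H.nonneg, fun u hu v hv hr => ?_, fun u hu hlt => ?_, fun u hu => ?_, H.antisymm,
    H.balance⟩
  · have h1 := H.valid u hu v hv hr
    rw [hh' u hu, hh' v hv]
    have h2 : u = x → h u ≠ h v + 1 := by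
      rintro rfl h3
      rw [hadm v hv h3] at hr
      exact lt_irrefl _ hr
    split_ifs with h3 h4 h4
    · subst h3; omega
    · subst h3; have := h2 rfl; omega
    · subst h4; omega
    · exact h1
  · rw [hh' u hu]
    split_ifs with h1
    · subst h1
      exact absurd hlt (not_lt.2 hpos.le)
    · exact H.deficit u hu hlt
  · rw [hh' u hu]
    split_ifs
    · omega
    · exact H.height_le u hu

/-- The net flow across a cut. -/
theorem FlowInvariant.cut (H : FlowInvariant n e c ex r h) (p : ℕ → Prop) [DecidablePred p] :
    ∑ v ∈ range n with ¬ p v, ex v = ∑ v ∈ range n with ¬ p v, e v +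
      ∑ u ∈ range n with p u, ∑ v ∈ range n with ¬ p v, (c u v - r u v) := by
  have hanti : ∀ u < n, ∀ v < n, c u v - r u v = -(c v u - r v u) := by
    intro u hu v hv
    have := H.antisymm u hu v hv
    rw [neg_sub, sub_eq_sub_iff_add_eq_add, ← this]
    abel
  have h1 : ∑ v ∈ range n with ¬ p v, ex v = ∑ v ∈ range n with ¬ p v, e v -
      ∑ v ∈ range n with ¬ p v, ∑ u ∈ range n, (c v u - r v u) := by
    rw [← sum_sub_distrib]
    exact sum_congr rfl fun v hv => H.balance v (mem_range.1 (mem_filter.1 hv).1)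
  -- The net flow is antisymmetric, so the flow inside one side of the cut equals its own negative
  -- and vanishes.
  have h2 : ∑ v ∈ range n with ¬ p v, ∑ u ∈ range n with ¬ p u, (c v u - r v u) = 0 := by
    rw [← self_eq_neg]
    conv_lhs => rw [sum_comm]
    rw [← sum_neg_distrib]
    refine sum_congr rfl fun v hv => ?_
    rw [← sum_neg_distrib]
    exact sum_congr rfl fun u hu =>
      hanti u (mem_range.1 (mem_filter.1 hu).1) v (mem_range.1 (mem_filter.1 hv).1)
  have h3 : ∑ v ∈ range n with ¬ p v, ∑ u ∈ range n, (c v u - r v u) =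
      - ∑ u ∈ range n with p u, ∑ v ∈ range n with ¬ p v, (c u v - r u v) := by
    have : ∀ v ∈ (range n).filter (¬ p ·), ∑ u ∈ range n, (c v u - r v u) =
        ∑ u ∈ range n with p u, (c v u - r v u) + ∑ u ∈ range n with ¬ p u, (c v u - r v u) :=
      fun v _ => (sum_filter_add_sum_filter_not _ _ _).symm
    rw [sum_congr rfl this, sum_add_distrib, h2, add_zero, sum_comm, ← sum_neg_distrib]
    refine sum_congr rfl fun v hv => ?_
    rw [← sum_neg_distrib]
    exact sum_congr rfl fun u hu =>
      hanti u (mem_range.1 (mem_filter.1 hu).1) v (mem_range.1 (mem_filter.1 hv).1)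
  rw [h1, h3, sub_neg_eq_add]

/-- When no vertex of height at most `n` has a positive excess, the preflow determines the maximum
weight of a stable set. -/
theorem FlowInvariant.isMaxStableWeight {g : ℕ → ℕ → ℕ} {w : ℕ → K} {side : ℕ → ℕ}
    (hw : ∀ u < n, 0 ≤ w u) (hg : ∀ u < n, ∀ v < n, g u v = g v u)
    (hside : ∀ u < n, ∀ v < n, 1 ≤ g u v → (side u = 1 ↔ side v ≠ 1))
    (H : FlowInvariant n (fun u => if side u = 1 then w u else - w u)
      (fun u v => if side u = 1 ∧ 1 ≤ g u v then ∑ u ∈ range n, w u else 0) ex r h)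
    (hend : ∀ u < n, 0 < ex u → h u = n + 1) :
    IsMaxStableWeight n g w
      (∑ u ∈ range n, (if side u = 1 then w u else 0) - ∑ u ∈ range n, min (ex u) 0) := by
  classical
  set W := ∑ u ∈ range n, w u with hW
  have hW0 : 0 ≤ W := sum_nonneg fun u hu => hw u (mem_range.1 hu)
  set O := ∑ u ∈ range n, (if side u = 1 then w u else 0) - ∑ u ∈ range n, min (ex u) 0 with hO
  have key : ∀ (p : ℕ → Prop) [DecidablePred p], ∑ u ∈ range n, (if side u = 1 then w u else 0) -
      ∑ u ∈ range n with ¬ p u, (if side u = 1 then w u else - w u) =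
      ∑ u ∈ range n with (side u = 1 ∧ p u) ∨ (side u ≠ 1 ∧ ¬ p u), w u := by
    intro p _
    rw [sum_filter, sum_filter, ← sum_sub_distrib]
    refine sum_congr rfl fun u _ => ?_
    by_cases h1 : side u = 1 <;> by_cases h2 : p u <;> simp [h1, h2]
  have upper : ∀ S ⊆ range n, (∀ u ∈ S, ∀ v ∈ S, u ≠ v → g u v = 0) → ∑ v ∈ S, w v ≤ O := by
    intro S hS hstable
    -- The cut that belongs to `S`: an arc of positive capacity from `p` to its complement would
    -- join two vertices of the stable set. Weak duality for this cut bounds the weight of `S`.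
    set p : ℕ → Prop := fun u => (side u = 1 ∧ u ∈ S) ∨ (side u ≠ 1 ∧ u ∉ S) with hp
    have h1 := H.cut p
    have h2 : ∑ u ∈ range n with p u, ∑ v ∈ range n with ¬ p v,
        ((if side u = 1 ∧ 1 ≤ g u v then W else 0) - r u v) ≤ 0 := by
      refine sum_nonpos fun u hu => sum_nonpos fun v hv => ?_
      simp only [mem_filter, mem_range] at hu hv
      rw [if_neg]
      · simpa using H.nonneg u hu.1 v hv.1
      · rintro ⟨h3, h4⟩
        have h5 := (hside u hu.1 v hv.1 h4).1 h3
        have h6 : u ∈ S := by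
          rcases hu.2 with h7 | h7
          · exact h7.2
          · exact absurd h3 h7.1
        have h7 : v ∈ S := by
          by_contra h7
          exact hv.2 (Or.inr ⟨h5, h7⟩)
        have := hstable u h6 v h7 (by rintro rfl; exact h5 h3)
        omega
    have h3 : ∑ u ∈ range n, min (ex u) 0 ≤ ∑ v ∈ range n with ¬ p v, ex v := by
      rw [← sum_filter_add_sum_filter_not (range n) p]
      have h4 : ∑ u ∈ range n with p u, min (ex u) 0 ≤ 0 := sum_nonpos fun u _ => min_le_right _ _
      have h5 : ∑ u ∈ range n with ¬ p u, min (ex u) 0 ≤ ∑ v ∈ range n with ¬ p v, ex v :=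
        sum_le_sum fun u _ => min_le_left _ _
      simpa using add_le_add h4 h5
    have h4 : S = (range n).filter fun u => (side u = 1 ∧ p u) ∨ (side u ≠ 1 ∧ ¬ p u) := by
      ext u
      simp only [mem_filter, mem_range, hp]
      constructor
      · intro hu
        have := mem_range.1 (hS hu)
        tauto
      · tauto
    rw [h4, ← key p, hO]
    refine sub_le_sub_left (h3.trans ?_) _
    rw [h1]
    exact add_le_of_nonpos_right h2
  refine ⟨?_, ?_⟩
  swap
  · rintro _ ⟨S, hS, hstable, rfl⟩
    exact upper S hS hstable
  -- There are `n + 1` levels from `0` to `n` but only `n` vertices, so some level `γ` is empty. By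
  -- validity no residual arc jumps across it. Positive excess lies above it, at height `n + 1`, and
  -- deficits lie below it, at height `0`; so the cut at `γ` is saturated and optimal.
  obtain ⟨γ, hγ, hgap⟩ : ∃ γ ∈ range (n + 1), γ ∉ (range n).image h :=
    exists_mem_notMem_of_card_lt_card (card_image_le.trans_lt (by simp))
  rw [mem_range] at hγ
  have hgap : ∀ u < n, h u ≠ γ := fun u hu heq =>
    hgap (mem_image.2 ⟨u, mem_range.2 hu, heq⟩)
  have h1 := H.cut (fun u => γ < h u)
  have h2 : ∑ u ∈ range n, min (ex u) 0 = ∑ v ∈ range n with ¬ γ < h v, ex v := by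
    rw [← sum_filter_add_sum_filter_not (range n) (fun u => γ < h u)]
    have h4 : ∑ u ∈ range n with γ < h u, min (ex u) 0 = 0 := by
      refine sum_eq_zero fun u hu => min_eq_right ?_
      simp only [mem_filter, mem_range] at hu
      by_contra hlt
      have := H.deficit u hu.1 (not_le.1 hlt)
      omega
    rw [h4, zero_add]
    refine sum_congr rfl fun u hu => min_eq_left ?_
    simp only [mem_filter, mem_range] at hu
    by_contra hlt
    have := hend u hu.1 (not_le.1 hlt)
    omega
  have h3 : ∑ u ∈ range n with γ < h u, ∑ v ∈ range n with ¬ γ < h v,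
      ((if side u = 1 ∧ 1 ≤ g u v then W else 0) - r u v) =
      ∑ u ∈ range n with γ < h u, ∑ v ∈ range n with ¬ γ < h v,
        (if side u = 1 ∧ 1 ≤ g u v then W else 0) := by
    refine sum_congr rfl fun u hu => sum_congr rfl fun v hv => ?_
    simp only [mem_filter, mem_range] at hu hv
    have h4 : r u v = 0 := by
      by_contra hne
      have := H.valid u hu.1 v hv.1 (lt_of_le_of_ne (H.nonneg u hu.1 v hv.1) (Ne.symm hne))
      have := hgap v hv.1
      omega
    rw [h4, sub_zero]
  rw [h3, ← h2] at h1
  have h4 : O = ∑ u ∈ range n with (side u = 1 ∧ γ < h u) ∨ (side u ≠ 1 ∧ ¬ γ < h u), w u -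
      ∑ u ∈ range n with γ < h u, ∑ v ∈ range n with ¬ γ < h v,
        (if side u = 1 ∧ 1 ≤ g u v then W else 0) := by
    rw [hO, h1, ← key (fun u => γ < h u), sub_add_eq_sub_sub]
  -- If an arc of capacity `W` crosses the cut, then the value is at most `0`, and the empty set
  -- attains it. Otherwise the cut defines a stable set.
  by_cases hcross : ∃ u < n, ∃ v < n, side u = 1 ∧ γ < h u ∧ ¬ γ < h v ∧ 1 ≤ g u v
  · obtain ⟨u, hu, v, hv, h5, h6, h7, h8⟩ := hcross
    have h9 : W ≤ ∑ u ∈ range n with γ < h u, ∑ v ∈ range n with ¬ γ < h v,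
        (if side u = 1 ∧ 1 ≤ g u v then W else 0) := by
      have hnn : ∀ a b, 0 ≤ (if side a = 1 ∧ 1 ≤ g a b then W else 0) := by
        intro a b; split_ifs <;> simp [hW0]
      refine le_trans ?_ (single_le_sum (fun a _ => sum_nonneg fun b _ => hnn a b)
        (mem_filter.2 ⟨mem_range.2 hu, h6⟩))
      refine le_trans ?_ (single_le_sum (fun b _ => hnn u b)
        (mem_filter.2 ⟨mem_range.2 hv, h7⟩))
      rw [if_pos ⟨h5, h8⟩]
    have h10 : ∑ u ∈ range n with (side u = 1 ∧ γ < h u) ∨ (side u ≠ 1 ∧ ¬ γ < h u), w u ≤ W :=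
      sum_le_sum_of_subset_of_nonneg (filter_subset _ _) fun u hu _ => hw u (mem_range.1 hu)
    refine ⟨∅, empty_subset _, by simp, ?_⟩
    refine le_antisymm ?_ (upper ∅ (empty_subset _) (by simp))
    rw [h4, sum_empty, sub_nonpos]
    exact h10.trans h9
  · push Not at hcross
    refine ⟨_, filter_subset (fun u => (side u = 1 ∧ γ < h u) ∨ (side u ≠ 1 ∧ ¬ γ < h u)) (range n),
      ?_, ?_⟩
    rotate_left
    · rw [h4, sub_eq_self]
      refine sum_eq_zero fun u hu => sum_eq_zero fun v hv => ?_
      simp only [mem_filter, mem_range] at hu hv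
      rw [if_neg]
      rintro ⟨h5, h6⟩
      exact absurd (hcross u hu.1 v hv.1 h5 hu.2 (not_lt.1 hv.2)) (by omega)
    · intro u hu v hv _
      simp only [mem_filter, mem_range] at hu hv
      by_contra hne
      have huv : 1 ≤ g u v := by omega
      have hvu : 1 ≤ g v u := by rwa [← hg u hu.1 v hv.1]
      have h5 := hside u hu.1 v hv.1 huv
      rcases hu.2 with ⟨h6, h7⟩ | ⟨h6, h7⟩ <;> rcases hv.2 with ⟨h8, h9⟩ | ⟨h8, h9⟩
      · tauto
      · exact absurd (hcross u hu.1 v hv.1 h6 h7 (not_lt.1 h9)) (by omega)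
      · exact absurd (hcross v hv.1 u hu.1 h8 h9 (not_lt.1 h7)) (by omega)
      · tauto

end Flow

end RAM

/-! ### The preflow program for bipartite graphs. -/

namespace RAM

open Cmd IExp Test

variable {K : Type*} [AddCommGroup K] [LinearOrder K]

/-- The excess of the vertices, in weight array `2`. -/
abbrev exOf (s : Store K) : ℕ → K := fun u => s.wt 2 u

/-- The residual capacities, in weight array `3`. -/
abbrev resOf (n : ℕ) (s : Store K) : ℕ → ℕ → K := fun u v => s.wt 3 (u * n + v)

/-- The heights, in integer array `18`. -/
abbrev heightOf (s : Store K) : ℕ → ℕ := fun u => s.int 18 u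

/-- The side of a vertex, in array `17`, is the colour of the arcs that leave it. -/
def computeSides : Cmd :=
  each 10 (iset 17 (reg 10) 1 ;; each 11 (when (ile 1 (get 4 (entry (reg 10) (reg 11))))
    (iset 17 (reg 10) (get 6 (entry (reg 10) (reg 11))))))

/-- Weight register `4` becomes the total weight. -/
def computeTotal : Cmd :=
  .wset 4 0 0 ;; each 10 (.wset 4 0 (.reg 4 + .get 0 (reg 10)))

/-- Initialize excess and heights. -/
def initExcess : Cmd :=
  each 10 (iset 18 (reg 10) 0 ;;
    .ite (ieq (get 17 (reg 10)) 1) (.wset 2 (reg 10) (.get 0 (reg 10)))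
      (.wset 2 (reg 10) (0 - .get 0 (reg 10))))

/-- Initialize the residual capacities. -/
def initResidual : Cmd :=
  each 10 (each 11 (.ite (conj (ieq (get 17 (reg 10)) 1) (ile 1 (get 4 (entry (reg 10) (reg 11)))))
    (.wset 3 (entry (reg 10) (reg 11)) (.reg 4)) (.wset 3 (entry (reg 10) (reg 11)) 0)))

/-- Find a highest vertex (register `20`) among those of positive excess and height at most `n`;
register `19` becomes `0` if there is none. -/
def pickActive : Cmd :=
  rset 19 0 ;;
  each 10 (when (conj (wlt 0 (.get 2 (reg 10))) (conj (ile (get 18 (reg 10)) size)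
    (disj (ieq (reg 19) 0) (ilt (get 18 (reg 20)) (get 18 (reg 10))))))
    (rset 19 1 ;; rset 20 (reg 10)))

/-- Push the amount in weight register `8` from vertex `x` to vertex `y`. -/
def pushAmount (x y : IExp) : Cmd :=
  .wset 3 (entry x y) (.get 3 (entry x y) - .reg 8) ;;
  .wset 3 (entry y x) (.get 3 (entry y x) + .reg 8) ;;
  .wset 2 x (.get 2 x - .reg 8) ;;
  .wset 2 y (.get 2 y + .reg 8)

/-- Push from the vertex in register `20` to all admissible vertices. -/
def pushAll : Cmd :=
  each 11 (when (ieq (get 18 (reg 20)) (get 18 (reg 11) + 1)) (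
    .ite (wle (.get 2 (reg 20)) (.get 3 (entry (reg 20) (reg 11))))
      (.wset 8 0 (.get 2 (reg 20))) (.wset 8 0 (.get 3 (entry (reg 20) (reg 11)))) ;;
    pushAmount (reg 20) (reg 11)))

/-- Push from the chosen vertex, and raise it if some excess remains. -/
def discharge : Cmd :=
  when (ieq (reg 19) 1) (pushAll ;; when (wlt 0 (.get 2 (reg 20))) (.incr 18 (reg 20)))

/-- Weight register `1` becomes the maximum weight of a stable set. -/
def readFlow : Cmd :=
  .wset 1 0 0 ;;
  each 10 (when (ieq (get 17 (reg 10)) 1) (.wset 1 0 (.reg 1 + .get 0 (reg 10))) ;;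
    when (wlt (.get 2 (reg 10)) 0) (.wset 1 0 (.reg 1 - .get 2 (reg 10))))

/-- The maximum weight of a stable set in a bipartite graph whose arcs are coloured. -/
def solveBipartite : Cmd :=
  computeSides ;; computeTotal ;; initExcess ;; initResidual ;;
  .rep 13 1 3 (pickActive ;; discharge) ;; readFlow

/-! ### Correctness of the preflow program and the number of its rounds. -/

section Spec

variable {n : ℕ} {g : ℕ → ℕ → ℕ} {s : Store K}

/-- All arcs that leave `u` have the same colour, since each of them differs from an arc that enters
`u` and there are only two colours. The last neighbour scanned therefore decides, and isolated
vertices keep the harmless default `1`. -/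
theorem computeSides_spec (hg : ∀ u < n, ∀ v < n, g u v = g v u) (h : HoldsGraph n g s)
    (hc : IsArcColouring n 0 g fun u v => s.int 6 (u * n + v)) :
    ∀ u < n, ∀ v < n, 1 ≤ g u v → (computeSides.run n s).int 17 u = s.int 6 (u * n + v) := by
  have key := run_each_invariant (n := n) (s := s) (x := 10)
    (p := iset 17 (reg 10) 1 ;; each 11 (when (ile 1 (get 4 (entry (reg 10) (reg 11))))
      (iset 17 (reg 10) (get 6 (entry (reg 10) (reg 11))))))
    (fun k s' => ∀ u < k, ∀ v < n, 1 ≤ g u v → s'.int 17 u = s.int 6 (u * n + v))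
    (by simp) (by simp) ?_
  · exact key
  intro k s1 hk hx hi hw hP
  set s2 := Cmd.run n (iset 17 (reg 10) 1) s1 with hs2
  have key := run_each_invariant (n := n) (s := s2) (x := 11)
    (p := when (ile 1 (get 4 (entry (reg 10) (reg 11))))
      (iset 17 (reg 10) (get 6 (entry (reg 10) (reg 11)))))
    (fun l s' => ∀ u < k + 1, ∀ v < n, (u = k → ∃ v' < l, 1 ≤ g k v') → 1 ≤ g u v →
      s'.int 17 u = s.int 6 (u * n + v)) (by simp) ?_ ?_
  · intro u hu v hv huv
    refine key u hu v hv (fun h => ?_) huv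
    subst h
    exact ⟨v, hv, huv⟩
  · intro u hu v hv hl huv
    by_cases h1 : u = k
    · obtain ⟨v', hv', -⟩ := hl h1
      omega
    · simp [hs2, hx, h1, hP u (by omega) v hv huv]
  · intro l s' hl hy hi' hw' hQ u hu v hv hl' huv
    have f : ∀ a, a ∉ [10, 11, 17] → ∀ i, s'.int a i = s.int a i := by
      intro a ha i
      simp only [List.mem_cons, not_or] at ha
      rw [hi' a (by simp [imods, ha]), ← hi a (by simp [imods, ha])]
      simp [hs2, ha]
    have hG := h.congr (f 0 (by decide)) (f 4 (by decide))
    have e10 : s'.int 10 0 = k := by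
      rw [hi' 10 (by decide)]
      simp [hs2, hx]
    have hkl := hG.graph k hk l hl
    have e6 := f 6 (by decide)
    have hQ' := hQ u hu v hv
    clear hi hi' hw hw' f hQ
    by_cases h1 : 1 ≤ g k l
    · by_cases h2 : u = k
      · subst h2
        have h3 : s.int 6 (u * n + l) = s.int 6 (u * n + v) := by
          have hlu : 1 ≤ g l u := by rwa [← hg u hk l hl]
          have h4 := hc.range u hk l hl h1
          have h5 := hc.range u hk v hv huv
          have h6 := hc.range l hl u hk hlu
          have h7 := (hc.differ l hl u hk l hl hlu h1).2 (Or.inl rfl)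
          have h8 := (hc.differ l hl u hk v hv hlu huv).2 (Or.inl rfl)
          omega
        simp [hG.size, e10, hy, hkl, h1, e6, h3]
      · simpa [hG.size, e10, hy, hkl, h1, h2] using hQ' (fun h => absurd h h2) huv
    · have h2 : u = k → ∃ v' < l, 1 ≤ g k v' := by
        intro h
        obtain ⟨v', h3, h4⟩ := hl' h
        rcases Nat.lt_succ_iff_lt_or_eq.1 h3 with h5 | rfl
        · exact ⟨v', h5, h4⟩
        · exact absurd h4 h1
      simpa [hG.size, e10, hy, hkl, h1] using hQ' h2 huv

theorem computeTotal_spec :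
    (computeTotal.run n s).wt 4 0 = ∑ u ∈ Finset.range n, s.wt 0 u := by
  refine run_each_invariant (s := (Cmd.wset 4 0 0).run n s) (x := 10)
    (p := .wset 4 0 (.reg 4 + .get 0 (reg 10)))
    (fun k s' => s'.wt 4 0 = ∑ u ∈ Finset.range k, s.wt 0 u) (by simp) (by simp) ?_
  intro k s' hk hx hi hw hP
  have : s'.wt 0 k = s.wt 0 k := by rw [hw 0 (by decide)]; simp
  simp [hP, hx, this, Finset.sum_range_succ]

theorem initExcess_spec : ∀ u < n,
    (initExcess.run n s).int 18 u = 0 ∧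
    (initExcess.run n s).wt 2 u = if s.int 17 u = 1 then s.wt 0 u else - s.wt 0 u := by
  refine run_each_invariant (s := s) (x := 10) (p := iset 18 (reg 10) 0 ;;
    .ite (ieq (get 17 (reg 10)) 1) (.wset 2 (reg 10) (.get 0 (reg 10)))
      (.wset 2 (reg 10) (0 - .get 0 (reg 10))))
    (fun k s' => ∀ u < k, s'.int 18 u = 0 ∧
      s'.wt 2 u = if s.int 17 u = 1 then s.wt 0 u else - s.wt 0 u) (by simp) (by simp) ?_
  intro k s' hk hx hi hw hP u hu
  have e0 : ∀ i, s'.wt 0 i = s.wt 0 i := hw 0 (by decide)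
  have e17 : ∀ i, s'.int 17 i = s.int 17 i := hi 17 (by decide)
  by_cases h1 : u = k
  · subst h1
    by_cases h2 : s.int 17 u = 1 <;> simp [hx, e0, e17, h2]
  · have := hP u (by omega)
    by_cases h2 : s.int 17 k = 1 <;> simp [hx, e17, h2, h1, this]

theorem initResidual_spec (h : HoldsGraph n g s) : ∀ u < n, ∀ v < n,
    (initResidual.run n s).wt 3 (u * n + v) =
      if s.int 17 u = 1 ∧ 1 ≤ g u v then s.wt 4 0 else 0 := by
  have key := run_each_each_invariant (n := n) (s := s) (x := 10) (y := 11)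
    (p := .ite (conj (ieq (get 17 (reg 10)) 1) (ile 1 (get 4 (entry (reg 10) (reg 11)))))
      (.wset 3 (entry (reg 10) (reg 11)) (.reg 4)) (.wset 3 (entry (reg 10) (reg 11)) 0))
    (by decide) (fun k l s' => ∀ u v, v < n → (u < k ∨ u = k ∧ v < l) → s'.wt 3 (u * n + v) =
      if s.int 17 u = 1 ∧ 1 ≤ g u v then s.wt 4 0 else 0)
    (by simp) (by simp) (by simp) (by grind) ?_
  · exact fun u hu v hv => key u v hv (Or.inl hu)
  intro k l s' hk hl hx hy hi hw hP u v hv huv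
  have hG := h.congr (s' := s') (hi 0 (by decide)) (hi 4 (by decide))
  have e4 : s'.wt 4 0 = s.wt 4 0 := hw 4 (by decide) 0
  have e17 : ∀ i, s'.int 17 i = s.int 17 i := hi 17 (by decide)
  have hg := hG.graph k hk l hl
  have hP' := hP u v hv
  clear hi hw hP
  simp only [run_ite, run_wset, holds_conj, holds_ile, holds_ieq, eval_get, eval_add, eval_mul,
    eval_ofNat, WExp.eval_get, WExp.eval_zero, hG.size, hx, hy, e4, e17, hg]
  by_cases h1 : u = k ∧ v = l
  · obtain ⟨rfl, rfl⟩ := h1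
    split_ifs <;> simp
  · rw [← hP' (by omega)]
    split_ifs with h2 <;> simp [entry_inj hv hl, h1]

theorem readFlow_spec : (readFlow.run n s).wt 1 0 =
    ∑ u ∈ Finset.range n, (if s.int 17 u = 1 then s.wt 0 u else 0) -
      ∑ u ∈ Finset.range n, min (s.wt 2 u) 0 := by
  refine run_each_invariant (s := (Cmd.wset 1 0 0).run n s) (x := 10)
    (p := when (ieq (get 17 (reg 10)) 1) (.wset 1 0 (.reg 1 + .get 0 (reg 10))) ;;
      when (wlt (.get 2 (reg 10)) 0) (.wset 1 0 (.reg 1 - .get 2 (reg 10))))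
    (fun k s' => s'.wt 1 0 = ∑ u ∈ Finset.range k, (if s.int 17 u = 1 then s.wt 0 u else 0) -
      ∑ u ∈ Finset.range k, min (s.wt 2 u) 0) (by simp) (by simp) ?_
  intro k s' hk hx hi hw hP
  have e0 : s'.wt 0 k = s.wt 0 k := by rw [hw 0 (by decide)]; simp
  have e2 : s'.wt 2 k = s.wt 2 k := by rw [hw 2 (by decide)]; simp
  have e17 : s'.int 17 k = s.int 17 k := by rw [hi 17 (by decide)]; simp
  rw [Finset.sum_range_succ, Finset.sum_range_succ, add_sub_add_comm, ← hP]
  by_cases h1 : s.int 17 k = 1 <;> by_cases h2 : s.wt 2 k < 0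
  · simp [hx, e0, e2, e17, h1, h2, h2.le]; abel
  · simp [hx, e0, e2, e17, h1, h2, not_lt.1 h2]
  · simp [hx, e2, e17, h1, h2, h2.le]; abel
  · simp [hx, e2, e17, h1, h2, not_lt.1 h2]

/-- The vertex `u` has a positive excess and can be raised. -/
def Active (n : ℕ) (s : Store K) (u : ℕ) : Prop := 0 < s.wt 2 u ∧ s.int 18 u ≤ n

theorem pickActive_spec (h : s.int 0 0 = n) (s' : Store K) (hs' : s' = pickActive.run n s) :
    (s'.int 19 0 = 0 ∧ ∀ u < n, ¬ Active n s u) ∨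
    (s'.int 19 0 = 1 ∧ s'.int 20 0 < n ∧ Active n s (s'.int 20 0) ∧
      ∀ u < n, Active n s u → s.int 18 u ≤ s.int 18 (s'.int 20 0)) := by
  subst hs'
  refine run_each_invariant (s := (rset 19 0).run n s) (x := 10)
    (p := when (conj (wlt 0 (.get 2 (reg 10))) (conj (ile (get 18 (reg 10)) size)
      (disj (ieq (reg 19) 0) (ilt (get 18 (reg 20)) (get 18 (reg 10))))))
      (rset 19 1 ;; rset 20 (reg 10)))
    (fun k s' => (s'.int 19 0 = 0 ∧ ∀ u < k, ¬ Active n s u) ∨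
      (s'.int 19 0 = 1 ∧ s'.int 20 0 < n ∧ Active n s (s'.int 20 0) ∧
        ∀ u < k, Active n s u → s.int 18 u ≤ s.int 18 (s'.int 20 0))) (by simp) (by simp) ?_
  intro k s' hk hx hi hw hP
  have e0 : s'.int 0 0 = n := by rw [hi 0 (by decide)]; simp [h]
  have e2 : ∀ i, s'.wt 2 i = s.wt 2 i := fun i => by rw [hw 2 (by decide)]; simp
  have e18 : ∀ i, s'.int 18 i = s.int 18 i := fun i => by rw [hi 18 (by decide)]; simp
  clear hi hw
  have hk1 : ∀ u, u < k + 1 ↔ u < k ∨ u = k := by omega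
  simp only [run_ite, run_seq, run_iset, run_skip, holds_conj, holds_ile, holds_ieq, holds_wlt,
    holds_disj, holds_ilt, eval_get, eval_ofNat, WExp.eval_get, WExp.eval_zero, e0, hx, e2, e18]
  split_ifs with h1
  · right
    simp only [Store.int_setInt, hx]
    simp only [and_self, and_true, true_and, if_true, if_false, Nat.reduceEqDiff]
    refine ⟨hk, ⟨h1.1, h1.2.1⟩, fun u hu hact => ?_⟩
    rcases (hk1 u).1 hu with h2 | rfl
    · rcases hP with ⟨-, h3⟩ | ⟨h3, h4, h5, h6⟩
      · exact absurd hact (h3 u h2)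
      · have := h6 u h2 hact
        omega
    · exact le_rfl
  · rcases hP with ⟨h2, h3⟩ | ⟨h2, h4, h5, h6⟩
    · refine Or.inl ⟨h2, fun u hu hact => ?_⟩
      rcases (hk1 u).1 hu with h4 | rfl
      · exact h3 u h4 hact
      · exact h1 ⟨hact.1, hact.2, Or.inl h2⟩
    · refine Or.inr ⟨h2, h4, h5, fun u hu hact => ?_⟩
      rcases (hk1 u).1 hu with h7 | rfl
      · exact h6 u h7 hact
      · by_contra hlt
        exact h1 ⟨hact.1, hact.2, Or.inr (not_le.1 hlt)⟩

/-- Each push empties `x` or saturates the arc, and later pushes of the same scan do not touch arcs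
already saturated. So if excess remains, then every admissible arc is saturated and `x` may be
raised. Only vertices one level below `x` receive excess, which `discharge_spec` needs for its
count. -/
theorem pushAll_spec [IsOrderedAddMonoid K] {e : ℕ → K} {c : ℕ → ℕ → K} (h : s.int 0 0 = n)
    (hx : s.int 20 0 < n) (hpos : 0 ≤ s.wt 2 (s.int 20 0))
    (H : FlowInvariant n e c (exOf s) (resOf n s) (heightOf s))
    (s' : Store K) (hs' : s' = pushAll.run n s) :
    FlowInvariant n e c (exOf s') (resOf n s') (heightOf s) ∧ 0 ≤ s'.wt 2 (s.int 20 0) ∧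
    (∀ u < n, u ≠ s.int 20 0 → s'.wt 2 u = s.wt 2 u ∨ s.int 18 (s.int 20 0) = s.int 18 u + 1) ∧
    (0 < s'.wt 2 (s.int 20 0) → ∀ u < n, s.int 18 (s.int 20 0) = s.int 18 u + 1 →
      s'.wt 3 (s.int 20 0 * n + u) = 0) := by
  subst hs'
  set x := s.int 20 0 with hxdef
  refine run_each_invariant (s := s) (x := 11)
    (p := when (ieq (get 18 (reg 20)) (get 18 (reg 11) + 1)) (
      .ite (wle (.get 2 (reg 20)) (.get 3 (entry (reg 20) (reg 11))))
        (.wset 8 0 (.get 2 (reg 20))) (.wset 8 0 (.get 3 (entry (reg 20) (reg 11)))) ;;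
      pushAmount (reg 20) (reg 11)))
    (fun k s' => FlowInvariant n e c (exOf s') (resOf n s') (heightOf s) ∧ 0 ≤ s'.wt 2 x ∧
      (∀ u < n, u ≠ x → s'.wt 2 u = s.wt 2 u ∨ s.int 18 x = s.int 18 u + 1) ∧
      (0 < s'.wt 2 x → ∀ u < k, s.int 18 x = s.int 18 u + 1 → s'.wt 3 (x * n + u) = 0))
    (fun _ _ _ h => h) ⟨H, hpos, fun _ _ _ => Or.inl rfl, by simp⟩ ?_
  intro k s1 hk hk1 hi hw ⟨hI, h0, hex, hadm⟩
  have e0 : s1.int 0 0 = n := by rw [hi 0 (by decide), h]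
  have e20 : s1.int 20 0 = x := hi 20 (by decide) 0
  have e18 : ∀ i, s1.int 18 i = s.int 18 i := hi 18 (by decide)
  clear hi hw
  have hlt : ∀ u, u < k + 1 ↔ u < k ∨ u = k := by omega
  by_cases hh : s.int 18 x = s.int 18 k + 1
  · set d := min (s1.wt 2 x) (s1.wt 3 (x * n + k)) with hd
    have hne : x ≠ k := by intro h1; rw [h1] at hh; omega
    have hne' := hne.symm
    set s2 := Cmd.run n (when (ieq (get 18 (reg 20)) (get 18 (reg 11) + 1)) (
      .ite (wle (.get 2 (reg 20)) (.get 3 (entry (reg 20) (reg 11))))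
        (.wset 8 0 (.get 2 (reg 20))) (.wset 8 0 (.get 3 (entry (reg 20) (reg 11)))) ;;
      pushAmount (reg 20) (reg 11))) s1 with hs2
    have hrun : s2 = Cmd.run n (pushAmount (reg 20) (reg 11)) (s1.setWt 8 0 d) := by
      by_cases h1 : s1.wt 2 x ≤ s1.wt 3 (x * n + k)
      · simp [hs2, e20, e18, hk1, hh, e0, h1, hd]
      · simp [hs2, e20, e18, hk1, hh, e0, h1, hd, (not_le.1 h1).le]
    have h2 : ∀ u < n, s2.wt 2 u =
        if u = x then s1.wt 2 x - d else if u = k then s1.wt 2 k + d else s1.wt 2 u := by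
      intro u hu
      rw [hrun]
      by_cases h3 : u = x
      · simp [pushAmount, e0, e20, hk1, h3, hne]
      · by_cases h4 : u = k
        · simp [pushAmount, e0, e20, hk1, h4, hne']
        · simp [pushAmount, e0, e20, hk1, h3, h4]
    have h3 : ∀ u < n, ∀ v < n, s2.wt 3 (u * n + v) = if u = x ∧ v = k then
        s1.wt 3 (x * n + k) - d else if u = k ∧ v = x then s1.wt 3 (k * n + x) + d else
        s1.wt 3 (u * n + v) := by
      intro u hu v hv
      rw [hrun]
      by_cases h3 : u = x ∧ v = k
      · simp [pushAmount, e0, e20, hk1, h3, hne, entry_inj hk hx]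
      · by_cases h4 : u = k ∧ v = x
        · simp [pushAmount, e0, e20, hk1, h4, hne', entry_inj hx hk]
        · simp [pushAmount, e0, e20, hk1, h3, h4, entry_inj hv hk, entry_inj hv hx]
    have hd0 : 0 ≤ d := le_min h0 (hI.nonneg x hx k hk)
    refine ⟨hI.push hx hk hh hd0 (min_le_right _ _) (min_le_left _ _) h2 h3, ?_, ?_, ?_⟩
    · rw [h2 x hx, if_pos rfl]
      exact sub_nonneg.2 (min_le_left _ _)
    · intro u hu hux
      rw [h2 u hu, if_neg hux]
      split_ifs with h4
      · subst h4; exact Or.inr hh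
      · exact hex u hu hux
    · rw [h2 x hx, if_pos rfl]
      intro hlt' u hu hhu
      have hlt1 := sub_pos.1 hlt'
      rw [h3 x hx u (by omega)]
      by_cases h4 : u = k
      · rw [if_pos ⟨rfl, h4⟩, hd, min_eq_right, sub_self]
        by_contra h5
        rw [hd, min_eq_left (not_le.1 h5).le] at hlt1
        exact lt_irrefl _ hlt1
      · rw [if_neg (fun h => h4 h.2), if_neg (fun h => hne h.1)]
        exact hadm (lt_of_le_of_lt hd0 hlt1) u (by omega) hhu
  · have hrun : Cmd.run n (when (ieq (get 18 (reg 20)) (get 18 (reg 11) + 1)) (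
      .ite (wle (.get 2 (reg 20)) (.get 3 (entry (reg 20) (reg 11))))
        (.wset 8 0 (.get 2 (reg 20))) (.wset 8 0 (.get 3 (entry (reg 20) (reg 11)))) ;;
      pushAmount (reg 20) (reg 11))) s1 = s1 := by
      simp [e20, e18, hk1, hh]
    rw [hrun]
    refine ⟨hI, h0, hex, fun h1 u hu h2 => ?_⟩
    rcases (hlt u).1 hu with h3 | rfl
    · exact hadm h1 u h3 h2
    · exact absurd h2 hh

open Classical in
/-- A bound for the number of further rounds before the heights increase. -/
noncomputable def levelMeasure (n : ℕ) (s : Store K) : ℕ :=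
  ((Finset.range n).filter fun u => Active n s u ∨ ∃ v < n, Active n s v ∧
    s.int 18 u < s.int 18 v).card

/-- A bound for the number of further rounds of the preflow algorithm. -/
noncomputable def flowMeasure (n : ℕ) (s : Store K) : ℕ :=
  ((n + 1) * n - ∑ u ∈ Finset.range n, s.int 18 u) * (n + 1) + levelMeasure n s

theorem flowMeasure_setInt (a j : ℕ) (ha : a ≠ 18) :
    flowMeasure n (s.setInt a 0 j) = flowMeasure n s := by
  have h18 : ∀ i, (s.setInt a 0 j).int 18 i = s.int 18 i := fun i => by simp [ha.symm]
  have : Active n (s.setInt a 0 j) = Active n s := by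
    funext u
    simp only [Active, h18]
    rfl
  have hlev : levelMeasure n (s.setInt a 0 j) = levelMeasure n s := by
    classical
    exact congrArg Finset.card (Finset.filter_congr fun u _ => by simp only [this, h18])
  simp only [flowMeasure, h18, hlev]

theorem levelMeasure_le : levelMeasure n s ≤ n := by
  classical
  exact (Finset.card_filter_le _ _).trans (by simp)

/-- If the vertex is raised, then the sum of the heights grows by one, which is worth `n + 1` and
outweighs the level measure, at most `n`. If it is not raised, then it drops out of the set counted
by the level measure: it is no longer active, and as a highest active vertex it has no active vertex
above it. The vertices that become active lie below it and were counted already. -/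
theorem discharge_spec [IsOrderedAddMonoid K] {e : ℕ → K} {c : ℕ → ℕ → K} (h : s.int 0 0 = n)
    (H : FlowInvariant n e c (exOf s) (resOf n s) (heightOf s))
    (s' : Store K) (hs' : s' = (pickActive ;; discharge).run n s) :
    FlowInvariant n e c (exOf s') (resOf n s') (heightOf s') ∧
    ((∀ u < n, ¬ Active n s' u) ∨
      (flowMeasure n s' < flowMeasure n s ∧ ∃ u < n, Active n s u)) := by
  classical
  have hpick := pickActive_spec h _ rfl
  rw [run_seq] at hs'
  set s1 := pickActive.run n s with hs1
  have f1 : ∀ a, a ∉ [10, 19, 20] → ∀ i, s1.int a i = s.int a i := by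
    intro a ha i
    simp only [List.mem_cons, not_or] at ha
    exact int_run_of_notMem _ _ _ _ (by simp [pickActive, imods, ha]) _
  have w1 : ∀ a i, s1.wt a i = s.wt a i := fun a i =>
    wt_run_of_notMem _ _ _ _ (by simp [pickActive, wmods]) _
  have H1 : FlowInvariant n e c (exOf s1) (resOf n s1) (heightOf s1) :=
    H.congr (fun u _ => w1 _ _) (fun u _ v _ => w1 _ _) (fun u _ => f1 18 (by decide) _)
  rcases hpick with ⟨h19, hno⟩ | ⟨h19, hx, hact, hmax⟩
  · have : s' = s1 := by simp [hs', discharge, h19]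
    subst this
    refine ⟨H1, Or.inl fun u hu => ?_⟩
    have := hno u hu
    rwa [Active, ← w1, ← f1 18 (by decide)] at this
  set x := s1.int 20 0 with hxdef
  have hpush := pushAll_spec (by rw [f1 0 (by decide), h]) hx (by rw [w1]; exact hact.1.le) H1 _ rfl
  rw [← hxdef] at hpush
  set s2 := pushAll.run n s1 with hs2
  obtain ⟨H2, h0, hex, hadm⟩ := hpush
  have f2 : ∀ a, a ≠ 11 → ∀ i, s2.int a i = s1.int a i := by
    intro a ha i
    exact int_run_of_notMem _ _ _ _ (by simp [pushAll, pushAmount, imods, ha]) _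
  have h20 : s2.int 20 0 = x := f2 20 (by decide) 0
  have h18 : ∀ i, s2.int 18 i = s.int 18 i := fun i => by
    rw [f2 18 (by decide), f1 18 (by decide)]
  have h18' : ∀ i, s1.int 18 i = s.int 18 i := f1 18 (by decide)
  have hrun : s' = Cmd.run n (when (wlt 0 (.get 2 (reg 20))) (.incr 18 (reg 20))) s2 := by
    rw [hs', discharge, when, run_ite, if_pos (by simpa using h19), run_seq]
  by_cases hp : 0 < s2.wt 2 x
  · have hrun' : s' = s2.setInt 18 x (s.int 18 x + 1) := by
      rw [hrun]
      simp [h20, hp, h18, hact.2]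
    have hs18 : ∀ u, s'.int 18 u = if u = x then s.int 18 x + 1 else s.int 18 u := by
      intro u
      rw [hrun']
      by_cases h1 : u = x <;> simp [h1, h18]
    have H3 : FlowInvariant n e c (exOf s') (resOf n s') (heightOf s') := by
      have := H2.relabel (h' := heightOf s') hx hp (by simpa [h18'] using hact.2) (hadm hp)
        (fun u hu => by simp [hs18, h18'])
      rw [hrun'] at this ⊢
      exact this
    refine ⟨H3, Or.inr ⟨?_, x, hx, hact⟩⟩
    have hsum : ∑ u ∈ Finset.range n, s'.int 18 u = ∑ u ∈ Finset.range n, s.int 18 u + 1 := by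
      have : ∀ u ∈ Finset.range n, s'.int 18 u = s.int 18 u + if u = x then 1 else 0 := by
        intro u _
        rw [hs18]
        by_cases h1 : u = x <;> simp [h1]
      rw [Finset.sum_congr rfl this, Finset.sum_add_distrib]
      simp [hx]
    have hle : ∑ u ∈ Finset.range n, s'.int 18 u ≤ (n + 1) * n := by
      refine (Finset.sum_le_card_nsmul _ _ (n + 1)
        fun u hu => H3.height_le u (Finset.mem_range.1 hu)).trans ?_
      simp [mul_comm]
    have hlev : levelMeasure n s' ≤ n := levelMeasure_le
    unfold flowMeasure
    rw [hsum] at hle ⊢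
    have h5 : (n + 1) * n - ∑ u ∈ Finset.range n, s.int 18 u =
      ((n + 1) * n - (∑ u ∈ Finset.range n, s.int 18 u + 1)) + 1 := by omega
    rw [h5]
    generalize (n + 1) * n - (∑ u ∈ Finset.range n, s.int 18 u + 1) = A
    rw [add_mul A 1]
    omega
  · have hrun' : s' = s2 := by
      rw [hrun]
      simp [h20, hp]
    rw [hrun']
    refine ⟨H2.congr (fun _ _ => rfl) (fun _ _ _ _ => rfl) (fun u _ => f2 18 (by decide) u),
      Or.inr ⟨?_, x, hx, hact⟩⟩
    have hx0 : ¬ Active n s2 x := fun h1 => hp h1.1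
    -- A newly active vertex received excess along an admissible arc, so it is lower than `x`.
    have hnew : ∀ u < n, Active n s2 u → Active n s u ∨ s.int 18 u < s.int 18 x := by
      intro u hu h1
      by_cases hux : u = x
      · rw [hux] at h1
        exact absurd h1 hx0
      rcases hex u hu hux with h2 | h2
      · left
        rwa [Active, h2, w1, h18] at h1
      · rw [h18', h18'] at h2
        omega
    unfold flowMeasure
    simp only [h18]
    refine Nat.add_lt_add_left (Finset.card_lt_card ?_) _
    rw [Finset.ssubset_iff_of_subset]
    · refine ⟨x, by simp [hx, hact], ?_⟩
      simp only [Finset.mem_filter, not_and, not_or, not_exists, h18]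
      refine fun _ => ⟨hx0, fun v hv hv' hlt => ?_⟩
      rcases hnew v hv hv' with h1 | h1
      · have := hmax v hv h1
        omega
      · omega
    · intro u hu
      simp only [Finset.mem_filter, Finset.mem_range, h18] at hu ⊢
      refine ⟨hu.1, ?_⟩
      rcases hu.2 with h1 | ⟨v, hv, h1, h2⟩
      · rcases hnew u hu.1 h1 with h3 | h3
        · exact Or.inl h3
        · exact Or.inr ⟨x, hx, hact, h3⟩
      · rcases hnew v hv h1 with h3 | h3
        · exact Or.inr ⟨v, hv, h3, h2⟩
        · exact Or.inr ⟨x, hx, hact, h2.trans h3⟩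

/-- The initial preflow is zero, with all heights `0`, and satisfies the invariant trivially. The
measure decreases in every round that has an active vertex, so after `(n + 1) ^ 3` rounds none is
left and `FlowInvariant.isMaxStableWeight` applies. -/
theorem solveBipartite_spec [IsOrderedAddMonoid K] (hg : ∀ u < n, ∀ v < n, g u v = g v u)
    (hw : ∀ u < n, 0 ≤ s.wt 0 u) (h : HoldsGraph n g s)
    (hc : IsArcColouring n 0 g fun u v => s.int 6 (u * n + v)) :
    IsMaxStableWeight n g (fun u => s.wt 0 u) ((solveBipartite.run n s).wt 1 0) := by
  have hside := computeSides_spec hg h hc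
  set s1 := computeSides.run n s with hs1
  have hS : ∀ u < n, ∀ v < n, 1 ≤ g u v → (s1.int 17 u = 1 ↔ s1.int 17 v ≠ 1) := by
    intro u hu v hv huv
    have hvu : 1 ≤ g v u := by rwa [hg v hv u hu]
    rw [hside u hu v hv huv, hside v hv u hu hvu]
    have h1 := hc.range u hu v hv huv
    have h2 := hc.range v hv u hu hvu
    have h3 := (hc.differ u hu v hv u hu huv hvu).2 (Or.inl rfl)
    omega
  have htot := computeTotal_spec (n := n) (s := s1)
  set s2 := computeTotal.run n s1 with hs2
  have hexc := initExcess_spec (n := n) (s := s2)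
  set s3 := initExcess.run n s2 with hs3
  have f3 : ∀ a, a ∉ [10, 11, 17, 18] → ∀ i, s3.int a i = s.int a i := by
    intro a ha i
    simp only [List.mem_cons, not_or] at ha
    rw [hs3, int_run_of_notMem _ _ _ _ (by simp [initExcess, imods, ha]), hs2,
      int_run_of_notMem _ _ _ _ (by simp [computeTotal, imods, ha]), hs1,
      int_run_of_notMem _ _ _ _ (by simp [computeSides, imods, ha])]
  have h17 : ∀ i, s3.int 17 i = s1.int 17 i := fun i => by
    rw [hs3, int_run_of_notMem _ _ _ _ (by decide), hs2, int_run_of_notMem _ _ _ _ (by decide)]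
  have hG3 : HoldsGraph n g s3 := h.congr (f3 0 (by decide)) (f3 4 (by decide))
  have hres := initResidual_spec hG3
  set s4 := initResidual.run n s3 with hs4
  have w01 : ∀ i, s1.wt 0 i = s.wt 0 i := wt_run_of_notMem _ _ _ _ (by decide)
  have w02 : ∀ i, s2.wt 0 i = s.wt 0 i := fun i => by
    rw [hs2, wt_run_of_notMem _ _ _ _ (by decide), w01]
  have w04 : ∀ i, s4.wt 0 i = s.wt 0 i := fun i => by
    rw [hs4, wt_run_of_notMem _ _ _ _ (by decide), hs3, wt_run_of_notMem _ _ _ _ (by decide), w02]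
  have h174 : ∀ i, s4.int 17 i = s1.int 17 i := fun i => by
    rw [hs4, int_run_of_notMem _ _ _ _ (by decide), h17]
  set e : ℕ → K := fun u => if s1.int 17 u = 1 then s.wt 0 u else - s.wt 0 u with he
  set c : ℕ → ℕ → K := fun u v => if s1.int 17 u = 1 ∧ 1 ≤ g u v then
    ∑ u ∈ Finset.range n, s.wt 0 u else 0 with hcdef
  have hW : s3.wt 4 0 = ∑ u ∈ Finset.range n, s.wt 0 u := by
    rw [hs3, wt_run_of_notMem _ _ _ _ (by decide), htot]
    simp [w01]
  have h172 : ∀ i, s2.int 17 i = s1.int 17 i := int_run_of_notMem _ _ _ _ (by decide)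
  have hW0 : 0 ≤ ∑ u ∈ Finset.range n, s.wt 0 u :=
    Finset.sum_nonneg fun u hu => hw u (Finset.mem_range.1 hu)
  have he4 : ∀ u < n, s4.wt 2 u = e u := fun u hu => by
    rw [hs4, wt_run_of_notMem _ _ _ _ (by decide), (hexc u hu).2, h172, w02]
  have hc4 : ∀ u < n, ∀ v < n, s4.wt 3 (u * n + v) = c u v := fun u hu v hv => by
    rw [hres u hu v hv, h17, hW]
  have hh4 : ∀ u < n, s4.int 18 u = 0 := fun u hu => by
    rw [hs4, int_run_of_notMem _ _ _ _ (by decide), (hexc u hu).1]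
  have H0 : FlowInvariant n e c e c (fun _ => 0) := by
    refine ⟨fun u hu v hv => ?_, by simp, by simp, by simp, by simp, by simp⟩
    simp only [hcdef]
    split_ifs <;> simp [hW0]
  have H4 : FlowInvariant n e c (exOf s4) (resOf n s4) (heightOf s4) := H0.congr he4 hc4 hh4
  have main := run_rep_invariant (n := n) (o := 1) (d := 3) (s := s4) (x := 13)
    (p := pickActive ;; discharge)
    (fun k s' => FlowInvariant n e c (exOf s') (resOf n s') (heightOf s') ∧
      ((∀ u < n, ¬ Active n s' u) ∨ k + flowMeasure n s' < (n + 1) ^ 3))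
    (fun k s' j hP => ⟨hP.1.congr (fun _ _ => rfl) (fun _ _ _ _ => rfl) (by simp),
      by rw [flowMeasure_setInt _ _ (by decide)]; simpa [Active] using hP.2⟩) ?_ ?_
  · set s5 := Cmd.run n (.rep 13 1 3 (pickActive ;; discharge)) s4 with hs5
    have hrun : solveBipartite.run n s = readFlow.run n s5 := rfl
    have h175 : ∀ i, s5.int 17 i = s1.int 17 i := fun i => by
      rw [hs5, int_run_of_notMem _ _ _ _ (by decide), h174]
    have w05 : ∀ i, s5.wt 0 i = s.wt 0 i := fun i => by
      rw [hs5, wt_run_of_notMem _ _ _ _ (by decide), w04]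
    rw [hrun, readFlow_spec]
    simp only [h175, w05]
    obtain ⟨H5, hend⟩ := main
    refine H5.isMaxStableWeight hw hg hS fun u hu hpos => ?_
    rcases hend with hend | hend
    · have := hend u hu
      have h1 := H5.height_le u hu
      by_contra h2
      exact this ⟨hpos, Nat.lt_succ_iff.1 (lt_of_le_of_ne h1 h2)⟩
    · omega
  · refine ⟨H4, Or.inr ?_⟩
    have hlev := levelMeasure_le (n := n) (s := s4)
    have h1 : ((n + 1) * n - ∑ u ∈ Finset.range n, s4.int 18 u) * (n + 1) ≤ (n + 1) * n * (n + 1) :=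
      Nat.mul_le_mul_right _ (Nat.sub_le _ _)
    -- The initial measure is at most `(n + 1) * n * (n + 1) + n`, less than the number of rounds.
    have h2 : (n + 1) ^ 3 = (n + 1) * n * (n + 1) + (n + 1) * (n + 1) := by ring
    have h3 : n + 1 ≤ (n + 1) * (n + 1) := Nat.le_mul_of_pos_left _ (by omega)
    unfold flowMeasure
    omega
  · rintro k s5 hk - hi hw5 ⟨H5, hprog⟩
    have h05 : s5.int 0 0 = n := by
      rw [hi 0 (by decide), hs4, int_run_of_notMem _ _ _ _ (by decide), hG3.size]
    obtain ⟨H6, h6⟩ := discharge_spec h05 H5 _ rfl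
    refine ⟨H6, ?_⟩
    rcases h6 with h6 | ⟨h6, u, hu, hact⟩
    · exact Or.inl h6
    · rcases hprog with h7 | h7
      · exact absurd hact (h7 u hu)
      · exact Or.inr (by omega)

end Spec

end RAM

namespace RAM

open Cmd IExp Test

variable {K : Type*} [AddCommGroup K] [LinearOrder K]

/-! ### Stable sets of maximum weight in line graphs of bipartite graphs

A vertex `v` of the line graph is an edge between the vertices `la v` and `lb v` of the two sides of
a bipartite graph, and a stable set is a matching. -/

/-- The invariant of the primal-dual algorithm for a matching of maximum weight. The dual variables
are `p` and `q`; if `mf b` is not `0` then `b` is matched by the edge `mt b`. -/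
structure DualInvariant (n : ℕ) (la lb : ℕ → ℕ) (w p q : ℕ → K) (mf mt : ℕ → ℕ) : Prop where
  nonneg_left : ∀ a < n, 0 ≤ p a
  nonneg_right : ∀ b < n, 0 ≤ q b
  cover : ∀ v < n, w v ≤ p (la v) + q (lb v)
  mate_lt : ∀ b < n, mf b ≠ 0 → mt b < n
  mate_right : ∀ b < n, mf b ≠ 0 → lb (mt b) = b
  tight : ∀ b < n, mf b ≠ 0 → p (la (mt b)) + q b = w (mt b)
  inj : ∀ b < n, ∀ b' < n, mf b ≠ 0 → mf b' ≠ 0 → la (mt b) = la (mt b') → b = b'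
  free : ∀ b < n, mf b = 0 → q b = 0

/-- The left vertex `a` is matched. -/
def Matched (n : ℕ) (la mf mt : ℕ → ℕ) (a : ℕ) : Prop := ∃ b < n, mf b ≠ 0 ∧ la (mt b) = a

/-- The matching is finished for the left vertices below `r`. -/
structure MatchedBelow (n : ℕ) (la : ℕ → ℕ) (p : ℕ → K) (mf mt : ℕ → ℕ) (r : ℕ) : Prop where
  lt : ∀ b < n, mf b ≠ 0 → la (mt b) < r
  done : ∀ a < r, a < n → Matched n la mf mt a ∨ p a = 0

/-- From the left vertex `a` a tight alternating path can be continued: either it stops because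
`p a = 0`, or it goes along the edge `nx a` and then back to a vertex of lower rank. -/
def TreeAt (n : ℕ) (la lb : ℕ → ℕ) (w p q : ℕ → K) (mf mt R nx ng rk : ℕ → ℕ) (a : ℕ) : Prop :=
  (ng a ≠ 0 ∧ p a = 0) ∨ (ng a = 0 ∧ nx a < n ∧ la (nx a) = a ∧
    p a + q (lb (nx a)) = w (nx a) ∧ (mf (lb (nx a)) ≠ 0 →
      R (la (mt (lb (nx a)))) ≠ 0 ∧ rk (la (mt (lb (nx a)))) < rk a))

/-- The right vertex `b` is unmatched, or its mate belongs to `R`. -/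
def Reached (la mf mt R : ℕ → ℕ) (b : ℕ) : Prop := mf b = 0 ∨ R (la (mt b)) ≠ 0

/-- `d` is the largest possible change of the dual variables, and `a` enters `R` after it. -/
structure IsDualStep (n : ℕ) (la lb : ℕ → ℕ) (w p q : ℕ → K) (mf mt R : ℕ → ℕ) (d : K)
    (a v f : ℕ) : Prop where
  lt : a < n
  fresh : R a = 0
  le_left : ∀ a' < n, R a' = 0 → d ≤ p a'
  le_slack : ∀ v' < n, R (la v') = 0 → Reached la mf mt R (lb v') →
    d ≤ p (la v') + q (lb v') - w v'
  attained : (f ≠ 0 ∧ d = p a) ∨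
    (f = 0 ∧ v < n ∧ la v = a ∧ Reached la mf mt R (lb v) ∧ d = p a + q (lb v) - w v)

section Matching

variable [IsOrderedAddMonoid K] {n : ℕ} {la lb : ℕ → ℕ} {w p q : ℕ → K} {mf mt : ℕ → ℕ}

/-- Complementary slackness. Matching edges are tight, unmatched right vertices have `q = 0`, and
unmatched left vertices have `p = 0` by `hdone`; so the current matching has the weight of the dual
solution. Weak duality bounds every other matching, because distinct edges of a matching have
distinct ends. -/
theorem DualInvariant.isMaxStableWeight {g : ℕ → ℕ → ℕ}
    (hla : ∀ v < n, la v < n) (hlb : ∀ v < n, lb v < n)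
    (hg : ∀ u < n, ∀ v < n, u ≠ v → (1 ≤ g u v ↔ la u = la v ∨ lb u = lb v))
    (H : DualInvariant n la lb w p q mf mt)
    (hdone : ∀ a < n, Matched n la mf mt a ∨ p a = 0) :
    IsMaxStableWeight n g w (∑ a ∈ Finset.range n, p a + ∑ b ∈ Finset.range n, q b) := by
  classical
  refine ⟨?_, ?_⟩
  · set B := (Finset.range n).filter fun b => mf b ≠ 0 with hB
    have hBm : ∀ b, b ∈ B ↔ b < n ∧ mf b ≠ 0 := by simp [hB]
    have hinj : Set.InjOn mt B := by
      intro b hb b' hb' heq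
      have h1 := (hBm b).1 hb
      have h2 := (hBm b').1 hb'
      rw [← H.mate_right b h1.1 h1.2, heq, H.mate_right b' h2.1 h2.2]
    refine ⟨B.image mt, ?_, ?_, ?_⟩
    · intro v hv
      obtain ⟨b, hb, rfl⟩ := Finset.mem_image.1 hv
      have h1 := (hBm b).1 hb
      exact Finset.mem_range.2 (H.mate_lt b h1.1 h1.2)
    · intro u hu v hv huv
      obtain ⟨b, hb, rfl⟩ := Finset.mem_image.1 hu
      obtain ⟨b', hb', rfl⟩ := Finset.mem_image.1 hv
      have h1 := (hBm b).1 hb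
      have h2 := (hBm b').1 hb'
      by_contra hne
      rcases (hg _ (H.mate_lt b h1.1 h1.2) _ (H.mate_lt b' h2.1 h2.2) huv).1 (by omega) with h3 | h3
      · exact huv (by rw [H.inj b h1.1 b' h2.1 h1.2 h2.2 h3])
      · rw [H.mate_right b h1.1 h1.2, H.mate_right b' h2.1 h2.2] at h3
        exact huv (by rw [h3])
    · rw [Finset.sum_image hinj]
      have h1 : ∑ b ∈ B, w (mt b) = ∑ b ∈ B, p (la (mt b)) + ∑ b ∈ B, q b := by
        rw [← Finset.sum_add_distrib]
        exact Finset.sum_congr rfl fun b hb => (H.tight b ((hBm b).1 hb).1 ((hBm b).1 hb).2).symm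
      have h2 : ∑ b ∈ B, q b = ∑ b ∈ Finset.range n, q b := by
        refine Finset.sum_subset (Finset.filter_subset _ _) fun b hb hb' => ?_
        have hb := Finset.mem_range.1 hb
        refine H.free b hb ?_
        by_contra h3
        exact hb' ((hBm b).2 ⟨hb, h3⟩)
      have h3 : ∑ b ∈ B, p (la (mt b)) = ∑ a ∈ Finset.range n, p a := by
        have hinj' : Set.InjOn (fun b => la (mt b)) B := by
          intro b hb b' hb' heq
          have h1 := (hBm b).1 hb
          have h2 := (hBm b').1 hb'
          exact H.inj b h1.1 b' h2.1 h1.2 h2.2 heq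
        rw [← Finset.sum_image hinj']
        refine Finset.sum_subset ?_ fun a ha ha' => ?_
        · intro a ha
          obtain ⟨b, hb, rfl⟩ := Finset.mem_image.1 ha
          have h1 := (hBm b).1 hb
          exact Finset.mem_range.2 (hla _ (H.mate_lt b h1.1 h1.2))
        · rcases hdone a (Finset.mem_range.1 ha) with ⟨b, hb, h4, h5⟩ | h4
          · exact absurd (Finset.mem_image.2 ⟨b, (hBm b).2 ⟨hb, h4⟩, h5⟩) ha'
          · exact h4
      rw [h1, h2, h3]
  · rintro _ ⟨S, hS, hstable, rfl⟩
    have hlt : ∀ v ∈ S, v < n := fun v hv => Finset.mem_range.1 (hS hv)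
    have hinj : ∀ (l : ℕ → ℕ), (∀ u < n, ∀ v < n, u ≠ v → l u = l v → 1 ≤ g u v) →
        Set.InjOn l S := by
      intro l hl u hu v hv heq
      by_contra hne
      have := hl u (hlt u hu) v (hlt v hv) hne heq
      have := hstable u hu v hv hne
      omega
    have hsum : ∀ (l : ℕ → ℕ) (f : ℕ → K), Set.InjOn l S → (∀ v < n, l v < n) →
        (∀ a < n, 0 ≤ f a) → ∑ v ∈ S, f (l v) ≤ ∑ a ∈ Finset.range n, f a := by
      intro l f hl hln hf
      rw [← Finset.sum_image (f := f) hl]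
      refine Finset.sum_le_sum_of_subset_of_nonneg ?_
        fun a ha _ => hf a (Finset.mem_range.1 ha)
      intro a ha
      obtain ⟨v, hv, rfl⟩ := Finset.mem_image.1 ha
      exact Finset.mem_range.2 (hln v (hlt v hv))
    calc ∑ v ∈ S, w v ≤ ∑ v ∈ S, (p (la v) + q (lb v)) :=
          Finset.sum_le_sum fun v hv => H.cover v (hlt v hv)
      _ = ∑ v ∈ S, p (la v) + ∑ v ∈ S, q (lb v) := Finset.sum_add_distrib
      _ ≤ _ := add_le_add
        (hsum la p (hinj la fun u hu v hv h1 h2 => (hg u hu v hv h1).2 (Or.inl h2)) hla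
          H.nonneg_left)
        (hsum lb q (hinj lb fun u hu v hv h1 h2 => (hg u hu v hv h1).2 (Or.inr h2)) hlb
          H.nonneg_right)

variable {R nx ng rk : ℕ → ℕ} {d : K} {a v f : ℕ}

theorem IsDualStep.nonneg (H : DualInvariant n la lb w p q mf mt)
    (D : IsDualStep n la lb w p q mf mt R d a v f) : 0 ≤ d := by
  rcases D.attained with ⟨-, h⟩ | ⟨-, hv, rfl, -, h⟩
  · rw [h]; exact H.nonneg_left a D.lt
  · rw [h]; exact sub_nonneg.2 (H.cover v hv)

-- Lowering `p` outside `R` and raising `q` at unreached right vertices changes `p + q` only for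
-- edges between `R` and unreached vertices, where it grows, and for edges between the outside of
-- `R` and reached vertices, where the slack is at least `d`. Matching edges remain tight since a
-- matched right vertex is reached exactly if its mate is in `R`, and unmatched ones are reached, so
-- they keep `q = 0`.
open Classical in
theorem DualInvariant.step (hla : ∀ v < n, la v < n) (hlb : ∀ v < n, lb v < n)
    (H : DualInvariant n la lb w p q mf mt) (D : IsDualStep n la lb w p q mf mt R d a v f)
    {p' q' : ℕ → K} (hp : ∀ a < n, p' a = if R a = 0 then p a - d else p a)
    (hq : ∀ b < n, q' b = if Reached la mf mt R b then q b else q b + d) :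
    DualInvariant n la lb w p' q' mf mt := by
  have hd := D.nonneg H
  refine ⟨fun a ha => ?_, fun b hb => ?_, fun v hv => ?_, H.mate_lt, H.mate_right,
    fun b hb hm => ?_, H.inj, fun b hb hm => ?_⟩
  · rw [hp a ha]
    split_ifs with h
    · exact sub_nonneg.2 (D.le_left a ha h)
    · exact H.nonneg_left a ha
  · rw [hq b hb]
    split_ifs
    · exact H.nonneg_right b hb
    · exact add_nonneg (H.nonneg_right b hb) hd
  · have hc := H.cover v hv
    rw [hp _ (hla v hv), hq _ (hlb v hv)]
    split_ifs with h1 h2 h2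
    · rw [sub_add_eq_add_sub]
      exact le_sub_comm.1 (D.le_slack v hv h1 h2)
    · convert hc using 1; abel
    · exact hc
    · rw [← add_assoc]; exact le_add_of_le_of_nonneg hc hd
  · have ht := H.tight b hb hm
    rw [hp _ (hla _ (H.mate_lt b hb hm)), hq b hb]
    by_cases h : R (la (mt b)) = 0
    · rw [if_pos h, if_neg (show ¬ Reached la mf mt R b by simp [Reached, h, hm]), ← ht]; abel
    · rw [if_neg h, if_pos (show Reached la mf mt R b from Or.inr h), ht]
  · rw [hq b hb, if_pos (show Reached la mf mt R b from Or.inl hm), H.free b hb hm]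

-- The bound that determines `d` becomes an equality for the new vertex `a`: either `p a` becomes
-- `0` or its edge to a reached vertex becomes tight. The old paths use only vertices of `R` and
-- reached vertices, whose dual variables do not move. The new vertex gets rank `k`, above all
-- former ranks.
omit [IsOrderedAddMonoid K] in
open Classical in
theorem TreeAt.step (hla : ∀ v < n, la v < n) (hlb : ∀ v < n, lb v < n)
    (H : DualInvariant n la lb w p q mf mt) (D : IsDualStep n la lb w p q mf mt R d a v f)
    {k : ℕ} (hT : ∀ a < n, R a ≠ 0 → TreeAt n la lb w p q mf mt R nx ng rk a ∧ rk a < k)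
    {p' q' : ℕ → K} (hp : ∀ a < n, p' a = if R a = 0 then p a - d else p a)
    (hq : ∀ b < n, q' b = if Reached la mf mt R b then q b else q b + d)
    {R' nx' ng' : ℕ → ℕ} (hR : ∀ a' < n, R' a' = if a' = a then 1 else R a')
    (hnx : ∀ a' < n, nx' a' = if a' = a then v else nx a')
    (hng : ∀ a' < n, ng' a' = if a' = a then f else ng a') :
    ∃ rk' : ℕ → ℕ, ∀ a' < n, R' a' ≠ 0 →
      TreeAt n la lb w p' q' mf mt R' nx' ng' rk' a' ∧ rk' a' < k + 1 := by
  refine ⟨fun a' => if a' = a then k else rk a', fun a' ha' hRa => ?_⟩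
  have mono : ∀ y < n, R y ≠ 0 → R' y ≠ 0 ∧ y ≠ a := by
    intro y hy hRy
    have : y ≠ a := by rintro rfl; exact hRy D.fresh
    rw [hR y hy, if_neg this]
    exact ⟨hRy, this⟩
  by_cases h1 : a' = a
  · subst h1
    refine ⟨?_, by simp⟩
    unfold TreeAt
    rw [hng a' ha', hnx a' ha', if_pos rfl, if_pos rfl, hp a' ha', if_pos D.fresh]
    rcases D.attained with ⟨h2, h3⟩ | ⟨h2, h3, h4, h5, h6⟩
    · exact Or.inl ⟨h2, by rw [h3, sub_self]⟩
    · refine Or.inr ⟨h2, h3, h4, ?_, fun hm => ?_⟩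
      · rw [hq _ (hlb v h3), if_pos h5, h6]; abel
      · have h7 : R (la (mt (lb v))) ≠ 0 := h5.resolve_left hm
        have hy := hla _ (H.mate_lt _ (hlb v h3) hm)
        obtain ⟨h8, h9⟩ := mono _ hy h7
        exact ⟨h8, by simpa [h9] using (hT _ hy h7).2⟩
  · rw [hR a' ha', if_neg h1] at hRa
    obtain ⟨hT1, hT2⟩ := hT a' ha' hRa
    refine ⟨?_, by simp only [h1, if_false]; omega⟩
    unfold TreeAt at hT1 ⊢
    rw [hng a' ha', hnx a' ha', if_neg h1, if_neg h1, hp a' ha', if_neg hRa]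
    rcases hT1 with h2 | ⟨h2, h3, h4, h5, h6⟩
    · exact Or.inl h2
    · refine Or.inr ⟨h2, h3, h4, ?_, fun hm => ?_⟩
      · rw [hq _ (hlb _ h3), if_pos, h5]
        by_cases hm : mf (lb (nx a')) = 0
        · exact Or.inl hm
        · exact Or.inr (h6 hm).1
      · obtain ⟨h7, h8⟩ := h6 hm
        have hy := hla _ (H.mate_lt _ (hlb _ h3) hm)
        obtain ⟨h9, h10⟩ := mono _ hy h7
        exact ⟨h9, by simpa [h1, h10] using h8⟩

/-- The invariant of an augmentation that frees the left vertex `x`. -/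
structure WalkInvariant (n : ℕ) (la lb : ℕ → ℕ) (w p q : ℕ → K) (mf mt R nx ng rk : ℕ → ℕ)
    (r x : ℕ) : Prop where
  lt : x < n
  le : x ≤ r
  unmatched : ¬ Matched n la mf mt x
  others : ∀ a ≤ r, a < n → a ≠ x → Matched n la mf mt a ∨ p a = 0
  mate_le : ∀ b < n, mf b ≠ 0 → la (mt b) ≤ r
  mem : R x ≠ 0
  tree : ∀ a < n, R a ≠ 0 → rk a ≤ rk x → TreeAt n la lb w p q mf mt R nx ng rk a

-- Replacing the mate of one right vertex by a tight edge from an unmatched left vertex leaves the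
-- dual variables alone. The former mate simply loses its partner; that is the reason why no
-- condition on unmatched left vertices belongs to `DualInvariant`.
omit [IsOrderedAddMonoid K] in
theorem DualInvariant.rematch (H : DualInvariant n la lb w p q mf mt) {x v : ℕ} (hv : v < n)
    (hx : la v = x) (hun : ¬ Matched n la mf mt x) (ht : p x + q (lb v) = w v) {mf' mt' : ℕ → ℕ}
    (hmf : ∀ b < n, mf' b = if b = lb v then 1 else mf b)
    (hmt : ∀ b < n, mt' b = if b = lb v then v else mt b) :
    DualInvariant n la lb w p q mf' mt' := by
  have hne : ∀ b < n, b ≠ lb v → mf' b ≠ 0 → mf b ≠ 0 := by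
    intro b hb h1 h2
    rwa [hmf b hb, if_neg h1] at h2
  refine ⟨H.nonneg_left, H.nonneg_right, H.cover, fun b hb hm => ?_, fun b hb hm => ?_,
    fun b hb hm => ?_, fun b hb b' hb' hm hm' heq => ?_, fun b hb hm => ?_⟩
  · rw [hmt b hb]
    split_ifs with h1
    · exact hv
    · exact H.mate_lt b hb (hne b hb h1 hm)
  · rw [hmt b hb]
    split_ifs with h1
    · exact h1.symm
    · exact H.mate_right b hb (hne b hb h1 hm)
  · rw [hmt b hb]
    split_ifs with h1
    · rw [h1, hx, ht]
    · exact H.tight b hb (hne b hb h1 hm)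
  · rw [hmt b hb, hmt b' hb'] at heq
    split_ifs at heq with h1 h2 h2
    · rw [h1, h2]
    · exact absurd ⟨b', hb', hne b' hb' h2 hm', by rw [← heq, hx]⟩ hun
    · exact absurd ⟨b, hb, hne b hb h1 hm, by rw [heq, hx]⟩ hun
    · exact H.inj b hb b' hb' (hne b hb h1 hm) (hne b' hb' h2 hm') heq
  · rw [hmf b hb] at hm
    split_ifs at hm with h1
    exact H.free b hb hm

-- The path ends at a left vertex with `p = 0`, which may remain unmatched.
omit [LinearOrder K] [IsOrderedAddMonoid K] in
theorem WalkInvariant.halt {r x : ℕ} (W : WalkInvariant n la lb w p q mf mt R nx ng rk r x)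
    (h : ng x ≠ 0) : MatchedBelow n la p mf mt (r + 1) := by
  refine ⟨fun b hb hm => Nat.lt_succ_of_le (W.mate_le b hb hm), fun a ha han => ?_⟩
  by_cases h1 : a = x
  · subst h1
    rcases W.tree a W.lt W.mem le_rfl with ⟨-, h2⟩ | ⟨h2, -⟩
    · exact Or.inr h2
    · exact absurd h2 h
  · exact W.others a (by omega) han h1

-- The path ends at an unmatched right vertex: taking it leaves no left vertex without a partner
-- that needs one.
omit [LinearOrder K] [IsOrderedAddMonoid K] in
theorem WalkInvariant.finish (hlb : ∀ v < n, lb v < n) {r x : ℕ}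
    (W : WalkInvariant n la lb w p q mf mt R nx ng rk r x)
    (h : ng x = 0) (hfree : mf (lb (nx x)) = 0) {mf' mt' : ℕ → ℕ}
    (hmf : ∀ b < n, mf' b = if b = lb (nx x) then 1 else mf b)
    (hmt : ∀ b < n, mt' b = if b = lb (nx x) then nx x else mt b) :
    MatchedBelow n la p mf' mt' (r + 1) := by
  obtain ⟨h1, -⟩ | ⟨-, hv, hx, -, -⟩ := W.tree x W.lt W.mem le_rfl
  · exact absurd h h1
  refine ⟨fun b hb hm => ?_, fun a ha han => ?_⟩
  · rw [hmt b hb]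
    rw [hmf b hb] at hm
    split_ifs at hm ⊢ with h1
    · rw [hx]; exact Nat.lt_succ_of_le W.le
    · exact Nat.lt_succ_of_le (W.mate_le b hb hm)
  · by_cases h1 : a = x
    · left
      refine ⟨lb (nx x), hlb _ hv, ?_, ?_⟩
      · rw [hmf _ (hlb _ hv)]; simp
      · rw [hmt _ (hlb _ hv), if_pos rfl, hx, h1]
    · rcases W.others a (by omega) han h1 with ⟨b, hb, h2, h3⟩ | h2
      · have h4 : b ≠ lb (nx x) := by rintro rfl; exact h2 hfree
        left
        refine ⟨b, hb, ?_, ?_⟩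
        · rwa [hmf b hb, if_neg h4]
        · rwa [hmt b hb, if_neg h4]
      · exact Or.inr h2

-- The vertex `x` takes the right vertex `b₀`, and the displaced left vertex `y` has to be served
-- next. The stored paths from vertices of rank at most that of `y` stay intact: their next edge
-- cannot end at `b₀`, as this would force a rank above that of `y`. This is why the invariant keeps
-- the tree only up to the current rank.
omit [IsOrderedAddMonoid K] in
theorem WalkInvariant.step (hla : ∀ v < n, la v < n) (hlb : ∀ v < n, lb v < n) {r x : ℕ}
    (H : DualInvariant n la lb w p q mf mt)
    (W : WalkInvariant n la lb w p q mf mt R nx ng rk r x)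
    (h : ng x = 0) (hm : mf (lb (nx x)) ≠ 0) {mf' mt' : ℕ → ℕ}
    (hmf : ∀ b < n, mf' b = if b = lb (nx x) then 1 else mf b)
    (hmt : ∀ b < n, mt' b = if b = lb (nx x) then nx x else mt b) :
    WalkInvariant n la lb w p q mf' mt' R nx ng rk r (la (mt (lb (nx x)))) ∧
      rk (la (mt (lb (nx x)))) < rk x := by
  obtain ⟨h1, -⟩ | ⟨-, hv, hx, -, hT⟩ := W.tree x W.lt W.mem le_rfl
  · exact absurd h h1
  obtain ⟨hRy, hrk⟩ := hT hm
  have hb0 := hlb _ hv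
  set b₀ := lb (nx x) with hb0def
  set y := la (mt b₀) with hy
  have hxy : x ≠ y := fun h2 => W.unmatched ⟨b₀, hb0, hm, by rw [← hy, h2]⟩
  have hne : ∀ b < n, b ≠ b₀ → (mf' b = mf b ∧ mt' b = mt b) := by
    intro b hb h1
    rw [hmf b hb, hmt b hb, if_neg h1, if_neg h1]
    exact ⟨rfl, rfl⟩
  have hat : mf' b₀ = 1 ∧ mt' b₀ = nx x := by
    rw [hmf b₀ hb0, hmt b₀ hb0, if_pos rfl, if_pos rfl]
    exact ⟨rfl, rfl⟩
  refine ⟨⟨hla _ (H.mate_lt _ hb0 hm), W.mate_le _ hb0 hm, ?_, ?_, ?_, hRy, ?_⟩, hrk⟩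
  · rintro ⟨b, hb, h2, h3⟩
    by_cases h4 : b = b₀
    · subst h4
      rw [hat.2, hx] at h3
      exact hxy h3
    · rw [(hne b hb h4).1] at h2
      rw [(hne b hb h4).2] at h3
      exact h4 (H.inj b hb b₀ hb0 h2 hm h3)
  · intro a ha han hay
    by_cases h2 : a = x
    · exact Or.inl ⟨b₀, hb0, by simp [hat.1], by rw [hat.2, hx, h2]⟩
    · rcases W.others a ha han h2 with ⟨b, hb, h3, h4⟩ | h3
      · have h5 : b ≠ b₀ := by rintro rfl; exact hay h4.symm
        exact Or.inl ⟨b, hb, by rwa [(hne b hb h5).1], by rwa [(hne b hb h5).2]⟩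
      · exact Or.inr h3
  · intro b hb h2
    by_cases h4 : b = b₀
    · subst h4
      rw [hat.2, hx]
      exact W.le
    · rw [(hne b hb h4).1] at h2
      rw [(hne b hb h4).2]
      exact W.mate_le b hb h2
  · intro a ha hRa hle
    rcases W.tree a ha hRa (by omega) with h2 | ⟨h2, h3, h4, h5, h6⟩
    · exact Or.inl h2
    · refine Or.inr ⟨h2, h3, h4, h5, fun h7 => ?_⟩
      have h8 : lb (nx a) ≠ b₀ := by
        intro h9
        rw [h9] at h6
        have : rk y < rk a := (h6 hm).2
        omega
      rw [(hne _ (hlb _ h3) h8).1] at h7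
      rw [(hne _ (hlb _ h3) h8).2]
      exact h6 h7

-- A finished left vertex without mate has `p = 0`. If it is outside `R`, then `d ≤ 0`, so `d = 0`
-- and nothing changes for it.
open Classical in
theorem MatchedBelow.step {r : ℕ} (H : DualInvariant n la lb w p q mf mt)
    (D : IsDualStep n la lb w p q mf mt R d a v f) (M : MatchedBelow n la p mf mt r)
    {p' : ℕ → K} (hp : ∀ a < n, p' a = if R a = 0 then p a - d else p a) :
    MatchedBelow n la p' mf mt r := by
  refine ⟨M.lt, fun a' ha han => (M.done a' ha han).imp_right fun h0 => ?_⟩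
  rw [hp a' han]
  split_ifs with h
  · have h1 := D.le_left a' han h
    rw [h0] at h1 ⊢
    rw [le_antisymm h1 (D.nonneg H), sub_zero]
  · exact h0

end Matching

/-- Store in array `A` the least vertex of the class of each vertex, where two adjacent vertices are
in the same class if the arcs between them have colour `c`. -/
def computeLabels (A c : ℕ) : Cmd :=
  each 10 (iset A (reg 10) (reg 10) ;;
    each 11 (when (conj (ilt (reg 11) (get A (reg 10))) (conj
        (ile 1 (get 4 (entry (reg 11) (reg 10)))) (ieq (get 6 (entry (reg 11) (reg 10))) (.lit c))))
      (iset A (reg 10) (reg 11))))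

/-- The test for `Reached`. -/
def reachedTest (b : IExp) : Test :=
  disj (ieq (get 26 b) 0) (ile 1 (get 28 (get 21 (get 27 b))))

/-- The slack of the edge `v`. -/
def slack (v : IExp) : WExp :=
  .get 5 (get 21 v) + .get 6 (get 22 v) - .get 0 v

/-- Find the largest possible change of the dual variables. -/
def pickDualStep : Cmd :=
  rset 31 (reg 36) ;; rset 33 1 ;; .wset 7 0 (.get 5 (reg 36)) ;;
  each 10 (when (conj (ieq (get 28 (get 21 (reg 10))) 0) (conj (reachedTest (get 22 (reg 10)))
      (wlt (slack (reg 10)) (.reg 7))))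
    (.wset 7 0 (slack (reg 10)) ;; rset 31 (get 21 (reg 10)) ;; rset 32 (reg 10) ;; rset 33 0)) ;;
  each 10 (when (conj (ieq (get 28 (reg 10)) 0) (wlt (.get 5 (reg 10)) (.reg 7)))
    (.wset 7 0 (.get 5 (reg 10)) ;; rset 31 (reg 10) ;; rset 33 1))

/-- Change the dual variables. -/
def doDualStep : Cmd :=
  each 10 (when (ieq (get 28 (reg 10)) 0) (.wset 5 (reg 10) (.get 5 (reg 10) - .reg 7))) ;;
  each 10 (when (neg (reachedTest (reg 10))) (.wset 6 (reg 10) (.get 6 (reg 10) + .reg 7))) ;;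
  iset 28 (reg 31) 1 ;; iset 29 (reg 31) (reg 32) ;; iset 30 (reg 31) (reg 33)

/-- One step of the augmentation. -/
def walkStep : Cmd :=
  when (ieq (reg 35) 0) (.ite (ile 1 (get 30 (reg 34))) (rset 35 1)
    (rset 38 (get 29 (reg 34)) ;; rset 39 (get 22 (reg 38)) ;;
      .ite (ieq (get 26 (reg 39)) 0) (rset 35 1) (rset 34 (get 21 (get 27 (reg 39)))) ;;
      iset 26 (reg 39) 1 ;; iset 27 (reg 39) (reg 38)))

/-- One round of growing the tree. -/
def growTree : Cmd := when (ieq (get 28 (reg 36)) 0) (pickDualStep ;; doDualStep)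

/-- Match the left vertex in register `36`, if this is profitable. -/
def matchVertex : Cmd :=
  each 10 (iset 28 (reg 10) 0) ;;
  each 37 growTree ;;
  rset 34 (reg 36) ;; rset 35 0 ;; each 37 walkStep

/-- Initialize the matching and the dual variables. -/
def initMatching : Cmd :=
  each 10 (iset 26 (reg 10) 0 ;; .wset 5 (reg 10) (.reg 4) ;; .wset 6 (reg 10) 0)

/-- The value of the dual solution. -/
def readDual : Cmd :=
  .wset 1 0 0 ;; each 10 (.wset 1 0 (.reg 1 + .get 5 (reg 10) + .get 6 (reg 10)))

/-- The maximum weight of a stable set in the line graph of a bipartite graph whose arcs are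
coloured. -/
def solveLine : Cmd :=
  computeLabels 21 1 ;; computeLabels 22 2 ;; computeTotal ;; initMatching ;; each 36 matchVertex ;;
  readDual

end RAM

namespace RAM

open Cmd IExp Test

variable {K : Type*} [AddCommGroup K] [LinearOrder K] {n : ℕ} {g : ℕ → ℕ → ℕ} {s : Store K}

/-! ### Correctness of the matching algorithm -/

/-- The label of a vertex is the least vertex of its class. -/
def IsLabel (n : ℕ) (g f : ℕ → ℕ → ℕ) (c v l : ℕ) : Prop :=
  (l = v ∨ l < n ∧ 1 ≤ g l v ∧ f l v = c) ∧ l ≤ v ∧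
    ∀ u < n, 1 ≤ g u v → f u v = c → l ≤ u

theorem computeLabels_spec {A c : ℕ} (hA : A = 21 ∨ A = 22) (h : HoldsGraph n g s) :
    ∀ v < n, IsLabel n g (fun u v => s.int 6 (u * n + v)) c v
      ((computeLabels A c).run n s |>.int A v) := by
  have key := run_each_invariant (n := n) (s := s) (x := 10)
    (p := iset A (reg 10) (reg 10) ;;
    each 11 (when (conj (ilt (reg 11) (get A (reg 10))) (conj
        (ile 1 (get 4 (entry (reg 11) (reg 10)))) (ieq (get 6 (entry (reg 11) (reg 10))) (.lit c))))
      (iset A (reg 10) (reg 11))))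
    (fun k s' => ∀ v < k, IsLabel n g (fun u v => s.int 6 (u * n + v)) c v (s'.int A v)) ?_ ?_ ?_
  · exact key
  · rcases hA with rfl | rfl <;> simp
  · simp
  intro k s1 hk hx hi _ hP
  set s2 := Cmd.run n (iset A (reg 10) (reg 10)) s1 with hs2
  have hkey := run_each_invariant (n := n) (s := s2) (x := 11)
    (p := when (conj (ilt (reg 11) (get A (reg 10))) (conj
        (ile 1 (get 4 (entry (reg 11) (reg 10)))) (ieq (get 6 (entry (reg 11) (reg 10))) (.lit c))))
      (iset A (reg 10) (reg 11)))
    (fun j s' => (∀ v < k, s'.int A v = s1.int A v) ∧ s'.int A k ≤ k ∧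
      (s'.int A k = k ∨ s'.int A k < n ∧ 1 ≤ g (s'.int A k) k ∧
        s.int 6 (s'.int A k * n + k) = c) ∧
      ∀ u < j, 1 ≤ g u k → s.int 6 (u * n + k) = c → s'.int A k ≤ u) ?_ ?_ ?_
  · intro v hv
    obtain ⟨h1, h2, h3, h4⟩ := hkey
    by_cases hvk : v = k
    · subst hvk
      exact ⟨h3, h2, h4⟩
    · have := hP v (by omega)
      rw [← h1 v (by omega)] at this
      exact this
  · rcases hA with rfl | rfl <;> simp
  · have : ∀ v < k, v ≠ k := fun v hv => by omega
    simp +contextual [hs2, hx, this]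
  intro j s3 hj hy hi' _ ⟨h1, h2, h3, h4⟩
  have f : ∀ a, a ∉ [10, 11, A] → ∀ i, s3.int a i = s.int a i := by
    intro a ha i
    simp only [List.mem_cons, not_or] at ha
    rw [hi' a (by simp [imods, ha]), ← hi a (by simp [imods, ha])]
    simp [hs2, ha]
  have hG : HoldsGraph n g s3 := h.congr (f 0 (by rcases hA with rfl | rfl <;> decide))
    (f 4 (by rcases hA with rfl | rfl <;> decide))
  have e10 : s3.int 10 0 = k := by
    rw [hi' 10 (by rcases hA with rfl | rfl <;> simp [imods])]
    rcases hA with rfl | rfl <;> simp [hs2, hx]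
  have e6 := f 6 (by rcases hA with rfl | rfl <;> decide)
  have hjk := hG.graph j hj k hk
  clear hi hi' f
  simp only [run_ite, run_iset, run_skip, holds_conj, holds_ile, holds_ieq, holds_ilt, eval_get,
    eval_add, eval_mul, eval_ofNat, eval_lit, hG.size, e10, hy, hjk, e6]
  have hlt : ∀ u, u < j + 1 ↔ u < j ∨ u = j := by omega
  have hne : ∀ v < k, v ≠ k := fun v hv => by omega
  split_ifs with h5
  · simp only [Store.int_setInt, true_and, if_true]
    refine ⟨fun v hv => by rw [if_neg (hne v hv), h1 v hv], by omega, Or.inr ⟨hj, h5.2⟩, ?_⟩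
    intro u hu hg1 hc1
    rcases (hlt u).1 hu with h6 | rfl
    · have := h4 u h6 hg1 hc1
      omega
    · exact le_rfl
  · refine ⟨h1, h2, h3, fun u hu hg1 hc1 => ?_⟩
    rcases (hlt u).1 hu with h6 | rfl
    · exact h4 u h6 hg1 hc1
    · by_contra h7
      exact h5 ⟨by omega, hg1, hc1⟩

/-- In mode `1` an arc and its reverse have the same colour. If `uv` and `vw` have equal colours,
then `u` and `w` are equal or adjacent, and in the latter case `uw` has that colour too. So being
equal or joined in colour `c` is an equivalence relation, and the labels are its least
representatives. -/
theorem IsArcColouring.label_eq_iff {f : ℕ → ℕ → ℕ} (hg : ∀ u < n, ∀ v < n, g u v = g v u)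
    (hf : IsArcColouring n 1 g f) {c : ℕ} {l : ℕ → ℕ} (hl : ∀ v < n, IsLabel n g f c v (l v)) {u v : ℕ} (hu : u < n) (hv : v < n)
    (huv : u ≠ v) : l u = l v ↔ 1 ≤ g u v ∧ f u v = c := by
  have sym : ∀ u < n, ∀ v < n, 1 ≤ g u v → f u v = f v u := by
    intro u hu v hv h
    have h1 : 1 ≤ g v u := by rwa [hg v hv u hu]
    by_contra hne
    have := (hf.differ u hu v hv u hu h h1).1 hne
    simp [Differ] at this
  set E : ℕ → ℕ → Prop := fun u v => u = v ∨ 1 ≤ g u v ∧ f u v = c with hE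
  have Esymm : ∀ u < n, ∀ v < n, E u v → E v u := by
    intro u hu v hv h
    rcases h with h | ⟨h1, h2⟩
    · exact Or.inl h.symm
    · exact Or.inr ⟨by rwa [hg v hv u hu], by rw [← sym u hu v hv h1, h2]⟩
  have Etrans : ∀ u < n, ∀ v < n, ∀ w < n, E u v → E v w → E u w := by
    intro u hu v hv w hw h h'
    rcases h with rfl | ⟨h1, h2⟩
    · exact h'
    rcases h' with rfl | ⟨h3, h4⟩
    · exact Or.inr ⟨h1, h2⟩
    by_cases huw : u = w
    · exact Or.inl huw
    have h5 : ¬ Differ 1 g u w := by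
      rw [← hf.differ u hu v hv w hw h1 h3, h2, h4]
      simp
    have h6 : 1 ≤ g u w := by
      by_contra h7
      exact h5 (Or.inr ⟨Ne.symm huw, by omega⟩)
    refine Or.inr ⟨h6, ?_⟩
    have h7 : 1 ≤ g v u := by rwa [hg v hv u hu]
    have h8 : f v u = f u w := by
      by_contra hne
      have := (hf.differ v hv u hu w hw h7 h6).1 hne
      simp only [Differ] at this
      omega
    rw [← h8, ← sym u hu v hv h1, h2]
  have hEl : ∀ v < n, E (l v) v ∧ l v < n ∧ ∀ u < n, E u v → l v ≤ u := by
    intro v hv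
    obtain ⟨h1, h2, h3⟩ := hl v hv
    refine ⟨h1.imp_right fun h => h.2, by omega, fun u hu h => ?_⟩
    rcases h with rfl | ⟨h4, h5⟩
    · exact h2
    · exact h3 u hu h4 h5
  have : l u = l v ↔ E u v := by
    obtain ⟨h1, h2, h3⟩ := hEl u hu
    obtain ⟨h4, h5, h6⟩ := hEl v hv
    constructor
    · intro heq
      rw [← heq] at h4
      exact Etrans u hu _ h2 v hv (Esymm _ h2 u hu h1) h4
    · intro h
      exact le_antisymm (h3 _ h5 (Etrans _ h5 v hv u hu h4 (Esymm u hu v hv h)))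
        (h6 _ h2 (Etrans _ h2 u hu v hv h1 h))
  rw [this]
  simp [hE, huv]

/-- Adjacency in terms of the labels. -/
theorem IsArcColouring.adj_iff_label {f : ℕ → ℕ → ℕ} (hg : ∀ u < n, ∀ v < n, g u v = g v u)
    (hf : IsArcColouring n 1 g f)
    {la lb : ℕ → ℕ} (hla : ∀ v < n, IsLabel n g f 1 v (la v))
    (hlb : ∀ v < n, IsLabel n g f 2 v (lb v)) {u v : ℕ} (hu : u < n) (hv : v < n) (huv : u ≠ v) :
    1 ≤ g u v ↔ la u = la v ∨ lb u = lb v := by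
  rw [hf.label_eq_iff hg hla hu hv huv,
    hf.label_eq_iff hg hlb hu hv huv]
  have := hf.range u hu v hv
  tauto

section Stage

variable {la lb : ℕ → ℕ} {w : ℕ → K}

/-- The memory holds the labels and the weights. -/
structure HoldsLabels (n : ℕ) (la lb : ℕ → ℕ) (w : ℕ → K) (s : Store K) : Prop where
  left : s.int 21 = la
  right : s.int 22 = lb
  weight : s.wt 0 = w

@[simp] theorem holds_reachedTest (b : IExp) : (reachedTest b).Holds s ↔
    s.int 26 (b.eval s) = 0 ∨ 1 ≤ s.int 28 (s.int 21 (s.int 27 (b.eval s))) := by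
  simp [reachedTest]

omit [LinearOrder K] in
@[simp] theorem eval_slack (v : IExp) : (slack v).eval s =
    s.wt 5 (s.int 21 (v.eval s)) + s.wt 6 (s.int 22 (v.eval s)) - s.wt 0 (v.eval s) := rfl

/-- The search starts with `p` at the left vertex of the current stage, which is still outside `R`,
so there is always a candidate. Two passes then minimize over the slacks and over the values of `p`.
-/
theorem pickDualStep_spec (hla : ∀ v < n, la v < n) (h : HoldsLabels n la lb w s)
    (hr : s.int 36 0 < n) (hR : s.int 28 (s.int 36 0) = 0) (s' : Store K)
    (hs' : s' = pickDualStep.run n s) :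
    IsDualStep n la lb w (s.wt 5) (s.wt 6) (s.int 26) (s.int 27) (s.int 28) (s'.wt 7 0)
      (s'.int 31 0) (s'.int 32 0) (s'.int 33 0) := by
  set s1 := Cmd.run n (rset 31 (reg 36) ;; rset 33 1 ;; .wset 7 0 (.get 5 (reg 36))) s with hs1
  set c1 : Cmd := when (conj (ieq (get 28 (get 21 (reg 10))) 0)
      (conj (reachedTest (get 22 (reg 10))) (wlt (slack (reg 10)) (.reg 7))))
    (.wset 7 0 (slack (reg 10)) ;; rset 31 (get 21 (reg 10)) ;; rset 32 (reg 10) ;; rset 33 0)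
    with hc1
  set c2 : Cmd := when (conj (ieq (get 28 (reg 10)) 0) (wlt (.get 5 (reg 10)) (.reg 7)))
    (.wset 7 0 (.get 5 (reg 10)) ;; rset 31 (reg 10) ;; rset 33 1) with hc2
  set Att : Store K → Prop := fun s' => s'.int 31 0 < n ∧ s.int 28 (s'.int 31 0) = 0 ∧
    ((s'.int 33 0 ≠ 0 ∧ s'.wt 7 0 = s.wt 5 (s'.int 31 0)) ∨
      (s'.int 33 0 = 0 ∧ s'.int 32 0 < n ∧ la (s'.int 32 0) = s'.int 31 0 ∧
        Reached la (s.int 26) (s.int 27) (s.int 28) (lb (s'.int 32 0)) ∧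
        s'.wt 7 0 = s.wt 5 (s'.int 31 0) + s.wt 6 (lb (s'.int 32 0)) - w (s'.int 32 0))) with hAtt
  have k1 := run_each_invariant (n := n) (s := s1) (x := 10) (p := c1)
    (fun k s' => Att s' ∧ ∀ v < k, s.int 28 (la v) = 0 →
      Reached la (s.int 26) (s.int 27) (s.int 28) (lb v) →
      s'.wt 7 0 ≤ s.wt 5 (la v) + s.wt 6 (lb v) - w v) (by simp [hAtt])
    ⟨by simp [hAtt, hs1, hr, hR], by simp⟩ ?_
  set s2 := Cmd.run n (each 10 c1) s1 with hs2
  have k2 := run_each_invariant (n := n) (s := s2) (x := 10) (p := c2)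
    (fun k s' => Att s' ∧ (∀ v < n, s.int 28 (la v) = 0 →
      Reached la (s.int 26) (s.int 27) (s.int 28) (lb v) →
      s'.wt 7 0 ≤ s.wt 5 (la v) + s.wt 6 (lb v) - w v) ∧
      ∀ a < k, s.int 28 a = 0 → s'.wt 7 0 ≤ s.wt 5 a) (by simp [hAtt]) ⟨k1.1, k1.2, by simp⟩ ?_
  · have hrun : s' = Cmd.run n (each 10 c2) s2 := by rw [hs']; rfl
    rw [← hrun] at k2
    exact ⟨k2.1.1, k2.1.2.1, k2.2.2, k2.2.1, k2.1.2.2⟩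
  · intro k s3 hk hx hi hw ⟨hA, hv, ha⟩
    have e28 : ∀ i, s3.int 28 i = s.int 28 i := fun i => by
      rw [hi 28 (by decide), hs2, int_run_of_notMem _ _ _ _ (by decide), hs1]; simp
    have e5 : ∀ i, s3.wt 5 i = s.wt 5 i := fun i => by
      rw [hw 5 (by decide), hs2, wt_run_of_notMem _ _ _ _ (by decide), hs1]; simp
    have hlt : ∀ u, u < k + 1 ↔ u < k ∨ u = k := by omega
    clear hi hw
    simp only [hc2, run_ite, run_seq, run_iset, run_wset, run_skip, holds_conj, holds_ieq,
      holds_wlt, eval_get, eval_ofNat, WExp.eval_get, hx, e28, e5]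
    split_ifs with h1
    · refine ⟨?_, ?_, ?_⟩
      · simp [hAtt, hx, hk, h1.1]
      · intro v hv' h2 h3
        simp only [Store.wt_setInt, Store.wt_setWt, true_and, if_true]
        exact h1.2.le.trans (hv v hv' h2 h3)
      · intro a ha' h2
        simp only [Store.wt_setInt, Store.wt_setWt, true_and, if_true]
        rcases (hlt a).1 ha' with h3 | rfl
        · exact h1.2.le.trans (ha a h3 h2)
        · exact le_rfl
    · refine ⟨hA, hv, fun a ha' h2 => ?_⟩
      rcases (hlt a).1 ha' with h3 | rfl
      · exact ha a h3 h2
      · exact not_lt.1 fun h4 => h1 ⟨h2, h4⟩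
  · intro k s3 hk hx hi hw ⟨hA, hv⟩
    have e28 : ∀ i, s3.int 28 i = s.int 28 i := fun i => by rw [hi 28 (by decide), hs1]; simp
    have e26 : ∀ i, s3.int 26 i = s.int 26 i := fun i => by rw [hi 26 (by decide), hs1]; simp
    have e27 : ∀ i, s3.int 27 i = s.int 27 i := fun i => by rw [hi 27 (by decide), hs1]; simp
    have e21 : ∀ i, s3.int 21 i = la i := fun i => by
      rw [hi 21 (by decide), hs1, ← h.left]; simp
    have e22 : ∀ i, s3.int 22 i = lb i := fun i => by
      rw [hi 22 (by decide), hs1, ← h.right]; simp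
    have e5 : ∀ i, s3.wt 5 i = s.wt 5 i := fun i => by rw [hw 5 (by decide), hs1]; simp
    have e6 : ∀ i, s3.wt 6 i = s.wt 6 i := fun i => by rw [hw 6 (by decide), hs1]; simp
    have e0 : ∀ i, s3.wt 0 i = w i := fun i => by
      rw [hw 0 (by decide), hs1, ← h.weight]; simp
    have hlt : ∀ u, u < k + 1 ↔ u < k ∨ u = k := by omega
    have hreach : (s.int 26 (lb k) = 0 ∨ 1 ≤ s.int 28 (la (s.int 27 (lb k)))) ↔
        Reached la (s.int 26) (s.int 27) (s.int 28) (lb k) := by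
      unfold Reached
      rw [Nat.one_le_iff_ne_zero]
    clear hi hw
    rw [hc1, run_ite]
    split_ifs with h1 <;> simp only [holds_conj, holds_ieq, holds_wlt, holds_reachedTest,
      eval_slack, eval_get, eval_ofNat, WExp.eval_get, hx, e28, e26, e27, e21, e22, e5, e6, e0,
      hreach] at h1
    · refine ⟨?_, ?_⟩
      · have h2 := hla k hk
        refine ⟨?_, ?_, Or.inr ⟨?_, ?_, ?_, ?_, ?_⟩⟩ <;>
          simp [hx, hk, h1, e21, h2, e5, e6, e22, e0]
      · intro v hv' h2 h3
        simp only [run_seq, run_iset, run_wset, eval_slack, Store.wt_setInt, Store.wt_setWt,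
          true_and, if_true, hx, e21, e22, e5, e6, e0, eval_get, eval_ofNat]
        rcases (hlt v).1 hv' with h4 | rfl
        · exact h1.2.2.le.trans (hv v h4 h2 h3)
        · exact le_rfl
    · refine ⟨hA, fun v hv' h2 h3 => ?_⟩
      rcases (hlt v).1 hv' with h4 | rfl
      · exact hv v h4 h2 h3
      · exact not_lt.1 fun h5 => h1 ⟨h2, h3, h5⟩

open Classical in
theorem doDualStep_spec (h : HoldsLabels n la lb w s) (s' : Store K)
    (hs' : s' = doDualStep.run n s) :
    (∀ a < n, s'.wt 5 a = if s.int 28 a = 0 then s.wt 5 a - s.wt 7 0 else s.wt 5 a) ∧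
    (∀ b < n, s'.wt 6 b = if Reached la (s.int 26) (s.int 27) (s.int 28) b then s.wt 6 b
      else s.wt 6 b + s.wt 7 0) ∧
    (∀ a, s'.int 28 a = if a = s.int 31 0 then 1 else s.int 28 a) ∧
    (∀ a, s'.int 29 a = if a = s.int 31 0 then s.int 32 0 else s.int 29 a) ∧
    (∀ a, s'.int 30 a = if a = s.int 31 0 then s.int 33 0 else s.int 30 a) := by
  set c1 : Cmd := when (ieq (get 28 (reg 10)) 0) (.wset 5 (reg 10) (.get 5 (reg 10) - .reg 7))
    with hc1
  set c2 : Cmd := when (neg (reachedTest (reg 10))) (.wset 6 (reg 10) (.get 6 (reg 10) + .reg 7))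
    with hc2
  set s1 := Cmd.run n (each 10 c1) s with hs1
  set s2 := Cmd.run n (each 10 c2) s1 with hs2
  have i1 : ∀ a, a ≠ 10 → ∀ i, s1.int a i = s.int a i := by
    intro a ha i
    exact int_run_of_notMem _ _ _ _ (by simp [hc1, imods, ha]) _
  have i2 : ∀ a, a ≠ 10 → ∀ i, s2.int a i = s.int a i := by
    intro a ha i
    rw [← i1 a ha]
    exact int_run_of_notMem _ _ _ _ (by simp [hc2, imods, ha]) _
  have k1 := run_each_invariant (n := n) (s := s) (x := 10) (p := c1)
    (fun k s' => ∀ a < n, s'.wt 5 a = if a < k ∧ s.int 28 a = 0 then s.wt 5 a - s.wt 7 0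
      else s.wt 5 a) (by simp) (by simp) ?_
  have k2 := run_each_invariant (n := n) (s := s1) (x := 10) (p := c2)
    (fun k s' => ∀ b < n, s'.wt 6 b = if b < k ∧ ¬ Reached la (s.int 26) (s.int 27) (s.int 28) b
      then s.wt 6 b + s.wt 7 0 else s.wt 6 b) (by simp) ?_ ?_
  · have hrun : s' = Cmd.run n (iset 28 (reg 31) 1 ;; iset 29 (reg 31) (reg 32) ;;
      iset 30 (reg 31) (reg 33)) s2 := by rw [hs']; rfl
    refine ⟨fun a ha => ?_, fun b hb => ?_, fun a => ?_, fun a => ?_, fun a => ?_⟩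
    · rw [hrun, wt_run_of_notMem _ _ _ _ (by decide), hs2, wt_run_of_notMem _ _ _ _ (by decide),
        k1 a ha]
      simp [ha]
    · rw [hrun, wt_run_of_notMem _ _ _ _ (by decide), k2 b hb]
      by_cases hb' : Reached la (s.int 26) (s.int 27) (s.int 28) b <;> simp [hb, hb']
    · rw [hrun]; simp [i2]
    · rw [hrun]; simp [i2]
    · rw [hrun]; simp [i2]
  · intro b hb
    rw [hs1, wt_run_of_notMem _ _ _ _ (by decide)]
    simp
  · intro k s3 hk hx hi hw hP b hb
    have e28 : ∀ i, s3.int 28 i = s.int 28 i := fun i => by rw [hi 28 (by decide), i1 _ (by decide)]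
    have e26 : ∀ i, s3.int 26 i = s.int 26 i := fun i => by rw [hi 26 (by decide), i1 _ (by decide)]
    have e27 : ∀ i, s3.int 27 i = s.int 27 i := fun i => by rw [hi 27 (by decide), i1 _ (by decide)]
    have e21 : ∀ i, s3.int 21 i = la i := fun i => by
      rw [hi 21 (by decide), i1 _ (by decide), ← h.left]
    have e7 : s3.wt 7 0 = s.wt 7 0 := by
      rw [hw 7 (by decide), hs1, wt_run_of_notMem _ _ _ _ (by decide)]
    have hreach : (s.int 26 k = 0 ∨ 1 ≤ s.int 28 (la (s.int 27 k))) ↔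
        Reached la (s.int 26) (s.int 27) (s.int 28) k := by
      unfold Reached
      rw [Nat.one_le_iff_ne_zero]
    have hPk := hP k hk
    have hPb := hP b hb
    clear hi hw hP
    have hholds : Test.Holds s3 (neg (reachedTest (reg 10))) ↔
        ¬ Reached la (s.int 26) (s.int 27) (s.int 28) k := by
      simp only [holds_neg, holds_reachedTest, eval_get, eval_ofNat, hx, e28, e26, e27, e21, hreach]
    have h3 : b < k + 1 ↔ b < k ∨ b = k := by omega
    rw [hc2, run_ite]
    by_cases h1 : Reached la (s.int 26) (s.int 27) (s.int 28) k <;> by_cases h2 : b = k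
    · subst h2
      rw [if_neg (by rw [hholds]; exact not_not.2 h1)]
      simp [h1, hPk]
    · rw [if_neg (by rw [hholds]; exact not_not.2 h1)]
      simp [h2, h3, hPb]
    · subst h2
      rw [if_pos (by rwa [hholds])]
      simp [h1, hx, e7, hPk]
    · rw [if_pos (by rwa [hholds])]
      simp [hx, h2, h3, hPb]
  · intro k s3 hk hx hi hw hP b hb
    have e28 : ∀ i, s3.int 28 i = s.int 28 i := fun i => by rw [hi 28 (by decide)]
    have e7 : s3.wt 7 0 = s.wt 7 0 := by rw [hw 7 (by decide)]
    have hPk := hP k hk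
    have hPb := hP b hb
    clear hi hw hP
    simp only [hc1, run_ite, run_wset, run_skip, holds_ieq, eval_get, eval_ofNat, WExp.eval_get,
      WExp.eval_sub, hx, e28, e7]
    by_cases h1 : b = k
    · subst h1
      by_cases h2 : s.int 28 b = 0 <;> simp [h2, hPk]
    · have h3 : b < k + 1 ↔ b < k := by omega
      by_cases h2 : s.int 28 k = 0 <;> simp [h1, h2, h3, hPb]

end Stage

end RAM

/-! ### A stage of the matching algorithm: growing the tree and augmenting. -/

namespace RAM

open Cmd IExp Test

variable {K : Type*} [AddCommGroup K] [LinearOrder K] {n : ℕ} {g : ℕ → ℕ → ℕ} {s : Store K}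

section Stage

variable {la lb : ℕ → ℕ} {w : ℕ → K}

omit [AddCommGroup K] [LinearOrder K] in
theorem HoldsLabels.congr {s' : Store K} (h : HoldsLabels n la lb w s)
    (h1 : ∀ i, s'.int 21 i = s.int 21 i) (h2 : ∀ i, s'.int 22 i = s.int 22 i)
    (h3 : ∀ i, s'.wt 0 i = s.wt 0 i) : HoldsLabels n la lb w s' :=
  ⟨(funext h1).trans h.left, (funext h2).trans h.right, (funext h3).trans h.weight⟩

variable [IsOrderedAddMonoid K]

/-- The tree grows backwards: it starts from possible ends of augmenting paths and not from the
vertex to be matched. Each round adds one left vertex to `R` until the vertex of the stage is in it,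
which happens within `n` rounds. -/
theorem growTree_spec (hla : ∀ v < n, la v < n) (hlb : ∀ v < n, lb v < n)
    (h : HoldsLabels n la lb w s) (hr : s.int 36 0 < n)
    (H : DualInvariant n la lb w (s.wt 5) (s.wt 6) (s.int 26) (s.int 27))
    (M : MatchedBelow n la (s.wt 5) (s.int 26) (s.int 27) (s.int 36 0))
    (hR : ∀ a < n, s.int 28 a = 0) (s' : Store K) (hs' : s' = (each 37 growTree).run n s) :
    DualInvariant n la lb w (s'.wt 5) (s'.wt 6) (s.int 26) (s.int 27) ∧
    MatchedBelow n la (s'.wt 5) (s.int 26) (s.int 27) (s.int 36 0) ∧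
    s'.int 28 (s.int 36 0) ≠ 0 ∧
    ∃ rk : ℕ → ℕ, ∀ a < n, s'.int 28 a ≠ 0 →
      TreeAt n la lb w (s'.wt 5) (s'.wt 6) (s.int 26) (s.int 27) (s'.int 28) (s'.int 29)
        (s'.int 30) rk a ∧ rk a < n := by
  set r := s.int 36 0 with hrdef
  have key := run_each_invariant (n := n) (s := s) (x := 37) (p := growTree)
    (fun k s' => DualInvariant n la lb w (s'.wt 5) (s'.wt 6) (s.int 26) (s.int 27) ∧
      MatchedBelow n la (s'.wt 5) (s.int 26) (s.int 27) r ∧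
      (s'.int 28 r ≠ 0 ∨ k ≤ ((Finset.range n).filter fun a => s'.int 28 a ≠ 0).card) ∧
      ∃ rk : ℕ → ℕ, ∀ a < n, s'.int 28 a ≠ 0 →
        TreeAt n la lb w (s'.wt 5) (s'.wt 6) (s.int 26) (s.int 27) (s'.int 28) (s'.int 29)
          (s'.int 30) rk a ∧ rk a < k) ?_ ?_ ?_
  · rw [← hs'] at key
    obtain ⟨h1, h2, h3, h4⟩ := key
    refine ⟨h1, h2, h3.elim id fun h5 => ?_, h4⟩
    -- If `R` has `n` elements, then it contains all left vertices.
    have h6 := Finset.eq_of_subset_of_card_le (Finset.filter_subset _ (Finset.range n))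
      (by rwa [Finset.card_range])
    have h7 : r ∈ (Finset.range n).filter fun a => s'.int 28 a ≠ 0 := by
      rw [h6]; exact Finset.mem_range.2 hr
    exact (Finset.mem_filter.1 h7).2
  · intro k s4 j h4
    have h5 : ∀ a, a ≠ 37 → (s4.setInt 37 0 j).int a = s4.int a := by
      intro a ha
      funext i
      simp [ha]
    rw [h5 28 (by decide), h5 29 (by decide), h5 30 (by decide)]
    exact h4
  · exact ⟨H, M, Or.inr (Nat.zero_le _), fun _ => 0, fun a ha h1 => absurd (hR a ha) h1⟩
  intro k s1 hk hx hi hw ⟨h1, h2, h3, rk, h4⟩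
  have e36 : s1.int 36 0 = r := by rw [hi 36 (by decide)]
  have e26 : s1.int 26 = s.int 26 := funext fun i => hi 26 (by decide) i
  have e27 : s1.int 27 = s.int 27 := funext fun i => hi 27 (by decide) i
  have hL : HoldsLabels n la lb w s1 := h.congr (hi 21 (by decide)) (hi 22 (by decide))
    (hw 0 (by decide))
  rw [← e26, ← e27] at h1 h2 h4 ⊢
  clear hi hw
  have hholds : Test.Holds s1 (ieq (get 28 (reg 36)) 0) ↔ s1.int 28 r = 0 := by simp [e36]
  unfold growTree
  rw [run_ite]
  by_cases h0 : s1.int 28 r = 0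
  · rw [if_pos (by rwa [hholds]), run_seq]
    have D := pickDualStep_spec hla hL (by rwa [e36]) (by rwa [e36]) _ rfl
    set s2 := Cmd.run n pickDualStep s1 with hs2
    have hL2 : HoldsLabels n la lb w s2 := hL.congr (int_run_of_notMem _ _ _ _ (by decide))
      (int_run_of_notMem _ _ _ _ (by decide)) (wt_run_of_notMem _ _ _ _ (by decide))
    obtain ⟨d1, d2, d3, d4, d5⟩ := doDualStep_spec hL2 _ rfl
    set s3 := Cmd.run n doDualStep s2 with hs3
    have f26 : s2.int 26 = s1.int 26 := funext (int_run_of_notMem _ _ _ _ (by decide))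
    have f27 : s2.int 27 = s1.int 27 := funext (int_run_of_notMem _ _ _ _ (by decide))
    have f28 : s2.int 28 = s1.int 28 := funext (int_run_of_notMem _ _ _ _ (by decide))
    have f29 : s2.int 29 = s1.int 29 := funext (int_run_of_notMem _ _ _ _ (by decide))
    have f30 : s2.int 30 = s1.int 30 := funext (int_run_of_notMem _ _ _ _ (by decide))
    have g5 : s2.wt 5 = s1.wt 5 := funext (wt_run_of_notMem _ _ _ _ (by decide))
    have g6 : s2.wt 6 = s1.wt 6 := funext (wt_run_of_notMem _ _ _ _ (by decide))
    rw [f28, g5] at d1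
    rw [f26, f27, f28, g6] at d2
    rw [f28] at d3
    rw [f29] at d4
    rw [f30] at d5
    clear_value s2 s3
    refine ⟨h1.step hla hlb D d1 d2, h2.step h1 D d1, ?_,
      TreeAt.step hla hlb h1 D h4 d1 d2 (fun a _ => d3 a) (fun a _ => d4 a) fun a _ => d5 a⟩
    right
    refine Nat.succ_le_of_lt ((h3.resolve_left (not_not.2 h0)).trans_lt
      (Finset.card_lt_card ⟨fun a ha => ?_, fun h5 => ?_⟩))
    · rw [Finset.mem_filter] at ha ⊢
      refine ⟨ha.1, ?_⟩
      rw [d3]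
      split_ifs
      · exact one_ne_zero
      · exact ha.2
    · have h6 := h5 (Finset.mem_filter.2 ⟨Finset.mem_range.2 D.lt, by rw [d3, if_pos rfl]; simp⟩)
      exact (Finset.mem_filter.1 h6).2 D.fresh
  · rw [if_neg (by rwa [hholds]), run_skip]
    exact ⟨h1, h2, Or.inl h0, rk, fun a ha h5 => ⟨(h4 a ha h5).1, (h4 a ha h5).2.trans_le
      (Nat.le_succ k)⟩⟩

-- The three outcomes are `WalkInvariant.halt`, `WalkInvariant.finish` and `WalkInvariant.step`. In
-- the last one the displaced vertex is read before its entry is overwritten, and its smaller rank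
-- measures progress.
omit [IsOrderedAddMonoid K] in
theorem walkStep_spec (hla : ∀ v < n, la v < n) (hlb : ∀ v < n, lb v < n)
    (h : HoldsLabels n la lb w s) {r : ℕ} {rk : ℕ → ℕ}
    (H : DualInvariant n la lb w (s.wt 5) (s.wt 6) (s.int 26) (s.int 27))
    (W : WalkInvariant n la lb w (s.wt 5) (s.wt 6) (s.int 26) (s.int 27) (s.int 28) (s.int 29)
      (s.int 30) rk r (s.int 34 0))
    (h0 : s.int 35 0 = 0) (s' : Store K) (hs' : s' = walkStep.run n s) :
    DualInvariant n la lb w (s.wt 5) (s.wt 6) (s'.int 26) (s'.int 27) ∧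
    ((s'.int 35 0 ≠ 0 ∧ MatchedBelow n la (s.wt 5) (s'.int 26) (s'.int 27) (r + 1)) ∨
    (s'.int 35 0 = 0 ∧ rk (s'.int 34 0) < rk (s.int 34 0) ∧
      WalkInvariant n la lb w (s.wt 5) (s.wt 6) (s'.int 26) (s'.int 27) (s.int 28) (s.int 29)
        (s.int 30) rk r (s'.int 34 0))) := by
  set x := s.int 34 0 with hx
  have e21 : ∀ i, s.int 21 i = la i := fun i => by rw [← h.left]
  have e22 : ∀ i, s.int 22 i = lb i := fun i => by rw [← h.right]
  subst hs'
  unfold walkStep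
  rw [run_ite, if_pos (by simp [h0]), run_ite]
  by_cases h1 : s.int 30 x = 0
  · rw [if_neg (by simp [← hx, h1])]
    obtain ⟨h2, -⟩ | ⟨-, hv, hxv, ht, -⟩ := W.tree x W.lt W.mem le_rfl
    · exact absurd h1 h2
    simp only [run_seq, run_iset, eval_get, eval_ofNat, ← hx]
    rw [run_ite]
    by_cases h3 : s.int 26 (lb (s.int 29 x)) = 0
    · rw [if_pos (by simp [e22, h3])]
      have hmf : ∀ b < n, (fun b => if b = lb (s.int 29 x) then 1 else s.int 26 b) b =
        if b = lb (s.int 29 x) then 1 else s.int 26 b := fun _ _ => rfl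
      have hmt : ∀ b < n, (fun b => if b = lb (s.int 29 x) then s.int 29 x else s.int 27 b) b =
        if b = lb (s.int 29 x) then s.int 29 x else s.int 27 b := fun _ _ => rfl
      have h4 := H.rematch hv hxv W.unmatched ht hmf hmt
      have h5 := W.finish hlb h1 h3 hmf hmt
      refine ⟨?_, Or.inl ⟨by simp, ?_⟩⟩
      · convert h4 using 1 <;> funext b <;> simp [e22]
      · convert h5 using 1 <;> funext b <;> simp [e22]
    · rw [if_neg (by simp [e22, h3])]
      have hmf : ∀ b < n, (fun b => if b = lb (s.int 29 x) then 1 else s.int 26 b) b =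
        if b = lb (s.int 29 x) then 1 else s.int 26 b := fun _ _ => rfl
      have hmt : ∀ b < n, (fun b => if b = lb (s.int 29 x) then s.int 29 x else s.int 27 b) b =
        if b = lb (s.int 29 x) then s.int 29 x else s.int 27 b := fun _ _ => rfl
      have h4 := H.rematch hv hxv W.unmatched ht hmf hmt
      have h5 := W.step hla hlb H h1 h3 hmf hmt
      refine ⟨?_, Or.inr ⟨by simp [h0], ?_, ?_⟩⟩
      · convert h4 using 1 <;> funext b <;> simp [e22]
      · simpa [e22, e21] using h5.2
      · convert h5.1 using 1
        · funext b; simp [e22]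
        · funext b; simp [e22]
        · simp [e22, e21]
  · rw [if_pos (by simp [← hx]; omega)]
    refine ⟨?_, Or.inl ⟨by simp, ?_⟩⟩
    · convert H using 1 <;> funext b <;> simp
    · convert W.halt h1 using 1 <;> funext b <;> simp

/-- After the growth of the tree a path leads from `r` to a possible end, and walking along it makes
the matching finished for one more left vertex. -/
theorem matchVertex_spec (hla : ∀ v < n, la v < n) (hlb : ∀ v < n, lb v < n)
    (h : HoldsLabels n la lb w s) {r : ℕ} (hr : r < n) (hr36 : s.int 36 0 = r)
    (H : DualInvariant n la lb w (s.wt 5) (s.wt 6) (s.int 26) (s.int 27))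
    (M : MatchedBelow n la (s.wt 5) (s.int 26) (s.int 27) r) (s' : Store K)
    (hs' : s' = matchVertex.run n s) :
    DualInvariant n la lb w (s'.wt 5) (s'.wt 6) (s'.int 26) (s'.int 27) ∧
    MatchedBelow n la (s'.wt 5) (s'.int 26) (s'.int 27) (r + 1) := by
  have k1 := run_each_invariant (n := n) (s := s) (x := 10) (p := iset 28 (reg 10) 0)
    (fun k s' => ∀ a < k, s'.int 28 a = 0) (by simp) (by simp) (by
      intro k s1 hk hx hi hw hP a ha
      by_cases hak : a = k
      · simp [hx, hak]
      · simp [hx, hak, hP a (by omega)])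
  set s1 := Cmd.run n (each 10 (iset 28 (reg 10) 0)) s with hs1
  have e21 : ∀ i, s1.int 21 i = s.int 21 i := int_run_of_notMem _ _ _ _ (by decide)
  have e22 : ∀ i, s1.int 22 i = s.int 22 i := int_run_of_notMem _ _ _ _ (by decide)
  have e26 : s1.int 26 = s.int 26 := funext (int_run_of_notMem _ _ _ _ (by decide))
  have e27 : s1.int 27 = s.int 27 := funext (int_run_of_notMem _ _ _ _ (by decide))
  have e36 : s1.int 36 0 = r := by rw [hs1, int_run_of_notMem _ _ _ _ (by decide), hr36]
  have e0 : ∀ i, s1.wt 0 i = s.wt 0 i := wt_run_of_notMem _ _ _ _ (by decide)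
  have e5 : s1.wt 5 = s.wt 5 := funext (wt_run_of_notMem _ _ _ _ (by decide))
  have e6 : s1.wt 6 = s.wt 6 := funext (wt_run_of_notMem _ _ _ _ (by decide))
  have hL1 : HoldsLabels n la lb w s1 := h.congr e21 e22 e0
  have k2 := growTree_spec hla hlb hL1 (by rwa [e36]) (by rwa [e5, e6, e26, e27])
    (by rwa [e5, e26, e27, e36]) k1 _ rfl
  set s2 := Cmd.run n (each 37 growTree) s1 with hs2
  have f26 : s2.int 26 = s1.int 26 := funext (int_run_of_notMem _ _ _ _ (by decide))
  have f27 : s2.int 27 = s1.int 27 := funext (int_run_of_notMem _ _ _ _ (by decide))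
  have f36 : s2.int 36 0 = r := by rw [hs2, int_run_of_notMem _ _ _ _ (by decide), e36]
  have hL2 : HoldsLabels n la lb w s2 := hL1.congr (int_run_of_notMem _ _ _ _ (by decide))
    (int_run_of_notMem _ _ _ _ (by decide)) (wt_run_of_notMem _ _ _ _ (by decide))
  rw [← f26, ← f27, e36] at k2
  obtain ⟨H2, M2, hR, rk, hT⟩ := k2
  set s3 := Cmd.run n (rset 34 (reg 36) ;; rset 35 0) s2 with hs3
  have hrun : s' = Cmd.run n (each 37 walkStep) s3 := by rw [hs']; rfl
  have g : ∀ a, a ≠ 34 → a ≠ 35 → s3.int a = s2.int a := by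
    intro a h1 h2
    funext i
    simp [hs3, h1, h2]
  have gw : ∀ a, s3.wt a = s2.wt a := by
    intro a
    funext i
    simp [hs3]
  have g34 : s3.int 34 0 = r := by simp [hs3, f36]
  have g35 : s3.int 35 0 = 0 := by simp [hs3]
  -- The rank of the walker starts below `n` and drops in every step, so an unfinished walk is
  -- impossible after `n` steps.
  have key := run_each_invariant (n := n) (s := s3) (x := 37) (p := walkStep)
    (fun k s' => DualInvariant n la lb w (s2.wt 5) (s2.wt 6) (s'.int 26) (s'.int 27) ∧
      ((s'.int 35 0 ≠ 0 ∧ MatchedBelow n la (s2.wt 5) (s'.int 26) (s'.int 27) (r + 1)) ∨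
      (s'.int 35 0 = 0 ∧ rk (s'.int 34 0) + k < n ∧
      WalkInvariant n la lb w (s2.wt 5) (s2.wt 6) (s'.int 26) (s'.int 27) (s2.int 28) (s2.int 29)
        (s2.int 30) rk r (s'.int 34 0)))) ?_ ?_ ?_
  · rw [← hrun] at key
    have w5 : s'.wt 5 = s2.wt 5 := by
      rw [hrun, ← gw]; exact funext (wt_run_of_notMem _ _ _ _ (by decide))
    have w6 : s'.wt 6 = s2.wt 6 := by
      rw [hrun, ← gw]; exact funext (wt_run_of_notMem _ _ _ _ (by decide))
    rw [w5, w6]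
    refine ⟨key.1, ?_⟩
    rcases key.2 with h1 | ⟨-, h1, -⟩
    · exact h1.2
    · omega
  · intro k s4 j h4
    have h5 : ∀ a, a ≠ 37 → (s4.setInt 37 0 j).int a = s4.int a := by
      intro a ha
      funext i
      simp [ha]
    rwa [h5 26 (by decide), h5 27 (by decide), h5 34 (by decide), h5 35 (by decide)]
  · rw [g 26 (by decide) (by decide), g 27 (by decide) (by decide), g34, g35]
    refine ⟨H2, Or.inr ⟨rfl, (hT r hr hR).2, hr, le_rfl, ?_, ?_, ?_, hR, fun a ha h1 _ =>
      (hT a ha h1).1⟩⟩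
    · rintro ⟨b, hb, h1, h2⟩
      have := M2.lt b hb h1
      omega
    · intro a ha han har
      exact M2.done a (by omega) han
    · intro b hb h1
      exact (M2.lt b hb h1).le
  · intro k s4 hk hx hi hw ⟨h1, h2⟩
    have i : ∀ a, a ∉ 37 :: walkStep.imods → a ≠ 34 → a ≠ 35 → s4.int a = s2.int a := by
      intro a ha h3 h4
      rw [← g a h3 h4]
      exact funext (hi a ha)
    have iw : ∀ a, a ∉ walkStep.wmods → s4.wt a = s2.wt a := by
      intro a ha
      rw [← gw]
      exact funext (hw a ha)
    have e5 := iw 5 (by decide)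
    have e6 := iw 6 (by decide)
    have e28 := i 28 (by decide) (by decide) (by decide)
    have e29 := i 29 (by decide) (by decide) (by decide)
    have e30 := i 30 (by decide) (by decide) (by decide)
    have hL4 : HoldsLabels n la lb w s4 := hL2.congr
      (congrFun (i 21 (by decide) (by decide) (by decide)))
      (congrFun (i 22 (by decide) (by decide) (by decide)))
      (congrFun (iw 0 (by decide)))
    rcases h2 with ⟨h3, h4⟩ | ⟨h3, h4, h5⟩
    · have : Cmd.run n walkStep s4 = s4 := by
        unfold walkStep
        rw [run_ite, if_neg (by simp [h3]), run_skip]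
      rw [this]
      exact ⟨h1, Or.inl ⟨h3, h4⟩⟩
    · rw [← e5, ← e6] at h1 ⊢
      rw [← e5, ← e6, ← e28, ← e29, ← e30] at h5
      have h6 := walkStep_spec hla hlb hL4 h1 h5 h3 _ rfl
      rw [← e28, ← e29, ← e30]
      refine ⟨h6.1, h6.2.imp_right fun h7 => ⟨h7.1, ?_, h7.2.2⟩⟩
      have := h7.2.1
      omega

/-- By the labels, `v` is an edge from `la v` to `lb v`, and adjacency means sharing an end. The
empty matching with a feasible dual solution starts the algorithm, and after `n` stages all left
vertices are finished. -/
theorem solveLine_spec (hw : ∀ u < n, 0 ≤ s.wt 0 u) (hg : ∀ u < n, ∀ v < n, g u v = g v u)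
    (h : HoldsGraph n g s) (hc : IsArcColouring n 1 g fun u v => s.int 6 (u * n + v)) :
    IsMaxStableWeight n g (fun u => s.wt 0 u) ((solveLine.run n s).wt 1 0) := by
  set s1 := Cmd.run n (computeLabels 21 1) s with hs1
  have l1 : ∀ v < n, IsLabel n g (fun u v => s.int 6 (u * n + v)) 1 v (s1.int 21 v) :=
    computeLabels_spec (Or.inl rfl) h
  have e6 : ∀ i, s1.int 6 i = s.int 6 i := int_run_of_notMem _ _ _ _ (by decide)
  have h1 : HoldsGraph n g s1 := h.congr (int_run_of_notMem _ _ _ _ (by decide))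
    (int_run_of_notMem _ _ _ _ (by decide))
  set s2 := Cmd.run n (computeLabels 22 2) s1 with hs2
  have l2 : ∀ v < n, IsLabel n g (fun u v => s1.int 6 (u * n + v)) 2 v (s2.int 22 v) :=
    computeLabels_spec (Or.inr rfl) h1
  simp only [e6] at l2
  set la := s1.int 21 with hla'
  set lb := s2.int 22 with hlb'
  have hla : ∀ v < n, la v < n := fun v hv => (l1 v hv).2.1.trans_lt hv
  have hlb : ∀ v < n, lb v < n := fun v hv => (l2 v hv).2.1.trans_lt hv
  set s3 := Cmd.run n computeTotal s2 with hs3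
  set W := ∑ u ∈ Finset.range n, s.wt 0 u with hW
  have w1 : ∀ i, s1.wt 0 i = s.wt 0 i := wt_run_of_notMem _ _ _ _ (by decide)
  have w2 : ∀ i, s2.wt 0 i = s1.wt 0 i := wt_run_of_notMem _ _ _ _ (by decide)
  have w3 : ∀ i, s3.wt 0 i = s2.wt 0 i := wt_run_of_notMem _ _ _ _ (by decide)
  have hW3 : s3.wt 4 0 = W := by
    rw [hs3, computeTotal_spec, hW]
    exact Finset.sum_congr rfl fun u _ => by rw [w2, w1]
  have i3 : ∀ i, s3.int 21 i = la i := fun i => by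
    rw [hs3, int_run_of_notMem _ _ _ _ (by decide), hs2, int_run_of_notMem _ _ _ _ (by decide)]
  have i3' : ∀ i, s3.int 22 i = lb i := fun i => by
    rw [hs3, int_run_of_notMem _ _ _ _ (by decide)]
  set c4 : Cmd := iset 26 (reg 10) 0 ;; .wset 5 (reg 10) (.reg 4) ;; .wset 6 (reg 10) 0 with hc4
  have k4 := run_each_invariant (n := n) (s := s3) (x := 10) (p := c4)
    (fun k s' => ∀ a < k, s'.int 26 a = 0 ∧ s'.wt 5 a = W ∧ s'.wt 6 a = 0) (by simp) (by simp) (by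
      intro k s4 hk hx hi hw hP a ha
      have e4 : s4.wt 4 0 = W := by rw [hw 4 (by decide), hW3]
      by_cases hak : a = k
      · simp [hc4, hx, hak, e4]
      · simp [hc4, hx, hak, hP a (by omega)])
  set s4 := Cmd.run n (each 10 c4) s3 with hs4
  have L4 : HoldsLabels n la lb (s.wt 0) s4 :=
    ⟨funext fun i => by rw [hs4, int_run_of_notMem _ _ _ _ (by decide), i3],
      funext fun i => by rw [hs4, int_run_of_notMem _ _ _ _ (by decide), i3'],
      funext fun i => by rw [hs4, wt_run_of_notMem _ _ _ _ (by decide), w3, w2, w1]⟩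
  have hWn : 0 ≤ W := Finset.sum_nonneg fun u hu => hw u (Finset.mem_range.1 hu)
  -- The dual solution `p = W`, `q = 0` is feasible because no weight exceeds the total weight.
  have H4 : DualInvariant n la lb (s.wt 0) (s4.wt 5) (s4.wt 6) (s4.int 26) (s4.int 27) := by
    refine ⟨fun a ha => ?_, fun a ha => ?_, fun v hv => ?_, fun b hb hm => ?_, fun b hb hm => ?_,
      fun b hb hm => ?_, fun b hb b' _ hm => ?_, fun b hb _ => (k4 b hb).2.2⟩
    · rwa [(k4 a ha).2.1]
    · rw [(k4 a ha).2.2]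
    · rw [(k4 _ (hla v hv)).2.1, (k4 _ (hlb v hv)).2.2, add_zero]
      exact Finset.single_le_sum (f := fun u => s.wt 0 u)
        (fun u hu => hw u (Finset.mem_range.1 hu)) (Finset.mem_range.2 hv)
    all_goals exact absurd (k4 b hb).1 hm
  have M4 : MatchedBelow n la (s4.wt 5) (s4.int 26) (s4.int 27) 0 :=
    ⟨fun b hb hm => absurd (k4 b hb).1 hm, fun a ha => absurd ha (Nat.not_lt_zero a)⟩
  have k5 := run_each_invariant (n := n) (s := s4) (x := 36) (p := matchVertex)
    (fun k s' => DualInvariant n la lb (s.wt 0) (s'.wt 5) (s'.wt 6) (s'.int 26) (s'.int 27) ∧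
      MatchedBelow n la (s'.wt 5) (s'.int 26) (s'.int 27) k) (by
      intro k s5 j h5
      have h6 : ∀ a, a ≠ 36 → (s5.setInt 36 0 j).int a = s5.int a := by
        intro a ha
        funext i
        simp [ha]
      rw [h6 26 (by decide), h6 27 (by decide)]
      exact h5) ⟨H4, M4⟩ (by
      intro k s5 hk hx hi hw hP
      exact matchVertex_spec hla hlb (L4.congr (hi 21 (by decide)) (hi 22 (by decide))
        (hw 0 (by decide))) hk hx hP.1 hP.2 _ rfl)
  set s5 := Cmd.run n (each 36 matchVertex) s4 with hs5
  have hmax := k5.1.isMaxStableWeight hla hlb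
    (fun u hu v hv huv => hc.adj_iff_label hg l1 l2 hu hv huv) fun a ha => k5.2.done a ha ha
  set c6 : Cmd := .wset 1 0 (.reg 1 + .get 5 (reg 10) + .get 6 (reg 10)) with hc6
  have k6 := run_each_invariant (n := n) (s := Cmd.run n (.wset 1 0 0) s5) (x := 10) (p := c6)
    (fun k s' => s'.wt 1 0 = ∑ a ∈ Finset.range k, s5.wt 5 a + ∑ b ∈ Finset.range k, s5.wt 6 b)
    (by simp) (by simp) (by
      intro k s6 hk hx hi hw hP
      have e5 : s6.wt 5 k = s5.wt 5 k := by rw [hw 5 (by decide)]; simp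
      have e6 : s6.wt 6 k = s5.wt 6 k := by rw [hw 6 (by decide)]; simp
      simp only [hc6, run_wset, Store.wt_setWt, eval_get, eval_ofNat, WExp.eval_add, WExp.eval_get,
        hx, e5, e6, hP, Finset.sum_range_succ, and_self, if_true]
      abel)
  rw [← k6] at hmax
  exact hmax

end Stage

end RAM

namespace RAM

open Cmd IExp Test

variable {K : Type*} [AddCommGroup K] [LinearOrder K] {n : ℕ} {g : ℕ → ℕ → ℕ} {s : Store K}

/-! ### The largest of several weights -/

/-- Raise the weight in register `1` to the value of `e`. -/
def raise (e : WExp) : Cmd := when (wlt (.reg 1) e) (.wset 1 0 e)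

/-- Stating the result as the greatest element of the old value and the new one allows composition
by `isGreatest_insert_union`. -/
theorem raise_spec (e : WExp) :
    IsGreatest (insert (s.wt 1 0) {e.eval s}) (((raise e).run n s).wt 1 0) := by
  unfold raise
  rw [run_ite]
  split_ifs with h
  · simp only [holds_wlt] at h
    simpa [IsGreatest, upperBounds] using h.le
  · simp only [holds_wlt, not_lt] at h
    simpa [IsGreatest, upperBounds] using h

omit [AddCommGroup K] in
theorem isGreatest_insert_union {a b c : K} {A B : Set K} (h : IsGreatest (insert a A) b)
    (h' : IsGreatest (insert b B) c) : IsGreatest (insert a (A ∪ B)) c := by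
  refine ⟨?_, ?_⟩
  · rcases h'.1 with rfl | h1
    · rcases h.1 with rfl | h2
      · exact Or.inl rfl
      · exact Or.inr (Or.inl h2)
    · exact Or.inr (Or.inr h1)
  · have hbc : b ≤ c := h'.2 (Or.inl rfl)
    rintro x (rfl | h1 | h1)
    · exact (h.2 (Or.inl rfl)).trans hbc
    · exact (h.2 (Or.inr h1)).trans hbc
    · exact h'.2 (Or.inr h1)

/-- A loop of rounds, each of which takes a maximum over its own set of candidates, takes the
maximum over the union. Nested loops are treated by nesting this rule. -/
theorem run_each_isGreatest {x : ℕ} {p : Cmd} (A : ℕ → Set K)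
    (step : ∀ k s', k < n → s'.int x 0 = k →
      (∀ a, a ∉ x :: p.imods → ∀ i, s'.int a i = s.int a i) →
      (∀ a, a ∉ p.wmods → ∀ i, s'.wt a i = s.wt a i) →
      IsGreatest (insert (s'.wt 1 0) (A k)) ((p.run n s').wt 1 0)) :
    IsGreatest (insert (s.wt 1 0) {y | ∃ k < n, y ∈ A k}) (((Cmd.each x p).run n s).wt 1 0) := by
  refine run_each_invariant (s := s) (x := x) (p := p)
    (fun k s' => IsGreatest (insert (s.wt 1 0) {y | ∃ i < k, y ∈ A i}) (s'.wt 1 0))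
    (fun k s' j h => h) (by simp [IsGreatest, upperBounds]) ?_
  intro k s' hk hx hi hw hP
  convert isGreatest_insert_union hP (step k s' hk hx hi hw) using 2
  ext y
  simp only [Nat.lt_succ_iff_lt_or_eq, or_and_right, exists_or, exists_eq_left, Set.mem_ofPred_eq,
    Set.mem_union]

-- To maximize over all stable sets it suffices to examine a subfamily that dominates the others.
omit [AddCommGroup K] in
theorem IsGreatest.of_dominated {A C : Set K} {a : K} (h : IsGreatest A a) (hAC : A ⊆ C)
    (hC : ∀ c ∈ C, ∃ b ∈ A, c ≤ b) : IsGreatest C a := by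
  refine ⟨hAC h.1, fun c hc => ?_⟩
  obtain ⟨b, hb, hcb⟩ := hC c hc
  exact hcb.trans (h.2 hb)

/-- Add up the weights of the vertices that pass the test `b` in register `2`. The vertex is in
register `x`. -/
def addWeights (x : ℕ) (b : Test) : Cmd :=
  each x (when b (.wset 2 0 (.reg 2 + .get 0 (reg x))))

theorem addWeights_spec {x : ℕ} {b : Test} {C : ℕ → Prop} [DecidablePred C]
    (hb : ∀ s' : Store K, ∀ k < n, s'.int x 0 = k →
      (∀ a, a ≠ x → ∀ i, s'.int a i = s.int a i) → (∀ a, a ≠ 2 → ∀ i, s'.wt a i = s.wt a i) →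
      (b.Holds s' ↔ C k)) :
    ((addWeights x b).run n s).wt 2 0 = s.wt 2 0 + ∑ u ∈ Finset.range n with C u, s.wt 0 u := by
  refine run_each_invariant (s := s) (x := x) (p := when b (.wset 2 0 (.reg 2 + .get 0 (reg x))))
    (fun k s' => s'.wt 2 0 = s.wt 2 0 + ∑ u ∈ Finset.range k with C u, s.wt 0 u)
    (fun k s' j h => h) (by simp) ?_
  intro k s' hk hx hi hw hP
  have e0 : s'.wt 0 k = s.wt 0 k := hw 0 (by simp [wmods]) k
  have h1 := hb s' k hk hx (fun a ha i => hi a (by simp [imods, ha]) i)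
    (fun a ha i => hw a (by simp [wmods, ha]) i)
  rw [run_ite, Finset.range_add_one, Finset.filter_insert]
  split_ifs with h2 h3 h3
  · rw [Finset.sum_insert (by simp)]
    simp only [run_wset, Store.wt_setWt, eval_get, eval_ofNat, WExp.eval_add, WExp.eval_get, hx,
      e0, hP, and_self, if_true]
    abel
  · exact absurd (h1.1 h2) h3
  · exact absurd (h1.2 h3) h2
  · exact hP

/-! ### Triangles that are not strong -/

/-- Every triangle is strong. -/
def StrongTriangles (n : ℕ) (g : ℕ → ℕ → ℕ) : Prop :=
  ∀ u < n, ∀ v < n, ∀ w < n, 1 ≤ g u w → 1 ≤ g v w → g u v ≠ 1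

/-- Raise the flag in register `8` if there is a triangle that is not strong. -/
def checkTriangles : Cmd :=
  each 10 (each 11 (each 12 (when (conj (ile 1 (get 4 (entry (reg 10) (reg 12))))
      (conj (ile 1 (get 4 (entry (reg 11) (reg 12)))) (ieq (get 4 (entry (reg 10) (reg 11))) 1)))
    (rset 8 1))))

theorem checkTriangles_spec (h : HoldsGraph n g s) :
    (checkTriangles.run n s).int 8 0 = 0 ↔ s.int 8 0 = 0 ∧ StrongTriangles n g := by
  refine run_each_flag (by decide) _ fun u s1 hu hx1 hi1 hw1 => ?_
  refine run_each_flag (by decide) _ fun v s2 hv hx2 hi2 hw2 => ?_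
  refine run_each_flag (by decide) _ fun w s3 hw hx3 hi3 hw3 => ?_
  have e10 : s3.int 10 0 = u := by rw [hi3 10 (by decide), hi2 10 (by decide), hx1]
  have e11 : s3.int 11 0 = v := by rw [hi3 11 (by decide), hx2]
  have h3 : HoldsGraph n g s3 := h.congr
    (fun i => by rw [hi3 0 (by decide), hi2 0 (by decide), hi1 0 (by decide)])
    (fun i => by rw [hi3 4 (by decide), hi2 4 (by decide), hi1 4 (by decide)])
  clear hi1 hi2 hi3 hw1 hw2 hw3
  have huv := h3.graph u hu v hv
  have huw := h3.graph u hu w hw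
  have hvw := h3.graph v hv w hw
  rw [run_ite]
  split_ifs with h4 <;> simp only [holds_conj, holds_ile, holds_ieq, eval_get, eval_add, eval_mul,
    eval_ofNat, h3.size, e10, e11, hx3, huv, huw, hvw] at h4
  · simp only [run_iset, Store.int_setInt]
    simp [h4]
  · simp only [run_skip, iff_self_and]
    exact fun _ h5 h6 h7 => h4 ⟨h5, h6, h7⟩

/-! ### Strong cliques in graphs without diamonds -/

/-- Any two common neighbours of two adjacent vertices are adjacent. -/
def DiamondFree (n : ℕ) (g : ℕ → ℕ → ℕ) : Prop :=
  ∀ u < n, ∀ v < n, ∀ x < n, ∀ y < n, 1 ≤ g u v → 1 ≤ g x u → 1 ≤ g x v → 1 ≤ g u y → 1 ≤ g v y →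
    x ≠ y → 1 ≤ g x y

/-- In mode `0` there is no triangle at all. In mode `1` the arcs of a triangle share a colour, so
in a diamond the two triangles on `uv` have the same colour, and then `x` and `y` cannot be
nonadjacent. -/
theorem IsArcColouring.diamondFree {mode : ℕ} {f : ℕ → ℕ → ℕ} (hf : IsArcColouring n mode g f)
    (hg : ∀ u < n, ∀ v < n, g u v = g v u) : DiamondFree n g := by
  intro u hu v hv x hx y hy huv hxu hxv huy hvy hxy
  by_contra h
  have hvu : 1 ≤ g v u := by rwa [hg v hv u hu]
  have h1 := hf.differ x hx u hu y hy hxu huy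
  have h2 := hf.differ x hx u hu v hv hxu huv
  have h3 := hf.differ v hv u hu y hy hvu huy
  have h4 := hf.differ u hu v hv u hu huv hvu
  have r1 := hf.range x hx u hu hxu
  have r2 := hf.range u hu v hv huv
  have r3 := hf.range v hv u hu hvu
  have r4 := hf.range u hu y hy huy
  unfold Differ at h1 h2 h3 h4
  by_cases hm : mode = 0
  · have hvx : 1 ≤ g v x := by rwa [hg v hv x hx]
    have h5 := hf.differ u hu v hv x hx huv hvx
    have h6 := hf.differ v hv x hx u hu hvx hxu
    have r5 := hf.range v hv x hx hvx
    simp only [Differ, hm, true_or, iff_true] at h2 h5 h6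
    omega
  · have h7 : y ≠ x ∧ g x y = 0 := ⟨Ne.symm hxy, by omega⟩
    simp only [hm, false_or] at h1 h2 h3 h4
    omega

/-- The arcs around a triangle would be three objects, pairwise different in colour, with two
colours. -/
theorem IsArcColouring.strongTriangles {f : ℕ → ℕ → ℕ} (hf : IsArcColouring n 0 g f)
    (hg : ∀ u < n, ∀ v < n, g u v = g v u) : StrongTriangles n g := by
  intro u hu v hv w hw huw hvw huv
  have hwv : 1 ≤ g w v := by rwa [hg w hw v hv]
  have hvu : 1 ≤ g v u := by rw [hg v hv u hu, huv]
  have hwu : 1 ≤ g w u := by rwa [hg w hw u hu]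
  have h1 := (hf.differ u hu w hw v hv huw hwv).2 (Or.inl rfl)
  have h2 := (hf.differ w hw v hv u hu hwv hvu).2 (Or.inl rfl)
  have h3 := (hf.differ v hv u hu w hw hvu huw).2 (Or.inl rfl)
  have r1 := hf.range u hu w hw huw
  have r2 := hf.range w hw v hv hwv
  have r3 := hf.range v hv u hu hvu
  omega

/-- The maximum weight of a strong clique in a graph without diamonds in which every triangle is
strong. -/
def solvePairs : Cmd :=
  .wset 1 0 0 ;; each 10 (raise (.get 0 (reg 10))) ;;
  each 10 (each 11 (when (ieq (get 4 (entry (reg 10) (reg 11))) 2)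
    (.wset 2 0 (.get 0 (reg 10) + .get 0 (reg 11)) ;;
      addWeights 12 (conj (ile 1 (get 4 (entry (reg 10) (reg 12))))
        (ile 1 (get 4 (entry (reg 11) (reg 12))))) ;;
      raise (.reg 2))))

/-- A strong edge together with all common neighbours is a clique because there are no diamonds, and
every pair in it lies in a triangle or is the edge itself, so it is strong. A strong clique with at
least two vertices is contained in such a set for any of its edges; as weights are nonnegative, only
these sets, single vertices and the empty set matter. -/
theorem solvePairs_spec [IsOrderedAddMonoid K] (hg : ∀ u < n, ∀ v < n, g u v = g v u)
    (hloop : ∀ u < n, g u u = 0) (hle : ∀ u < n, ∀ v < n, g u v ≤ 2) (hT : StrongTriangles n g)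
    (hD : DiamondFree n g) (hw : ∀ u < n, 0 ≤ s.wt 0 u) (h : HoldsGraph n g s) {g' : ℕ → ℕ → ℕ}
    (hg' : ∀ u < n, ∀ v < n, u ≠ v → (g' u v = 0 ↔ g u v = 2)) :
    IsMaxStableWeight n g' (fun u => s.wt 0 u) ((solvePairs.run n s).wt 1 0) := by
  classical
  set s1 : Store K := s.setWt 1 0 0 with hs1
  set c1 : Cmd := raise (.get 0 (reg 10)) with hc1
  set c2 : Cmd := when (ieq (get 4 (entry (reg 10) (reg 11))) 2)
    (.wset 2 0 (.get 0 (reg 10) + .get 0 (reg 11)) ;;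
      addWeights 12 (conj (ile 1 (get 4 (entry (reg 10) (reg 12))))
        (ile 1 (get 4 (entry (reg 11) (reg 12))))) ;;
      raise (.reg 2)) with hc2
  set N : ℕ → ℕ → Finset ℕ := fun u v => (Finset.range n).filter fun x => 1 ≤ g u x ∧ 1 ≤ g v x
    with hN
  have k1 := run_each_isGreatest (n := n) (s := s1) (x := 10) (p := c1)
    (fun u => {s.wt 0 u}) (by
      intro k s' hk hx hi hw'
      have := raise_spec (n := n) (s := s') (.get 0 (reg 10))
      have e0 : s'.wt 0 k = s.wt 0 k := by rw [hw' 0 (by decide)]; simp [hs1]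
      simpa [hx, e0] using this)
  set s2 := Cmd.run n (each 10 c1) s1 with hs2
  have k2 := run_each_isGreatest (n := n) (s := s2) (x := 10) (p := each 11 c2)
    (fun u => {y | ∃ v < n, y ∈ {z | g u v = 2 ∧ z = s.wt 0 u + s.wt 0 v +
      ∑ x ∈ N u v, s.wt 0 x}}) (by
      intro u s' hu hx hi hw'
      refine run_each_isGreatest (n := n) (s := s') (x := 11) (p := c2) _ ?_
      intro v s3 hv hy hi' hw''
      have e10 : s3.int 10 0 = u := by rw [hi' 10 (by decide), hx]
      have e0 : ∀ i, s3.wt 0 i = s.wt 0 i := fun i => by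
        rw [hw'' 0 (by decide), hw' 0 (by decide), hs2, wt_run_of_notMem _ _ _ _ (by decide)]
        simp [hs1]
      have h3 : HoldsGraph n g s3 := h.congr
        (fun i => by
          rw [hi' 0 (by decide), hi 0 (by decide), hs2, int_run_of_notMem _ _ _ _ (by decide)]; rfl)
        (fun i => by
          rw [hi' 4 (by decide), hi 4 (by decide), hs2, int_run_of_notMem _ _ _ _ (by decide)]; rfl)
      clear hi hi' hw' hw''
      have huv := h3.graph u hu v hv
      rw [hc2, run_ite]
      split_ifs with h4 <;> simp only [holds_ieq, eval_get, eval_add, eval_mul, eval_ofNat,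
        h3.size, e10, hy, huv] at h4
      · rw [run_seq, run_seq]
        set s4 := Cmd.run n (.wset 2 0 (.get 0 (reg 10) + .get 0 (reg 11))) s3 with hs4
        have k3 := addWeights_spec (n := n) (s := s4) (x := 12)
          (b := conj (ile 1 (get 4 (entry (reg 10) (reg 12))))
            (ile 1 (get 4 (entry (reg 11) (reg 12))))) (C := fun x => 1 ≤ g u x ∧ 1 ≤ g v x) (by
            intro s5 k hk hz hi _
            have f0 : s5.int 0 0 = n := by rw [hi 0 (by decide)]; exact h3.size
            have f10 : s5.int 10 0 = u := by rw [hi 10 (by decide)]; exact e10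
            have f11 : s5.int 11 0 = v := by rw [hi 11 (by decide)]; exact hy
            have f1 : s5.int 4 (u * n + k) = g u k := by
              rw [hi 4 (by decide)]; exact h3.graph u hu k hk
            have f2 : s5.int 4 (v * n + k) = g v k := by
              rw [hi 4 (by decide)]; exact h3.graph v hv k hk
            clear hi
            simp [f0, f10, f11, hz, f1, f2])
        set s5 := Cmd.run n (addWeights 12 (conj (ile 1 (get 4 (entry (reg 10) (reg 12))))
            (ile 1 (get 4 (entry (reg 11) (reg 12)))))) s4 with hs5
        have f1 : s5.wt 1 0 = s3.wt 1 0 := by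
          rw [hs5, wt_run_of_notMem _ _ _ _ (by decide)]
          simp [hs4]
        have := raise_spec (n := n) (s := s5) (.reg 2)
        have f2 : (WExp.reg 2).eval s5 = s.wt 0 u + s.wt 0 v + ∑ x ∈ N u v, s.wt 0 x := by
          have e4 : ∀ i, s4.wt 0 i = s.wt 0 i := fun i => by simp [hs4, e0]
          simp only [WExp.eval_get, eval_ofNat]
          rw [k3]
          simp only [e4, hN]
          simp [hs4, e10, hy, e0]
        rw [f1, f2] at this
        simpa [h4] using this
      · simp [h4, IsGreatest, upperBounds])
  have hrun : solvePairs.run n s = Cmd.run n (each 10 (each 11 c2)) s2 := rfl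
  rw [← hrun] at k2
  have e1 : s1.wt 1 0 = 0 := by simp [hs1]
  rw [e1] at k1
  refine IsGreatest.of_dominated (isGreatest_insert_union k1 k2) ?_ ?_
  · rintro _ (rfl | ⟨u, hu, rfl⟩ | ⟨u, hu, v, hv, huv, rfl⟩)
    · exact ⟨∅, by simp, by simp, by simp⟩
    · refine ⟨{u}, by simpa using hu, ?_, by simp⟩
      intro a ha b hb hab
      rw [Finset.mem_singleton] at ha hb
      exact absurd (ha.trans hb.symm) hab
    · have hne : u ≠ v := by
        rintro rfl
        rw [hloop u hu] at huv
        omega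
      have hNm : ∀ x, x ∈ N u v ↔ x < n ∧ 1 ≤ g u x ∧ 1 ≤ g v x := by simp [hN]
      have huN : u ∉ N u v := fun h1 => by
        have := ((hNm u).1 h1).2.1
        rw [hloop u hu] at this
        omega
      have hvN : v ∉ N u v := fun h1 => by
        have := ((hNm v).1 h1).2.2
        rw [hloop v hv] at this
        omega
      have hsub : ∀ a ∈ insert u (insert v (N u v)), a < n := by
        intro a ha
        rcases Finset.mem_insert.1 ha with rfl | ha
        · exact hu
        rcases Finset.mem_insert.1 ha with rfl | ha
        · exact hv
        · exact ((hNm a).1 ha).1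
      refine ⟨insert u (insert v (N u v)), fun a ha => Finset.mem_range.2 (hsub a ha), ?_, ?_⟩
      · have key : ∀ a < n, ∀ b < n, ∀ c < n, 1 ≤ g a b → 1 ≤ g a c → 1 ≤ g b c → g a b = 2 := by
          intro a ha b hb c hc h1 h2 h3
          have := hT a ha b hb c hc h2 h3
          have := hle a ha b hb
          omega
        have hgu : ∀ x ∈ N u v, g u x = 2 ∧ g v x = 2 := by
          intro x hx
          obtain ⟨h1, h2, h3⟩ := (hNm x).1 hx
          have h4 : 1 ≤ g x v := by rwa [hg x h1 v hv]
          have h5 : 1 ≤ g x u := by rwa [hg x h1 u hu]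
          have h6 : 1 ≤ g v u := by rw [hg v hv u hu]; omega
          exact ⟨key u hu x h1 v hv h2 (by omega) h4, key v hv x h1 u hu h3 h6 h5⟩
        have hN2 : ∀ x ∈ N u v, ∀ y ∈ N u v, x ≠ y → g x y = 2 := by
          intro x hx y hy hxy
          obtain ⟨h1, h2, h3⟩ := (hNm x).1 hx
          obtain ⟨h4, h5, h6⟩ := (hNm y).1 hy
          have h7 : 1 ≤ g x u := by rwa [hg x h1 u hu]
          have h8 : 1 ≤ g x v := by rwa [hg x h1 v hv]
          have h9 : 1 ≤ g y u := by rwa [hg y h4 u hu]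
          exact key x h1 y h4 u hu (hD u hu v hv x h1 y h4 (by omega) h7 h8 h5 h6 hxy) h7 h9
        intro a ha b hb hab
        rw [hg' a (hsub a ha) b (hsub b hb) hab]
        rcases Finset.mem_insert.1 ha with rfl | ha' <;> rcases Finset.mem_insert.1 hb with rfl | hb'
        · exact absurd rfl hab
        · rcases Finset.mem_insert.1 hb' with rfl | hb'
          · exact huv
          · exact (hgu b hb').1
        · rw [hg _ (hsub _ ha) _ hu]
          rcases Finset.mem_insert.1 ha' with rfl | ha'
          · exact huv
          · exact (hgu a ha').1
        · rcases Finset.mem_insert.1 ha' with rfl | ha' <;>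
            rcases Finset.mem_insert.1 hb' with rfl | hb'
          · exact absurd rfl hab
          · exact (hgu b hb').2
          · rw [hg _ (hsub _ ha) _ hv]
            exact (hgu a ha').2
          · exact hN2 a ha' b hb' hab
      · rw [Finset.sum_insert (by simp [hne, huN]), Finset.sum_insert hvN, add_assoc]
  · rintro _ ⟨S, hS, hst, rfl⟩
    have hlt : ∀ v ∈ S, v < n := fun v hv => Finset.mem_range.1 (hS hv)
    by_cases h0 : S = ∅
    · exact ⟨0, Or.inl rfl, by simp [h0]⟩
    obtain ⟨u, hu⟩ := Finset.nonempty_iff_ne_empty.2 h0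
    by_cases h1 : S = {u}
    · exact ⟨s.wt 0 u, Or.inr (Or.inl ⟨u, hlt u hu, rfl⟩), by simp [h1]⟩
    obtain ⟨v, hv, hvu⟩ : ∃ v ∈ S, v ≠ u := by
      by_contra h2
      push Not at h2
      exact h1 (Finset.eq_singleton_iff_unique_mem.2 ⟨hu, h2⟩)
    have hS2 : ∀ a ∈ S, ∀ b ∈ S, a ≠ b → g a b = 2 := fun a ha b hb hab =>
      (hg' a (hlt a ha) b (hlt b hb) hab).1 (hst a ha b hb hab)
    refine ⟨_, Or.inr (Or.inr ⟨u, hlt u hu, v, hlt v hv, hS2 u hu v hv hvu.symm, rfl⟩), ?_⟩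
    have hvS : v ∈ S.erase u := Finset.mem_erase.2 ⟨hvu, hv⟩
    rw [← Finset.add_sum_erase S _ hu, ← Finset.add_sum_erase (S.erase u) _ hvS, ← add_assoc]
    refine add_le_add_right (Finset.sum_le_sum_of_subset_of_nonneg ?_ ?_) _
    · intro x hx
      rw [Finset.mem_erase, Finset.mem_erase] at hx
      obtain ⟨hxv, hxu, hxS⟩ := hx
      refine Finset.mem_filter.2 ⟨hS hxS, ?_, ?_⟩
      · rw [hS2 u hu x hxS hxu.symm]; omega
      · rw [hS2 v hv x hxS hxv.symm]; omega
    · intro x hx _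
      exact hw x (Finset.mem_range.1 (Finset.mem_filter.1 hx).1)

end RAM

namespace RAM

open Cmd IExp Test

variable {K : Type*} [AddCommGroup K] [LinearOrder K] {n : ℕ} {g : ℕ → ℕ → ℕ} {s : Store K}

/-! ### Doubled trigraphs

The two parts are given by a predicate `X`: the second part consists of the vertices that do not
satisfy it. -/

section Mate

variable {X : ℕ → Prop} {u v w : ℕ}

/-- `u` and `v` are distinct, and they are adjacent vertices of the first part or antiadjacent
vertices of the second part. -/
def Mate (g : ℕ → ℕ → ℕ) (X : ℕ → Prop) (u v : ℕ) : Prop :=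
  u ≠ v ∧ ((X u ∧ X v ∧ 1 ≤ g u v) ∨ (¬ X u ∧ ¬ X v ∧ g u v ≤ 1))

/-- The two parts are a good partition. -/
structure GoodSide (n : ℕ) (g : ℕ → ℕ → ℕ) (X : ℕ → Prop) : Prop where
  mate_unique : ∀ u < n, ∀ v < n, ∀ w < n, Mate g X u v → Mate g X u w → v = w
  no_semi : ∀ u < n, ∀ v < n, X u → ¬ X v → g u v ≠ 1
  differ : ∀ u < n, ∀ v < n, ∀ y < n, Mate g X u v → (X u ↔ ¬ X y) → g u y ≠ g v y

theorem Mate.congr {Y : ℕ → Prop} (hu : X u ↔ Y u) (hv : X v ↔ Y v) :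
    Mate g X u v ↔ Mate g Y u v := by
  simp only [Mate, hu, hv]

theorem GoodSide.congr {Y : ℕ → Prop} (h : ∀ u < n, (X u ↔ Y u)) :
    GoodSide n g X ↔ GoodSide n g Y := by
  have key : ∀ {X Y : ℕ → Prop}, (∀ u < n, (X u ↔ Y u)) → GoodSide n g X → GoodSide n g Y := by
    intro X Y h H
    refine ⟨fun u hu v hv w hw h1 h2 => ?_, fun u hu v hv h1 h2 => ?_,
      fun u hu v hv y hy h1 h2 => ?_⟩
    · exact H.mate_unique u hu v hv w hw ((Mate.congr (h u hu) (h v hv)).2 h1)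
        ((Mate.congr (h u hu) (h w hw)).2 h2)
    · exact H.no_semi u hu v hv ((h u hu).2 h1) (mt (h v hv).1 h2)
    · exact H.differ u hu v hv y hy ((Mate.congr (h u hu) (h v hv)).2 h1)
        (by rw [h u hu, h y hy]; exact h2)
  exact ⟨key h, key fun u hu => (h u hu).symm⟩

/-- `mt` lists the mates of the vertices for which `mf` is not `0`; the others have none. -/
structure HoldsMates (n : ℕ) (g : ℕ → ℕ → ℕ) (X : ℕ → Prop) (mf mt : ℕ → ℕ) : Prop where
  none : ∀ u < n, mf u = 0 → ∀ v < n, ¬ Mate g X u v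
  some : ∀ u < n, mf u ≠ 0 → mt u < n ∧ Mate g X u (mt u)

end Mate

/-- The vertices in registers `10` and `11` are mates. -/
def mateTest : Test :=
  conj (neg (ieq (reg 10) (reg 11))) (disj
    (conj (ieq (get 40 (reg 10)) 0) (conj (ieq (get 40 (reg 11)) 0)
      (ile 1 (get 4 (entry (reg 10) (reg 11))))))
    (conj (neg (ieq (get 40 (reg 10)) 0)) (conj (neg (ieq (get 40 (reg 11)) 0))
      (ile (get 4 (entry (reg 10) (reg 11))) 1))))

/-- Find the mates. A second mate raises the flag in register `8`. -/
def computeMates : Cmd :=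
  each 10 (iset 41 (reg 10) 0 ;; each 11 (when mateTest
    (when (ile 1 (get 41 (reg 10))) (rset 8 1) ;; iset 41 (reg 10) 1 ;;
      iset 42 (reg 10) (reg 11))))

/-- Check the pairs between the two parts. -/
def checkAcross : Cmd :=
  each 10 (each 11 (
    when (conj (ieq (get 40 (reg 10)) 0) (conj (neg (ieq (get 40 (reg 11)) 0))
      (ieq (get 4 (entry (reg 10) (reg 11))) 1))) (rset 8 1) ;;
    when (conj (ile 1 (get 41 (reg 10)))
      (conj (disj (conj (ieq (get 40 (reg 10)) 0) (neg (ieq (get 40 (reg 11)) 0)))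
        (conj (neg (ieq (get 40 (reg 10)) 0)) (ieq (get 40 (reg 11)) 0)))
      (ieq (get 4 (entry (reg 10) (reg 11))) (get 4 (entry (get 42 (reg 10)) (reg 11))))))
      (rset 8 1)))

/-- Decide whether array `40` describes a good partition. -/
def checkSide : Cmd := rset 8 0 ;; computeMates ;; checkAcross

/-- The flag records the failure of uniqueness. The stored mate is a genuine one even if there are
several, which is all that `HoldsMates` demands. -/
theorem computeMates_spec (h : HoldsGraph n g s) {X : ℕ → Prop}
    (hX : ∀ u < n, (X u ↔ s.int 40 u = 0)) (s' : Store K) (hs' : s' = computeMates.run n s) :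
    (s'.int 8 0 = 0 ↔ s.int 8 0 = 0 ∧
      ∀ u < n, ∀ v < n, ∀ w < n, Mate g X u v → Mate g X u w → v = w) ∧
    HoldsMates n g X (s'.int 41) (s'.int 42) := by
  set c : Cmd := when mateTest (when (ile 1 (get 41 (reg 10))) (rset 8 1) ;;
    iset 41 (reg 10) 1 ;; iset 42 (reg 10) (reg 11)) with hc
  have key := run_each_invariant (n := n) (s := s) (x := 10)
    (p := iset 41 (reg 10) 0 ;; each 11 c)
    (fun k s' => (s'.int 8 0 = 0 ↔ s.int 8 0 = 0 ∧
      ∀ u < k, ∀ v < n, ∀ w < n, Mate g X u v → Mate g X u w → v = w) ∧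
      ∀ u < k, (s'.int 41 u = 0 → ∀ v < n, ¬ Mate g X u v) ∧
        (s'.int 41 u ≠ 0 → s'.int 42 u < n ∧ Mate g X u (s'.int 42 u))) (by simp) (by simp) ?_
  · rw [show s' = Cmd.run n (each 10 (iset 41 (reg 10) 0 ;; each 11 c)) s from hs']
    exact ⟨key.1, fun u hu => (key.2 u hu).1, fun u hu => (key.2 u hu).2⟩
  intro u s1 hu hx hi hw ⟨h1, h2⟩
  set s2 := Cmd.run n (iset 41 (reg 10) 0) s1 with hs2
  have hkey := run_each_invariant (n := n) (s := s2) (x := 11) (p := c)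
    (fun j s' => (s'.int 8 0 = 0 ↔ s1.int 8 0 = 0 ∧
      ∀ v < j, ∀ w < j, Mate g X u v → Mate g X u w → v = w) ∧
      (s'.int 41 u = 0 → ∀ v < j, ¬ Mate g X u v) ∧
      (s'.int 41 u ≠ 0 → s'.int 42 u < j ∧ Mate g X u (s'.int 42 u)) ∧
      ∀ a, a ≠ u → s'.int 41 a = s1.int 41 a ∧ s'.int 42 a = s1.int 42 a) ?_ ?_ ?_
  · rw [run_seq, ← hs2]
    obtain ⟨h3, h4, h5, h6⟩ := hkey
    rw [h3, h1]
    refine ⟨?_, fun a ha => ?_⟩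
    · rw [and_assoc]
      refine and_congr_right fun _ => ⟨fun h7 a ha => ?_, fun h7 => ⟨fun a ha => h7 a (by omega),
        h7 u (by omega)⟩⟩
      rcases Nat.lt_succ_iff_lt_or_eq.1 ha with h8 | rfl
      · exact h7.1 a h8
      · exact h7.2
    · rcases Nat.lt_succ_iff_lt_or_eq.1 ha with h8 | rfl
      · have h9 := h6 a (by omega)
        rw [h9.1, h9.2]
        exact h2 a h8
      · exact ⟨h4, h5⟩
  · simp
  · refine ⟨by simp [hs2], by simp, by simp [hs2, hx], fun a ha => ?_⟩
    simp [hs2, hx, ha]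
  intro j s3 hj hy hi' hw' ⟨h3, h4, h5, h6⟩
  have f : ∀ a, a ∉ [10, 11, 41, 42, 8] → ∀ i, s3.int a i = s.int a i := by
    intro a ha i
    simp only [List.mem_cons, not_or] at ha
    rw [hi' a (by simp [hc, imods, ha]), ← hi a (by simp [hc, imods, ha])]
    simp [hs2, ha]
  have hG : HoldsGraph n g s3 := h.congr (f 0 (by decide)) (f 4 (by decide))
  have e10 : s3.int 10 0 = u := by
    rw [hi' 10 (by decide)]
    simp [hs2, hx]
  have e40 := f 40 (by decide)
  have huj := hG.graph u hu j hj
  clear hi hi' f hw hw'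
  have hholds : mateTest.Holds s3 ↔ Mate g X u j := by
    simp only [mateTest, holds_conj, holds_neg, holds_disj, holds_ieq, holds_ile, eval_get,
      eval_add, eval_mul, eval_ofNat, hG.size, e10, hy, e40, huj, Mate, hX u hu, hX j hj]
  have hlt : ∀ v, v < j + 1 ↔ v < j ∨ v = j := fun v => Nat.lt_succ_iff_lt_or_eq
  rw [hc, run_ite]
  by_cases h7 : Mate g X u j
  · rw [if_pos (by rwa [hholds]), run_seq, run_seq, run_ite]
    have h8 : (ile 1 (get 41 (reg 10))).Holds s3 ↔ ∃ v < j, Mate g X u v := by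
      simp only [holds_ile, eval_get, eval_ofNat, e10]
      constructor
      · intro h9
        exact ⟨_, h5 (by omega)⟩
      · rintro ⟨v, hv, h9⟩
        by_contra h10
        exact h4 (by omega) v hv h9
    refine ⟨?_, ?_, ?_, ?_⟩
    · by_cases h9 : ∃ v < j, Mate g X u v
      · rw [if_pos (by rwa [h8])]
        obtain ⟨v, hv, h10⟩ := h9
        have : ¬ ∀ v < j + 1, ∀ w < j + 1, Mate g X u v → Mate g X u w → v = w := fun h11 =>
          absurd (h11 v (by omega) j (by omega) h10 h7) (by omega)
        exact iff_of_false (by simp) fun h12 => this h12.2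
      · rw [if_neg (by rwa [h8])]
        simp only [run_skip, run_iset, Store.int_setInt]
        simp only [show ¬ (8 = 42) by decide, show ¬ (8 = 41) by decide, false_and, if_false]
        rw [h3]
        refine and_congr_right fun _ => ⟨fun _ v hv w hw h10 h11 => ?_,
          fun h10 v hv w hw => h10 v (by omega) w (by omega)⟩
        rcases (hlt v).1 hv with h12 | rfl
        · exact absurd ⟨v, h12, h10⟩ h9
        rcases (hlt w).1 hw with h12 | rfl
        · exact absurd ⟨w, h12, h11⟩ h9
        · rfl
    · split_ifs <;> simp [e10]
    · split_ifs <;> simp [e10, hy, h7]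
    · intro a ha
      split_ifs <;> simp [e10, ha, h6 a ha]
  · rw [if_neg (by rwa [hholds]), run_skip]
    refine ⟨?_, ?_, ?_, h6⟩
    · rw [h3]
      refine and_congr_right fun _ => ⟨fun h8 v hv w hw h10 h11 => ?_,
          fun h10 v hv w hw => h10 v (by omega) w (by omega)⟩
      rcases (hlt v).1 hv with h12 | rfl
      · rcases (hlt w).1 hw with h13 | rfl
        · exact h8 v h12 w h13 h10 h11
        · exact absurd h11 h7
      · exact absurd h10 h7
    · intro h8 v hv
      rcases (hlt v).1 hv with h12 | rfl
      · exact h4 h8 v h12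
      · exact h7
    · intro h8
      exact ⟨(h5 h8).1.trans (Nat.lt_succ_self j), (h5 h8).2⟩

/-- Only the stored mate of each vertex is compared, so the check takes quadratic time; together
with uniqueness of mates it covers all mates. -/
theorem checkAcross_spec (h : HoldsGraph n g s) {X : ℕ → Prop}
    (hX : ∀ u < n, (X u ↔ s.int 40 u = 0)) (hM : HoldsMates n g X (s.int 41) (s.int 42)) :
    (checkAcross.run n s).int 8 0 = 0 ↔ s.int 8 0 = 0 ∧ ∀ u < n, ∀ y < n,
      ¬ (X u ∧ ¬ X y ∧ g u y = 1) ∧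
      ¬ (s.int 41 u ≠ 0 ∧ (X u ↔ ¬ X y) ∧ g u y = g (s.int 42 u) y) := by
  refine run_each_flag (by decide) _ fun u s1 hu hx1 hi1 hw1 => ?_
  refine run_each_flag (by decide) _ fun y s2 hy hx2 hi2 hw2 => ?_
  have f : ∀ a, a ∉ [10, 11, 8] → ∀ i, s2.int a i = s.int a i := by
    intro a ha i
    simp only [List.mem_cons, not_or] at ha
    rw [hi2 a (by simp [imods, ha]), hi1 a (by simp [imods, ha])]
  have hG : HoldsGraph n g s2 := h.congr (f 0 (by decide)) (f 4 (by decide))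
  have e10 : s2.int 10 0 = u := by rw [hi2 10 (by decide), hx1]
  have e40 := f 40 (by decide)
  have e41 := f 41 (by decide)
  have e42 := f 42 (by decide)
  have huy := hG.graph u hu y hy
  have hsome := hM.some u hu
  clear hi1 hi2 f hw1 hw2
  rw [run_seq]
  have key : ∀ s3 : Store K, (∀ a, a ≠ 8 → ∀ i, s3.int a i = s2.int a i) →
      ((Cmd.run n (when (conj (ile 1 (get 41 (reg 10)))
      (conj (disj (conj (ieq (get 40 (reg 10)) 0) (neg (ieq (get 40 (reg 11)) 0)))
        (conj (neg (ieq (get 40 (reg 10)) 0)) (ieq (get 40 (reg 11)) 0)))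
      (ieq (get 4 (entry (reg 10) (reg 11))) (get 4 (entry (get 42 (reg 10)) (reg 11))))))
      (rset 8 1)) s3).int 8 0 = 0 ↔ s3.int 8 0 = 0 ∧
        ¬ (s.int 41 u ≠ 0 ∧ (X u ↔ ¬ X y) ∧ g u y = g (s.int 42 u) y)) := by
    intro s3 f3
    have f0 := f3 0 (by decide)
    have f4 := f3 4 (by decide)
    have f10 := f3 10 (by decide)
    have f11 := f3 11 (by decide)
    have f40 := f3 40 (by decide)
    have f41 := f3 41 (by decide)
    have f42 := f3 42 (by decide)
    clear f3
    have hholds : Test.Holds s3 (conj (ile 1 (get 41 (reg 10)))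
      (conj (disj (conj (ieq (get 40 (reg 10)) 0) (neg (ieq (get 40 (reg 11)) 0)))
        (conj (neg (ieq (get 40 (reg 10)) 0)) (ieq (get 40 (reg 11)) 0)))
      (ieq (get 4 (entry (reg 10) (reg 11))) (get 4 (entry (get 42 (reg 10)) (reg 11)))))) ↔
        (s.int 41 u ≠ 0 ∧ (X u ↔ ¬ X y) ∧ g u y = g (s.int 42 u) y) := by
      simp only [holds_conj, holds_neg, holds_disj, holds_ieq, holds_ile, eval_get,
        eval_add, eval_mul, eval_ofNat, f0, f4, f10, f11, f40, f41, f42, hG.size, e10, hx2, e40,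
        e41, e42, huy, hX u hu, hX y hy, Nat.one_le_iff_ne_zero]
      refine and_congr_right fun h1 => ?_
      rw [hG.graph _ (hsome h1).1 y hy]
      tauto
    rw [run_ite]
    by_cases h1 : s.int 41 u ≠ 0 ∧ (X u ↔ ¬ X y) ∧ g u y = g (s.int 42 u) y
    · rw [if_pos (by rwa [hholds])]
      simp [h1]
    · rw [if_neg (by rwa [hholds]), run_skip]
      exact ⟨fun h2 => ⟨h2, h1⟩, fun h2 => h2.1⟩
  have hholds : Test.Holds s2 (conj (ieq (get 40 (reg 10)) 0) (conj (neg (ieq (get 40 (reg 11)) 0))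
      (ieq (get 4 (entry (reg 10) (reg 11))) 1))) ↔ X u ∧ ¬ X y ∧ g u y = 1 := by
    simp only [holds_conj, holds_neg, holds_ieq, eval_get, eval_add, eval_mul, eval_ofNat, hG.size,
      e10, hx2, e40, huy, hX u hu, hX y hy]
  rw [key _ fun a ha i => int_run_of_notMem _ _ _ _ (by simp [imods, ha]) _, run_ite,
    ← and_assoc (a := s2.int 8 0 = 0)]
  refine and_congr_left fun _ => ?_
  by_cases h1 : X u ∧ ¬ X y ∧ g u y = 1
  · rw [if_pos (by rwa [hholds])]
    simp [h1]
  · rw [if_neg (by rwa [hholds]), run_skip]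
    exact ⟨fun h2 => ⟨h2, h1⟩, fun h2 => h2.1⟩

theorem checkSide_spec (h : HoldsGraph n g s) {X : ℕ → Prop}
    (hX : ∀ u < n, (X u ↔ s.int 40 u = 0)) (s' : Store K) (hs' : s' = checkSide.run n s) :
    (s'.int 8 0 = 0 ↔ GoodSide n g X) ∧ HoldsMates n g X (s'.int 41) (s'.int 42) := by
  set s1 := Cmd.run n (rset 8 0) s with hs1
  have f1 : ∀ a, a ≠ 8 → ∀ i, s1.int a i = s.int a i := fun a ha i => by simp [hs1, ha]
  have h1 : HoldsGraph n g s1 := h.congr (f1 0 (by decide)) (f1 4 (by decide))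
  obtain ⟨h2, h3⟩ := computeMates_spec h1 (X := X) (fun u hu => by
    rw [hX u hu, f1 40 (by decide)]) _ rfl
  set s2 := Cmd.run n computeMates s1 with hs2
  have h4 : HoldsGraph n g s2 := h1.congr (int_run_of_notMem _ _ _ _ (by decide))
    (int_run_of_notMem _ _ _ _ (by decide))
  have h5 := checkAcross_spec h4 (X := X) (fun u hu => by
    rw [hX u hu, hs2, int_run_of_notMem _ _ _ _ (by decide), f1 40 (by decide)]) h3
  have hrun : s' = Cmd.run n checkAcross s2 := by rw [hs']; rfl
  have e41 : s'.int 41 = s2.int 41 := by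
    rw [hrun]; exact funext (int_run_of_notMem _ _ _ _ (by decide))
  have e42 : s'.int 42 = s2.int 42 := by
    rw [hrun]; exact funext (int_run_of_notMem _ _ _ _ (by decide))
  rw [e41, e42]
  refine ⟨?_, h3⟩
  rw [hrun, h5, h2]
  have e8 : s1.int 8 0 = 0 := by simp [hs1]
  constructor
  · rintro ⟨⟨-, h6⟩, h7⟩
    refine ⟨h6, fun u hu v hv h8 h9 h10 => (h7 u hu v hv).1 ⟨h8, h9, h10⟩,
      fun u hu v hv y hy h8 h9 h10 => ?_⟩
    -- Uniqueness identifies the given mate with the stored one, for which the pairs across were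
    -- checked.
    by_cases h11 : s2.int 41 u = 0
    · exact h3.none u hu h11 v hv h8
    · have h12 := h3.some u hu h11
      have h13 := h6 u hu v hv _ h12.1 h8 h12.2
      exact (h7 u hu y hy).2 ⟨h11, h9, by rw [← h13, h10]⟩
  · intro H
    refine ⟨⟨e8, H.mate_unique⟩, fun u hu y hy => ⟨fun h6 => H.no_semi u hu y hy h6.1 h6.2.1
      h6.2.2, fun h6 => ?_⟩⟩
    have h12 := h3.some u hu h6.1
    exact H.differ u hu _ h12.1 y hy h12.2 h6.2.1 h6.2.2

end RAM

namespace RAM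

open Cmd IExp Test

variable {K : Type*} [AddCommGroup K] [LinearOrder K] {n : ℕ} {g : ℕ → ℕ → ℕ} {s : Store K}

/-! ### The search for a good partition -/

/-- The candidate with the edge `ab` in the first part. -/
def EdgeSide (g : ℕ → ℕ → ℕ) (a b v : ℕ) : Prop := v = a ∨ v = b ∨ (g v a = 0 ∧ g v b = 0)

/-- The complement of the candidate with the antiedge `ab` in the second part. -/
def AntiedgeSide (g : ℕ → ℕ → ℕ) (a b v : ℕ) : Prop := v = a ∨ v = b ∨ (g v a = 2 ∧ g v b = 2)

/-- The number of neighbours. -/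
def degree (n : ℕ) (g : ℕ → ℕ → ℕ) (v : ℕ) : ℕ := ((Finset.range n).filter fun u => 1 ≤ g v u).card

/-- Set the entries of array `40` to `e` for the vertices that pass the test `b`, and to `f` for the
others. -/
def setSide (b : Test) (e f : IExp) : Cmd :=
  each 10 (.ite b (iset 40 (reg 10) e) (iset 40 (reg 10) f))

/-- The candidates for the first part. -/
def edgeSide : Cmd :=
  setSide (disj (ieq (reg 10) (reg 43)) (disj (ieq (reg 10) (reg 44))
    (conj (ieq (get 4 (entry (reg 10) (reg 43))) 0) (ieq (get 4 (entry (reg 10) (reg 44))) 0)))) 0 1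

/-- The candidates for the second part. -/
def antiedgeSide : Cmd :=
  setSide (disj (ieq (reg 10) (reg 43)) (disj (ieq (reg 10) (reg 44))
    (conj (ieq (get 4 (entry (reg 10) (reg 43))) 2) (ieq (get 4 (entry (reg 10) (reg 44))) 2)))) 1 0

/-- The candidates in the case that one part is stable and the other is a clique. -/
def degreeSide : Cmd := setSide (ile (reg 43) (get 45 (reg 10))) 1 0

/-- Compute the degrees. -/
def computeDegrees : Cmd :=
  each 10 (iset 45 (reg 10) 0 ;;
    each 11 (when (ile 1 (get 4 (entry (reg 10) (reg 11)))) (incr 45 (reg 10))))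

/-- Check the candidate that `c` computes, unless a good partition has been found. -/
def trySide (c : Cmd) : Cmd :=
  when (ieq (reg 46) 0) (c ;; checkSide ;; when (ieq (reg 8) 0) (rset 46 1))

/-- Search for a good partition. -/
def findSide : Cmd :=
  computeDegrees ;; rset 46 0 ;;
  each 43 (each 44 (trySide edgeSide ;; trySide antiedgeSide ;; trySide degreeSide))

/-- The memory holds a good partition and the mates. -/
structure HoldsSide (n : ℕ) (g : ℕ → ℕ → ℕ) (s : Store K) : Prop where
  good : GoodSide n g fun u => s.int 40 u = 0
  mates : HoldsMates n g (fun u => s.int 40 u = 0) (s.int 41) (s.int 42)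

theorem setSide_spec {b : Test} {e f : IExp} {C : ℕ → Prop} {x y : ℕ}
    (he : ∀ s' : Store K, e.eval s' = x) (hf : ∀ s' : Store K, f.eval s' = y)
    (hb : ∀ s' : Store K, ∀ k < n, s'.int 10 0 = k →
      (∀ a, a ∉ [10, 40] → ∀ i, s'.int a i = s.int a i) → (b.Holds s' ↔ C k)) :
    ∀ u < n, (C u → ((setSide b e f).run n s).int 40 u = x) ∧
      (¬ C u → ((setSide b e f).run n s).int 40 u = y) := by
  refine run_each_invariant (s := s) (x := 10)
    (p := .ite b (iset 40 (reg 10) e) (iset 40 (reg 10) f))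
    (fun k s' => ∀ u < k, (C u → s'.int 40 u = x) ∧ (¬ C u → s'.int 40 u = y)) (by simp) (by simp) ?_
  intro k s' hk hx hi hw hP u hu
  have h1 := hb s' k hk hx (fun a ha i => hi a (by
    simp only [List.mem_cons, not_or] at ha
    simp [imods, ha]) i)
  rw [run_ite]
  by_cases huk : u = k
  · subst huk
    split_ifs with h2
    · simp [hx, h1.1 h2, he]
    · simp [hx, mt h1.2 h2, hf]
  · have := hP u (by omega)
    split_ifs <;> simpa [hx, huk] using this

theorem computeDegrees_spec (h : HoldsGraph n g s) :
    ∀ v < n, (computeDegrees.run n s).int 45 v = degree n g v := by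
  set c : Cmd := when (ile 1 (get 4 (entry (reg 10) (reg 11)))) (incr 45 (reg 10)) with hc
  refine run_each_invariant (s := s) (x := 10) (p := iset 45 (reg 10) 0 ;; each 11 c)
    (fun k s' => ∀ v < k, s'.int 45 v = degree n g v) (by simp) (by simp) ?_
  intro v s1 hv hx hi hw hP
  have key := run_each_invariant (n := n) (s := Cmd.run n (iset 45 (reg 10) 0) s1) (x := 11)
    (p := c) (fun j s' => (∀ u, u ≠ v → s'.int 45 u = s1.int 45 u) ∧
      s'.int 45 v = ((Finset.range j).filter fun u => 1 ≤ g v u).card) (by simp) ?_ ?_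
  · intro u hu
    rcases Nat.lt_succ_iff_lt_or_eq.1 hu with h1 | rfl
    · rw [run_seq, key.1 u (by omega), hP u h1]
    · exact key.2
  · exact ⟨fun u hu => by simp [hx, hu], by simp [hx]⟩
  intro j s3 hj hy hi' hw' ⟨h1, h2⟩
  have f : ∀ a, a ∉ [10, 11, 45] → ∀ i, s3.int a i = s.int a i := by
    intro a ha i
    simp only [List.mem_cons, not_or] at ha
    rw [hi' a (by simp [hc, imods, ha]), ← hi a (by simp [hc, imods, ha])]
    simp [ha]
  have hG : HoldsGraph n g s3 := h.congr (f 0 (by decide)) (f 4 (by decide))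
  have e10 : s3.int 10 0 = v := by
    rw [hi' 10 (by decide)]
    simp [hx]
  have hvj := hG.graph v hv j hj
  clear hi hi' f hw hw'
  have hholds : Test.Holds s3 (ile 1 (get 4 (entry (reg 10) (reg 11)))) ↔ 1 ≤ g v j := by
    simp only [holds_ile, eval_get, eval_add, eval_mul, eval_ofNat, hG.size, e10, hy, hvj]
  -- The counter stays below the guard of `incr`, so no increment is lost.
  have hle : s3.int 45 v ≤ n := by
    rw [h2]
    refine (Finset.card_le_card (Finset.filter_subset _ _)).trans ?_
    rw [Finset.card_range]
    exact hj.le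
  rw [hc, run_ite, Finset.range_add_one, Finset.filter_insert]
  by_cases h3 : 1 ≤ g v j
  · rw [if_pos (by rwa [hholds]), if_pos h3, Finset.card_insert_of_notMem (by simp), run_incr,
      if_pos (by simpa [e10] using hle)]
    refine ⟨fun u hu => ?_, ?_⟩
    · simp [e10, hu, h1 u hu]
    · simp [e10, h2]
  · rw [if_neg (by rwa [hholds]), if_neg h3, run_skip]
    exact ⟨h1, h2⟩

/-- Once a good partition has been found nothing is executed any more, so the partition and its
mates survive the remaining candidates. -/
theorem trySide_spec {c : Cmd} {X : ℕ → Prop} (h : HoldsGraph n g s)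
    (hc : ∀ a ∈ [0, 4, 46], a ∉ c.imods)
    (hX : ∀ u < n, (X u ↔ (c.run n s).int 40 u = 0)) (hs : s.int 46 0 ≠ 0 → HoldsSide n g s)
    (s' : Store K) (hs' : s' = (trySide c).run n s) :
    (s'.int 46 0 ≠ 0 → HoldsSide n g s') ∧
      (s'.int 46 0 = 0 → s.int 46 0 = 0 ∧ ¬ GoodSide n g X) := by
  subst hs'
  unfold trySide
  rw [run_ite]
  by_cases h0 : s.int 46 0 = 0
  · rw [if_pos (by simpa using h0), run_seq, run_seq]
    set s1 := Cmd.run n c s with hs1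
    have h1 : HoldsGraph n g s1 := h.congr (int_run_of_notMem _ _ _ _ (hc 0 (by decide)))
      (int_run_of_notMem _ _ _ _ (hc 4 (by decide)))
    obtain ⟨h2, h3⟩ := checkSide_spec h1 (X := fun u => s1.int 40 u = 0) (fun u _ => Iff.rfl) _ rfl
    have e40 : (Cmd.run n checkSide s1).int 40 = s1.int 40 :=
      funext (int_run_of_notMem _ _ _ _ (by decide))
    have e46 : (Cmd.run n checkSide s1).int 46 0 = 0 := by
      rw [int_run_of_notMem _ _ _ _ (by decide), hs1,
        int_run_of_notMem _ _ _ _ (hc 46 (by decide)), h0]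
    set s2 := Cmd.run n checkSide s1 with hs2
    rw [run_ite]
    by_cases h4 : s2.int 8 0 = 0
    · rw [if_pos (by simpa using h4)]
      refine ⟨fun _ => ?_, fun h5 => absurd h5 (by simp)⟩
      have f : ∀ a, a ≠ 46 → (Cmd.run n (rset 46 1) s2).int a = s2.int a := by
        intro a ha
        funext i
        simp [ha]
      refine ⟨?_, ?_⟩
      · rw [f 40 (by decide), e40]
        exact h2.1 h4
      · rw [f 40 (by decide), f 41 (by decide), f 42 (by decide), e40]
        exact h3
    · rw [if_neg (by simpa using h4), run_skip]
      refine ⟨fun h5 => absurd e46 h5, fun _ => ⟨h0, fun h5 => h4 (h2.2 ?_)⟩⟩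
      exact (GoodSide.congr hX).1 h5
  · rw [if_neg (by simpa using h0), run_skip]
    exact ⟨hs, fun h1 => absurd h1 h0⟩

/-- The degree candidate with threshold `a` does not depend on `b`; it is tried again for every `b`,
which leaves the order of the running time unchanged. -/
theorem findSide_spec (h : HoldsGraph n g s) (s' : Store K) (hs' : s' = findSide.run n s) :
    (s'.int 46 0 ≠ 0 → HoldsSide n g s') ∧ (s'.int 46 0 = 0 → ∀ a < n, ∀ b < n,
      ¬ GoodSide n g (EdgeSide g a b) ∧ ¬ GoodSide n g (fun v => ¬ AntiedgeSide g a b v) ∧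
      ¬ GoodSide n g (fun v => ¬ a ≤ degree n g v)) := by
  have hdeg := computeDegrees_spec h
  set s1 := Cmd.run n computeDegrees s with hs1
  have h1 : HoldsGraph n g s1 := h.congr (int_run_of_notMem _ _ _ _ (by decide))
    (int_run_of_notMem _ _ _ _ (by decide))
  set s2 := Cmd.run n (rset 46 0) s1 with hs2
  have f2 : ∀ a, a ≠ 46 → ∀ i, s2.int a i = s1.int a i := fun a ha i => by simp [hs2, ha]
  set c : Cmd := trySide edgeSide ;; trySide antiedgeSide ;; trySide degreeSide with hc
  have key := run_each_each_invariant (n := n) (s := s2) (x := 43) (y := 44) (p := c) (by decide)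
    (fun k l s' => (s'.int 46 0 ≠ 0 → HoldsSide n g s') ∧ (s'.int 46 0 = 0 → ∀ a < n, ∀ b < n,
      a < k ∨ (a = k ∧ b < l) →
      ¬ GoodSide n g (EdgeSide g a b) ∧ ¬ GoodSide n g (fun v => ¬ AntiedgeSide g a b v) ∧
      ¬ GoodSide n g (fun v => ¬ a ≤ degree n g v))) ?_ ?_ ?_ ?_ ?_
  · rw [show s' = Cmd.run n (each 43 (each 44 c)) s2 from hs']
    exact ⟨key.1, fun h2 a ha b hb => key.2 h2 a ha b hb (Or.inl ha)⟩
  · intro k l s' j hP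
    exact ⟨fun h2 => ⟨(hP.1 h2).1, (hP.1 h2).2⟩, hP.2⟩
  · intro k l s' j hP
    exact ⟨fun h2 => ⟨(hP.1 h2).1, (hP.1 h2).2⟩, hP.2⟩
  · refine ⟨fun h2 => absurd (by simp [hs2]) h2, fun _ a ha b hb h2 => by omega⟩
  · intro k s' hk hP
    exact ⟨hP.1, fun h2 a ha b hb h3 => hP.2 h2 a ha b hb (by omega)⟩
  intro k l s3 hk hl hx hy hi hw ⟨hP1, hP2⟩
  have f : ∀ a, a ∉ 43 :: 44 :: 46 :: c.imods → ∀ i, s3.int a i = s1.int a i := by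
    intro a ha i
    simp only [List.mem_cons, not_or] at ha
    rw [hi a (by simp [ha]), f2 a ha.2.2.1]
  have h3 : HoldsGraph n g s3 := h1.congr (f 0 (by decide)) (f 4 (by decide))
  have e45 : ∀ v < n, s3.int 45 v = degree n g v := fun v hv => by
    rw [f 45 (by decide), hdeg v hv]
  clear hi hw f
  have hand : ∀ (s4 : Store K), HoldsGraph n g s4 → s4.int 43 0 = k → s4.int 44 0 = l →
      ∀ u < n, EdgeSide g k l u ↔ (Cmd.run n edgeSide s4).int 40 u = 0 := by
    intro s4 h4 e43 e44 u hu
    have := setSide_spec (n := n) (s := s4) (b := disj (ieq (reg 10) (reg 43)) (disj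
      (ieq (reg 10) (reg 44)) (conj (ieq (get 4 (entry (reg 10) (reg 43))) 0)
        (ieq (get 4 (entry (reg 10) (reg 44))) 0)))) (e := 0) (f := 1) (C := EdgeSide g k l)
      (x := 0) (y := 1) (fun _ => rfl) (fun _ => rfl) (by
        intro s5 v hv hx hi
        have f0 := hi 0 (by decide) 0
        have f43 := hi 43 (by decide) 0
        have f44 := hi 44 (by decide) 0
        have f4 := hi 4 (by decide)
        clear hi
        simp only [holds_disj, holds_conj, holds_ieq, eval_get, eval_add, eval_mul, eval_ofNat, hx,
          f0, f43, f44, f4, h4.size, e43, e44, h4.graph v hv k hk, h4.graph v hv l hl, EdgeSide]) u hu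
    constructor
    · exact this.1
    · intro h5
      by_contra h6
      rw [show edgeSide = setSide _ _ _ from rfl, this.2 h6] at h5
      exact one_ne_zero h5
  have hanti : ∀ (s4 : Store K), HoldsGraph n g s4 → s4.int 43 0 = k → s4.int 44 0 = l →
      ∀ u < n, ¬ AntiedgeSide g k l u ↔ (Cmd.run n antiedgeSide s4).int 40 u = 0 := by
    intro s4 h4 e43 e44 u hu
    have := setSide_spec (n := n) (s := s4) (b := disj (ieq (reg 10) (reg 43)) (disj
      (ieq (reg 10) (reg 44)) (conj (ieq (get 4 (entry (reg 10) (reg 43))) 2)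
        (ieq (get 4 (entry (reg 10) (reg 44))) 2)))) (e := 1) (f := 0) (C := AntiedgeSide g k l)
      (x := 1) (y := 0) (fun _ => rfl) (fun _ => rfl) (by
        intro s5 v hv hx hi
        have f0 := hi 0 (by decide) 0
        have f43 := hi 43 (by decide) 0
        have f44 := hi 44 (by decide) 0
        have f4 := hi 4 (by decide)
        clear hi
        simp only [holds_disj, holds_conj, holds_ieq, eval_get, eval_add, eval_mul, eval_ofNat, hx,
          f0, f43, f44, f4, h4.size, e43, e44, h4.graph v hv k hk, h4.graph v hv l hl,
          AntiedgeSide]) u hu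
    constructor
    · exact this.2
    · intro h5 h6
      rw [show antiedgeSide = setSide _ _ _ from rfl, this.1 h6] at h5
      exact one_ne_zero h5
  have hdegr : ∀ (s4 : Store K), s4.int 43 0 = k → (∀ v < n, s4.int 45 v = degree n g v) →
      ∀ u < n, ¬ k ≤ degree n g u ↔ (Cmd.run n degreeSide s4).int 40 u = 0 := by
    intro s4 e43 e45 u hu
    have := setSide_spec (n := n) (s := s4) (b := ile (reg 43) (get 45 (reg 10)))
      (e := 1) (f := 0) (C := fun v => k ≤ degree n g v)
      (x := 1) (y := 0) (fun _ => rfl) (fun _ => rfl) (by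
        intro s5 v hv hx hi
        have f43 := hi 43 (by decide) 0
        have f45 := hi 45 (by decide)
        clear hi
        simp only [holds_ile, eval_get, eval_ofNat, hx, f43, f45, e43, e45 v hv]) u hu
    constructor
    · exact this.2
    · intro h5 h6
      rw [show degreeSide = setSide _ _ _ from rfl, this.1 h6] at h5
      exact one_ne_zero h5
  rw [hc, run_seq, run_seq]
  have t1 := trySide_spec h3 (by decide) (hand s3 h3 hx hy) hP1 _ rfl
  set s4 := Cmd.run n (trySide edgeSide) s3 with hs4
  have f4 : ∀ a, a ∉ (trySide edgeSide).imods → ∀ i, s4.int a i = s3.int a i :=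
    fun a ha i => int_run_of_notMem _ _ _ _ ha _
  have h4 : HoldsGraph n g s4 := h3.congr (f4 0 (by decide)) (f4 4 (by decide))
  have t2 := trySide_spec h4 (by decide) (hanti s4 h4 (by rw [f4 43 (by decide), hx])
    (by rw [f4 44 (by decide), hy])) t1.1 _ rfl
  set s5 := Cmd.run n (trySide antiedgeSide) s4 with hs5
  have f5 : ∀ a, a ∉ (trySide antiedgeSide).imods → ∀ i, s5.int a i = s4.int a i :=
    fun a ha i => int_run_of_notMem _ _ _ _ ha _
  have h5 : HoldsGraph n g s5 := h4.congr (f5 0 (by decide)) (f5 4 (by decide))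
  have t3 := trySide_spec h5 (by decide) (hdegr s5
    (by rw [f5 43 (by decide), f4 43 (by decide), hx])
    (fun v hv => by rw [f5 45 (by decide), f4 45 (by decide), e45 v hv])) t2.1 _ rfl
  refine ⟨t3.1, fun h6 a ha b hb h7 => ?_⟩
  obtain ⟨h8, h9⟩ := t3.2 h6
  obtain ⟨h10, h11⟩ := t2.2 h8
  obtain ⟨h12, h13⟩ := t1.2 h10
  rcases h7 with h7 | ⟨rfl, h7⟩
  · exact hP2 h12 a ha b hb (Or.inl h7)
  · rcases Nat.lt_succ_iff_lt_or_eq.1 h7 with h14 | rfl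
    · exact hP2 h12 a ha b hb (Or.inr ⟨rfl, h14⟩)
    · exact ⟨h13, h11, h9⟩

end RAM

namespace RAM

open Cmd IExp Test

variable {K : Type*} [AddCommGroup K] [LinearOrder K] {n : ℕ} {g : ℕ → ℕ → ℕ} {s : Store K}

/-! ### Stable sets of maximum weight in doubled trigraphs -/

theorem Mate.symm {X : ℕ → Prop} {u v : ℕ} (hg : g u v = g v u) (h : Mate g X u v) :
    Mate g X v u := by
  unfold Mate at h ⊢
  rw [← hg]
  tauto

/-- The vertex belongs to the first part and is to be preferred to its mate. -/
def Preferred (X : ℕ → Prop) (w : ℕ → K) (mf mt : ℕ → ℕ) (u : ℕ) : Prop :=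
  X u ∧ (mf u = 0 ∨ w (mt u) < w u ∨ (w (mt u) ≤ w u ∧ u < mt u))

-- A stable set inside the first part is at best the choice of the heavier vertex from each pair of
-- mates. With one vertex `u` in the second part, all vertices of the first part antiadjacent to `u`
-- can be added, since `u` tells mates apart. Two vertices in the second part are mates and exclude
-- everything else: each vertex of the first part is adjacent to one of them, and another one in the
-- second part would be a second mate.
open Classical in
theorem GoodSide.isMaxStableWeight [IsOrderedAddMonoid K] {X : ℕ → Prop} {w : ℕ → K}
    {mf mt : ℕ → ℕ} {a : K} (hg : ∀ u < n, ∀ v < n, g u v = g v u)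
    (hw : ∀ u < n, 0 ≤ w u) (H : GoodSide n g X) (M : HoldsMates n g X mf mt)
    (ha : IsGreatest (insert 0 ({∑ u ∈ Finset.range n with Preferred X w mf mt u, w u} ∪
      {z | ∃ u < n, z ∈ {z | ¬ X u ∧ z = w u + ∑ x ∈ Finset.range n with X x ∧ g u x = 0, w x}} ∪
      {z | ∃ u < n, z ∈ {z | ∃ v < n, z ∈ {z | (u ≠ v ∧ ¬ X u ∧ ¬ X v ∧ g u v = 0) ∧
        z = w u + w v}}})) a) :
    IsMaxStableWeight n g w a := by
  have hmt : ∀ u < n, ∀ v < n, Mate g X u v → mf u ≠ 0 ∧ mt u = v := by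
    intro u hu v hv h
    have h1 : mf u ≠ 0 := fun h1 => M.none u hu h1 v hv h
    have h2 := M.some u hu h1
    exact ⟨h1, H.mate_unique u hu _ h2.1 v hv h2.2 h⟩
  have stable : ∀ (P : ℕ → Prop) (hPX : ∀ u < n, P u → X u)
      (hP : ∀ u < n, ∀ v < n, P u → P v → ¬ Mate g X u v),
      ∀ u ∈ Finset.range n, ∀ v ∈ Finset.range n, P u → P v → u ≠ v → g u v = 0 := by
    intro P hPX hP u hu v hv h1 h2 huv
    rw [Finset.mem_range] at hu hv
    by_contra h3
    exact hP u hu v hv h1 h2 ⟨huv, Or.inl ⟨hPX u hu h1, hPX v hv h2, by omega⟩⟩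
  refine IsGreatest.of_dominated ha ?_ ?_
  · rintro _ (rfl | (rfl | ⟨u, hu, hX, rfl⟩) | ⟨u, hu, v, hv, ⟨huv, hXu, hXv, h0⟩, rfl⟩)
    · exact ⟨∅, by simp, by simp, by simp⟩
    · refine ⟨_, Finset.filter_subset _ _, fun u hu v hv huv => ?_, rfl⟩
      rw [Finset.mem_filter] at hu hv
      refine stable (Preferred X w mf mt) (fun u _ h => h.1) ?_ u hu.1 v hv.1 hu.2 hv.2 huv
      intro u hu v hv h1 h2 h3
      obtain ⟨h4, h5⟩ := hmt u hu v hv h3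
      obtain ⟨h6, h7⟩ := hmt v hv u hu (h3.symm (hg u hu v hv))
      have h8 := h1.2.resolve_left h4
      have h9 := h2.2.resolve_left h6
      rw [h5] at h8
      rw [h7] at h9
      -- Ties are broken by the smaller number, so two mates are never both preferred.
      rcases h8 with h8 | h8 <;> rcases h9 with h9 | h9
      · exact lt_asymm h8 h9
      · exact absurd h8 (not_lt.2 h9.1)
      · exact absurd h9 (not_lt.2 h8.1)
      · omega
    · have hu' : u ∉ (Finset.range n).filter fun x => X x ∧ g u x = 0 := fun h =>
        hX (Finset.mem_filter.1 h).2.1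
      refine ⟨insert u ((Finset.range n).filter fun x => X x ∧ g u x = 0), ?_, ?_, ?_⟩
      · exact Finset.insert_subset (Finset.mem_range.2 hu) (Finset.filter_subset _ _)
      · intro x hx y hy hxy
        have hsym : ∀ z ∈ (Finset.range n).filter (fun x => X x ∧ g u x = 0), g z u = 0 := by
          intro z hz
          rw [Finset.mem_filter, Finset.mem_range] at hz
          rw [hg z hz.1 u hu]
          exact hz.2.2
        rcases Finset.mem_insert.1 hx with rfl | hx <;> rcases Finset.mem_insert.1 hy with rfl | hy
        · exact absurd rfl hxy
        · exact (Finset.mem_filter.1 hy).2.2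
        · exact hsym x hx
        · rw [Finset.mem_filter] at hx hy
          refine stable (fun x => X x ∧ g u x = 0) (fun u _ h => h.1) ?_ x hx.1 y hy.1 hx.2 hy.2 hxy
          intro x hx y hy h1 h2 h3
          refine H.differ x hx y hy u hu h3 ⟨fun _ => hX, fun _ => h1.1⟩ ?_
          rw [hg x hx u hu, hg y hy u hu, h1.2, h2.2]
      · rw [Finset.sum_insert hu']
    · refine ⟨{u, v}, ?_, ?_, by rw [Finset.sum_pair huv]⟩
      · intro x hx
        rcases Finset.mem_insert.1 hx with rfl | hx
        · exact Finset.mem_range.2 hu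
        · rw [Finset.mem_singleton.1 hx]
          exact Finset.mem_range.2 hv
      · intro x hx y hy hxy
        rw [Finset.mem_insert, Finset.mem_singleton] at hx hy
        rcases hx with rfl | rfl <;> rcases hy with rfl | rfl
        · exact absurd rfl hxy
        · exact h0
        · rwa [hg _ hv _ hu]
        · exact absurd rfl hxy
  · rintro _ ⟨S, hS, hst, rfl⟩
    have hlt : ∀ v ∈ S, v < n := fun v hv => Finset.mem_range.1 (hS hv)
    by_cases h1 : ∀ u ∈ S, X u
    · refine ⟨_, Or.inr (Or.inl (Or.inl rfl)), ?_⟩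
      -- Exchange each vertex for its mate where the mate is preferred. No weight is lost, and `φ`
      -- is injective because `S` contains no two mates and mates are unique.
      set φ : ℕ → ℕ := fun u => if Preferred X w mf mt u then u else mt u with hφ
      have hun : ∀ u ∈ S, ¬ Preferred X w mf mt u → mf u ≠ 0 ∧ w u ≤ w (mt u) ∧
          Preferred X w mf mt (mt u) ∧ mt u < n ∧ Mate g X u (mt u) := by
        intro u hu h2
        have h3 : mf u ≠ 0 := fun h3 => h2 ⟨h1 u hu, Or.inl h3⟩
        obtain ⟨h4, h5⟩ := M.some u (hlt u hu) h3
        have h6 := (hmt _ h4 u (hlt u hu) (h5.symm (hg _ (hlt u hu) _ h4))).2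
        have h7 : ¬ w (mt u) < w u := fun h7 => h2 ⟨h1 u hu, Or.inr (Or.inl h7)⟩
        refine ⟨h3, not_lt.1 h7, ⟨?_, Or.inr ?_⟩, h4, h5⟩
        · rcases h5.2 with h8 | h8
          · exact h8.2.1
          · exact absurd (h1 u hu) h8.1
        · rw [h6]
          rcases lt_or_eq_of_le (not_lt.1 h7) with h8 | h8
          · exact Or.inl h8
          · refine Or.inr ⟨h8.le, ?_⟩
            have h9 : ¬ u < mt u := fun h9 => h2 ⟨h1 u hu, Or.inr (Or.inr ⟨h8.ge, h9⟩)⟩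
            have := h5.1
            omega
      have hinj : Set.InjOn φ S := by
        intro u hu v hv huv
        have hno : ∀ x ∈ S, ∀ y ∈ S, ¬ Mate g X x y := by
          intro x hx y hy h2
          rcases h2.2 with h3 | h3
          · have := hst x hx y hy h2.1
            omega
          · exact h3.1 (h1 x hx)
        simp only [hφ] at huv
        split_ifs at huv with h2 h3 h3
        · exact huv
        · exact absurd (huv ▸ (hun v hv h3).2.2.2.2) (hno v hv u hu)
        · exact absurd (huv ▸ (hun u hu h2).2.2.2.2) (hno u hu v hv)
        · obtain ⟨-, -, -, h4, h5⟩ := hun u hu h2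
          obtain ⟨-, -, -, h6, h7⟩ := hun v hv h3
          rw [← huv] at h7
          exact H.mate_unique _ h4 u (hlt u hu) v (hlt v hv) (h5.symm (hg _ (hlt u hu) _ h4))
            (h7.symm (hg _ (hlt v hv) _ h4))
      calc ∑ v ∈ S, w v ≤ ∑ v ∈ S, w (φ v) := Finset.sum_le_sum fun u hu => by
            simp only [hφ]
            split_ifs with h2
            · exact le_rfl
            · exact (hun u hu h2).2.1
        _ = ∑ v ∈ S.image φ, w v := by rw [Finset.sum_image hinj]
        _ ≤ _ := by
          refine Finset.sum_le_sum_of_subset_of_nonneg ?_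
            fun u hu _ => hw u (Finset.mem_range.1 (Finset.mem_filter.1 hu).1)
          intro v hv
          obtain ⟨u, hu, rfl⟩ := Finset.mem_image.1 hv
          rw [Finset.mem_filter, Finset.mem_range]
          simp only [hφ]
          split_ifs with h2
          · exact ⟨hlt u hu, h2⟩
          · exact ⟨(hun u hu h2).2.2.2.1, (hun u hu h2).2.2.1⟩
    push Not at h1
    obtain ⟨y, hy, hXy⟩ := h1
    by_cases h2 : ∀ u ∈ S, u ≠ y → X u
    · refine ⟨_, Or.inr (Or.inl (Or.inr ⟨y, hlt y hy, hXy, rfl⟩)), ?_⟩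
      rw [← Finset.add_sum_erase S _ hy]
      refine add_le_add_right (Finset.sum_le_sum_of_subset_of_nonneg ?_
        fun u hu _ => hw u (Finset.mem_range.1 (Finset.mem_filter.1 hu).1)) _
      intro u hu
      rw [Finset.mem_erase] at hu
      exact Finset.mem_filter.2 ⟨hS hu.2, h2 u hu.2 hu.1, hst y hy u hu.2 hu.1.symm⟩
    · push Not at h2
      obtain ⟨z, hz, hzy, hXz⟩ := h2
      have hyz := hst y hy z hz hzy.symm
      have hmate : Mate g X y z := ⟨hzy.symm, Or.inr ⟨hXy, hXz, by omega⟩⟩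
      refine ⟨_, Or.inr (Or.inr ⟨y, hlt y hy, z, hlt z hz, ⟨hzy.symm, hXy, hXz, hyz⟩, rfl⟩), ?_⟩
      rw [← Finset.sum_pair hzy.symm]
      refine Finset.sum_le_sum_of_subset_of_nonneg ?_ fun u hu _ => ?_
      · intro u hu
        rw [Finset.mem_insert, Finset.mem_singleton]
        by_contra h3
        push Not at h3
        have h4 := hst y hy u hu h3.1.symm
        have h5 := hst z hz u hu h3.2.symm
        by_cases h6 : X u
        · refine H.differ y (hlt y hy) z (hlt z hz) u (hlt u hu) hmate ?_ (by rw [h4, h5])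
          tauto
        · exact h3.2 (H.mate_unique y (hlt y hy) u (hlt u hu) z (hlt z hz)
            ⟨h3.1.symm, Or.inr ⟨hXy, h6, by omega⟩⟩ hmate)
      · rw [Finset.mem_insert, Finset.mem_singleton] at hu
        rcases hu with rfl | rfl
        · exact hw _ (hlt _ hy)
        · exact hw _ (hlt _ hz)

/-- The test for `Preferred`. -/
def preferTest : Test :=
  conj (ieq (get 40 (reg 10)) 0) (disj (ieq (get 41 (reg 10)) 0)
    (disj (wlt (.get 0 (get 42 (reg 10))) (.get 0 (reg 10)))
      (conj (wle (.get 0 (get 42 (reg 10))) (.get 0 (reg 10)))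
        (ilt (reg 10) (get 42 (reg 10))))))

/-- The stable sets with one vertex in the second part. -/
def solveOne : Cmd :=
  when (neg (ieq (get 40 (reg 10)) 0)) (.wset 2 0 (.get 0 (reg 10)) ;;
    addWeights 11 (conj (ieq (get 40 (reg 11)) 0) (ieq (get 4 (entry (reg 10) (reg 11))) 0)) ;;
    raise (.reg 2))

/-- The stable sets with two vertices in the second part. -/
def solveTwo : Cmd :=
  when (conj (neg (ieq (reg 10) (reg 11))) (conj (neg (ieq (get 40 (reg 10)) 0))
    (conj (neg (ieq (get 40 (reg 11)) 0)) (ieq (get 4 (entry (reg 10) (reg 11))) 0))))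
    (raise (.get 0 (reg 10) + .get 0 (reg 11)))

/-- The maximum weight of a stable set in a doubled trigraph. -/
def solveDoubled : Cmd :=
  .wset 1 0 0 ;; .wset 2 0 0 ;; addWeights 10 preferTest ;; raise (.reg 2) ;; each 10 solveOne ;;
  each 10 (each 11 solveTwo)

theorem solveDoubled_spec [IsOrderedAddMonoid K] (hg : ∀ u < n, ∀ v < n, g u v = g v u)
    (hw : ∀ u < n, 0 ≤ s.wt 0 u) (h : HoldsGraph n g s)
    (H : HoldsSide n g s) :
    IsMaxStableWeight n g (fun u => s.wt 0 u) ((solveDoubled.run n s).wt 1 0) := by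
  classical
  set X : ℕ → Prop := fun u => s.int 40 u = 0 with hX
  set s1 := Cmd.run n (.wset 1 0 0 ;; .wset 2 0 0) s with hs1
  have i1 : s1.int = s.int := rfl
  have w1 : s1.wt 0 = s.wt 0 := funext fun i => by simp [hs1]
  have k1 := addWeights_spec (n := n) (s := s1) (x := 10) (b := preferTest)
    (C := Preferred X (s.wt 0) (s.int 41) (s.int 42)) (by
      intro s' k hk hx hi hw'
      have e40 := hi 40 (by decide)
      have e41 := hi 41 (by decide)
      have e42 := hi 42 (by decide)
      have e0 := hw' 0 (by decide)
      clear hi hw'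
      simp only [preferTest, holds_conj, holds_disj, holds_ieq, holds_wlt, holds_wle, holds_ilt,
        eval_get, eval_ofNat, WExp.eval_get, hx, e40, e41, e42, e0, i1, w1, Preferred, hX])
  set s2 := Cmd.run n (addWeights 10 preferTest) s1 with hs2
  have e2 : s1.wt 2 0 = 0 := by simp [hs1]
  rw [e2, zero_add, w1] at k1
  have k2 := raise_spec (n := n) (s := s2) (.reg 2)
  have e1 : s2.wt 1 0 = 0 := by
    rw [hs2, wt_run_of_notMem _ _ _ _ (by decide)]
    simp [hs1]
  rw [e1, show (WExp.reg 2).eval s2 = s2.wt 2 0 from rfl, k1] at k2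
  set s3 := Cmd.run n (raise (.reg 2)) s2 with hs3
  have f3 : ∀ a, a ≠ 10 → s3.int a = s.int a := fun a ha => funext fun i => by
    rw [hs3, int_run_of_notMem _ _ _ _ (by simp [raise, imods]), hs2,
      int_run_of_notMem _ _ _ _ (by simp [addWeights, imods, ha]), i1]
  have w3 : s3.wt 0 = s.wt 0 := funext fun i => by
    rw [hs3, wt_run_of_notMem _ _ _ _ (by decide), hs2, wt_run_of_notMem _ _ _ _ (by decide), w1]
  have k3 := run_each_isGreatest (n := n) (s := s3) (x := 10) (p := solveOne)
    (fun u => {z | ¬ X u ∧ z = s.wt 0 u + ∑ x ∈ Finset.range n with X x ∧ g u x = 0, s.wt 0 x}) (by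
      intro u s4 hu hx hi hw'
      have f : ∀ a, a ∉ 10 :: solveOne.imods → ∀ i, s4.int a i = s.int a i := by
        intro a ha i
        rw [hi a ha, f3 a (fun h1 => ha (by simp [h1]))]
      have w4 : ∀ i, s4.wt 0 i = s.wt 0 i := fun i => by rw [hw' 0 (by decide), w3]
      have h4 : HoldsGraph n g s4 := h.congr (f 0 (by decide)) (f 4 (by decide))
      have e40 := f 40 (by decide)
      clear f hi hw'
      unfold solveOne
      rw [run_ite]
      by_cases h5 : X u
      · rw [if_neg (by simpa [hx, e40] using h5), run_skip]
        simp [h5, IsGreatest, upperBounds]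
      · rw [if_pos (by simpa [hx, e40] using h5), run_seq, run_seq]
        set s5 := Cmd.run n (.wset 2 0 (.get 0 (reg 10))) s4 with hs5
        have k5 := addWeights_spec (n := n) (s := s5) (x := 11)
          (b := conj (ieq (get 40 (reg 11)) 0) (ieq (get 4 (entry (reg 10) (reg 11))) 0))
          (C := fun x => X x ∧ g u x = 0) (by
            intro s6 k hk hz hi _
            have f0 : s6.int 0 0 = n := by rw [hi 0 (by decide)]; exact h4.size
            have f10 : s6.int 10 0 = u := by rw [hi 10 (by decide)]; exact hx
            have f40 : s6.int 40 k = s.int 40 k := by rw [hi 40 (by decide)]; exact e40 k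
            have f4 : s6.int 4 (u * n + k) = g u k := by
              rw [hi 4 (by decide)]; exact h4.graph u hu k hk
            clear hi
            simp only [holds_conj, holds_ieq, eval_get, eval_add, eval_mul, eval_ofNat, hz, f0, f10,
              f40, f4, hX])
        set s6 := Cmd.run n (addWeights 11 (conj (ieq (get 40 (reg 11)) 0)
          (ieq (get 4 (entry (reg 10) (reg 11))) 0))) s5 with hs6
        have f1 : s6.wt 1 0 = s4.wt 1 0 := by
          rw [hs6, wt_run_of_notMem _ _ _ _ (by decide)]
          simp [hs5]
        have k6 := raise_spec (n := n) (s := s6) (.reg 2)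
        have f2 : (WExp.reg 2).eval s6 =
            s.wt 0 u + ∑ x ∈ Finset.range n with X x ∧ g u x = 0, s.wt 0 x := by
          have w5 : s5.wt 0 = s.wt 0 := funext fun i => by simp [hs5, w4]
          simp only [WExp.eval_get, eval_ofNat]
          rw [k5, w5]
          simp [hs5, hx, w4]
        rw [f1, f2] at k6
        simpa [h5] using k6)
  set s4 := Cmd.run n (each 10 solveOne) s3 with hs4
  have k4 := run_each_isGreatest (n := n) (s := s4) (x := 10) (p := each 11 solveTwo)
    (fun u => {z | ∃ v < n, z ∈ {z | (u ≠ v ∧ ¬ X u ∧ ¬ X v ∧ g u v = 0) ∧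
        z = s.wt 0 u + s.wt 0 v}}) (by
      intro u s5 hu hx hi hw'
      refine run_each_isGreatest (n := n) (s := s5) (x := 11) (p := solveTwo) _ ?_
      intro v s6 hv hy hi' hw''
      have f : ∀ a, a ∉ [10, 11] → ∀ i, s6.int a i = s.int a i := by
        intro a ha i
        simp only [List.mem_cons, not_or] at ha
        rw [hi' a (by simp [solveTwo, raise, imods, ha]),
          hi a (by simp [solveTwo, raise, imods, ha]), hs4,
          int_run_of_notMem _ _ _ _ (by simp [solveOne, addWeights, raise, imods, ha]), f3 a ha.1]
      have e10 : s6.int 10 0 = u := by rw [hi' 10 (by decide), hx]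
      have w6 : ∀ i, s6.wt 0 i = s.wt 0 i := fun i => by
        rw [hw'' 0 (by decide), hw' 0 (by decide), hs4, wt_run_of_notMem _ _ _ _ (by decide), w3]
      have h6 : HoldsGraph n g s6 := h.congr (f 0 (by decide)) (f 4 (by decide))
      have e40 := f 40 (by decide)
      clear hi hi' hw' hw'' f
      have hholds : Test.Holds s6 (conj (neg (ieq (reg 10) (reg 11)))
          (conj (neg (ieq (get 40 (reg 10)) 0)) (conj (neg (ieq (get 40 (reg 11)) 0))
          (ieq (get 4 (entry (reg 10) (reg 11))) 0)))) ↔ (u ≠ v ∧ ¬ X u ∧ ¬ X v ∧ g u v = 0) := by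
        simp only [holds_conj, holds_neg, holds_ieq, eval_get, eval_add, eval_mul, eval_ofNat,
          h6.size, e10, hy, e40, h6.graph u hu v hv, hX, ne_eq]
      unfold solveTwo
      rw [run_ite]
      by_cases h7 : u ≠ v ∧ ¬ X u ∧ ¬ X v ∧ g u v = 0
      · rw [if_pos (by rwa [hholds])]
        have k6 := raise_spec (n := n) (s := s6) (.get 0 (reg 10) + .get 0 (reg 11))
        simp only [WExp.eval_add, WExp.eval_get, eval_get, eval_ofNat, e10, hy, w6] at k6
        simpa only [h7, true_and, Set.ofPred_eq_eq_singleton, not_false_eq_true, ne_eq] using k6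
      · rw [if_neg (by rwa [hholds]), run_skip]
        simp [h7, IsGreatest, upperBounds])
  have hrun : solveDoubled.run n s = Cmd.run n (each 10 (each 11 solveTwo)) s4 := rfl
  rw [← hrun] at k4
  refine H.good.isMaxStableWeight hg hw H.mates ?_
  convert isGreatest_insert_union (isGreatest_insert_union k2 k3) k4

end RAM

/-! ### Trigraphs in terms of the entries of their adjacency matrices. -/

namespace Trigraph

variable {n : ℕ} (T : Trigraph (Fin n))

/-- The entries of the adjacency matrix; they are `0` outside the range of the vertices. -/
def code (u v : ℕ) : ℕ :=
  if h : u < n ∧ v < n then signCode (T.adj ⟨u, h.1⟩ ⟨v, h.2⟩) else 0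

variable {T}

@[simp] theorem code_fin (u v : Fin n) : T.code u v = signCode (T.adj u v) := by
  simp [code]

theorem code_symm (u v : ℕ) : T.code u v = T.code v u := by
  unfold code
  by_cases h : u < n ∧ v < n
  · rw [dif_pos h, dif_pos h.symm, T.symm]
  · rw [dif_neg h, dif_neg (mt And.symm h)]

theorem code_le (u v : ℕ) : T.code u v ≤ 2 := by
  unfold code
  split_ifs
  · generalize T.adj _ _ = x
    cases x <;> simp [signCode]
  · exact Nat.zero_le 2

theorem code_self (u : ℕ) : T.code u u = 0 := by
  unfold code
  split_ifs
  · rw [T.diag]; rfl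
  · rfl

variable {u v : Fin n}

theorem code_eq_two_iff : T.code u v = 2 ↔ T.StronglyAdjacent u v := by
  have h : signCode (T.adj u v) = 2 ↔ T.adj u v = 1 := by
    generalize T.adj u v = x
    cases x <;> decide
  rw [code_fin, h]
  refine ⟨fun h1 => ⟨?_, h1⟩, fun h1 => h1.2⟩
  rintro rfl
  rw [T.diag] at h1
  exact absurd h1 (by decide)

theorem code_eq_one_iff : T.code u v = 1 ↔ T.Semiadjacent u v := by
  have h : signCode (T.adj u v) = 1 ↔ T.adj u v = 0 := by
    generalize T.adj u v = x
    cases x <;> decide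
  rw [code_fin, h]
  refine ⟨fun h1 => ⟨?_, h1⟩, fun h1 => h1.2⟩
  rintro rfl
  rw [T.diag] at h1
  exact absurd h1 (by decide)

theorem code_eq_zero_iff (huv : u ≠ v) : T.code u v = 0 ↔ T.StronglyAntiadjacent u v := by
  have h : signCode (T.adj u v) = 0 ↔ T.adj u v = -1 := by
    generalize T.adj u v = x
    cases x <;> decide
  rw [code_fin, h]
  exact ⟨fun h1 => ⟨huv, h1⟩, fun h1 => h1.2⟩

theorem one_le_code_iff : 1 ≤ T.code u v ↔ T.Adjacent u v := by
  unfold Adjacent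
  rw [← code_eq_two_iff, ← code_eq_one_iff]
  have := T.code_le u v
  omega

/-- Complementing exchanges `0` and `2` off the diagonal; the diagonal must be exempted since it is
fixed at `0`. -/
theorem code_compl {u v : ℕ} (hu : u < n) (hv : v < n) :
    T.compl.code u v = if u = v then 0 else 2 - T.code u v := by
  lift u to Fin n using hu
  lift v to Fin n using hv
  simp only [code_fin, compl, ← Fin.ext_iff]
  by_cases h : u = v
  · simp only [h, if_true]; rfl
  · simp only [h, if_false]
    generalize T.adj u v = x
    cases x <;> decide

end Trigraph

/-! ### Bipartite and line trigraphs in terms of arc colourings. -/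

namespace RAM

open Trigraph

variable {n : ℕ} {T : Trigraph (Fin n)}

/-- An arc is coloured by the side of its tail. Conversely, the tails of arcs of colour `1` form one
side, and the isolated vertices go to the other one. -/
theorem isBipartite_iff : T.IsBipartite ↔ ∃ f, IsArcColouring n 0 T.code f := by
  classical
  constructor
  · rintro ⟨X, Y, hXY, hX, hY⟩
    have hmem : ∀ v, v ∈ Y ↔ v ∉ X := fun v => by rw [← hXY.compl_eq, Set.mem_compl_iff]
    have key : ∀ u v : Fin n, 1 ≤ T.code u v → (u ∈ X ↔ v ∉ X) := by
      intro u v h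
      have hne : u ≠ v := by
        rintro rfl
        rw [code_self] at h
        omega
      have h0 : ¬ T.StronglyAntiadjacent u v := by
        rw [← code_eq_zero_iff hne]
        omega
      constructor
      · intro h1 h2
        exact h0 (hX h1 h2 hne)
      · intro h1
        by_contra h2
        exact h0 (hY ((hmem u).2 h2) ((hmem v).2 h1) hne)
    refine ⟨fun u _ => if ∃ h : u < n, (⟨u, h⟩ : Fin n) ∈ X then 1 else 2, fun u _ v _ _ => ?_,
      fun u hu v hv j hj h1 h2 => ?_⟩
    · split_ifs <;> simp
    · have h3 := key ⟨u, hu⟩ ⟨v, hv⟩ h1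
      simp only [hu, hv, exists_true_left, Differ, true_or, iff_true]
      by_cases h4 : (⟨v, hv⟩ : Fin n) ∈ X
      · rw [if_neg (fun h => h3.1 h h4), if_pos h4]; decide
      · rw [if_pos (h3.2 h4), if_neg h4]; decide
  · rintro ⟨f, hf⟩
    have hd : ∀ u v j : Fin n, T.Adjacent u v → T.Adjacent v j → f u v ≠ f v j := by
      intro u v j h1 h2
      exact (hf.differ u u.2 v v.2 j j.2 (one_le_code_iff.2 h1) (one_le_code_iff.2 h2)).2
        (Or.inl rfl)
    have hr : ∀ u v : Fin n, T.Adjacent u v → f u v = 1 ∨ f u v = 2 := fun u v h1 =>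
      hf.range u u.2 v v.2 (one_le_code_iff.2 h1)
    have hs : ∀ u v : Fin n, T.Adjacent u v → T.Adjacent v u := fun u v h1 => by
      rw [← one_le_code_iff, code_symm]
      exact one_le_code_iff.2 h1
    have hna : ∀ u v : Fin n, u ≠ v → ¬ T.Adjacent u v → T.StronglyAntiadjacent u v := by
      intro u v h1 h2
      rw [← one_le_code_iff] at h2
      rw [← code_eq_zero_iff h1]
      omega
    refine ⟨{u | ∃ v : Fin n, T.Adjacent u v ∧ f u v = 1}, _, isCompl_compl, ?_, ?_⟩
    · rintro u ⟨v, hv, huv⟩ u' ⟨v', hv', huv'⟩ hne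
      refine hna u u' hne fun h => ?_
      have h1 := hd u' u v (hs u u' h) hv
      have h2 := hd u u' v' h hv'
      have h3 := hd u u' u h (hs u u' h)
      have h4 := hr u u' h
      have h5 := hr u' u (hs u u' h)
      omega
    · intro u hu u' hu' hne
      refine hna u u' hne fun h => ?_
      have h1 : f u u' ≠ 1 := fun h1 => hu ⟨u', h, h1⟩
      have h2 : f u' u ≠ 1 := fun h1 => hu' ⟨u, hs u u' h, h1⟩
      have h3 := hd u u' u h (hs u u' h)
      have h4 := hr u u' h
      have h5 := hr u' u (hs u u' h)
      omega

theorem exists_isLabel (n : ℕ) (g f : ℕ → ℕ → ℕ) (c : ℕ) :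
    ∃ l : ℕ → ℕ, ∀ v < n, IsLabel n g f c v (l v) := by
  classical
  have h : ∀ v, ∃ l, l = v ∨ l < n ∧ 1 ≤ g l v ∧ f l v = c := fun v => ⟨v, Or.inl rfl⟩
  refine ⟨fun v => Nat.find (h v), fun v _ => ⟨Nat.find_spec (h v), ?_, fun u hu h1 h2 => ?_⟩⟩
  · exact Nat.find_min' (h v) (Or.inl rfl)
  · exact Nat.find_min' (h v) (Or.inr ⟨hu, h1, h2⟩)

/-- Think of `v` as an edge with ends `a v` and `b v`, where no two edges have the same ends.
Consecutive adjacencies at the same side imply that the outer edges share that end; at different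
sides they imply that the outer edges are distinct and disjoint, for otherwise two edges would
coincide. -/
theorem isArcColouring_of_labels {g : ℕ → ℕ → ℕ} {α β : Type*} [DecidableEq α] (a : ℕ → α)
    (b : ℕ → β) (hab : ∀ u < n, ∀ v < n, a u = a v → b u = b v → u = v)
    (hg : ∀ u < n, ∀ v < n, 1 ≤ g u v ↔ u ≠ v ∧ (a u = a v ∨ b u = b v)) :
    IsArcColouring n 1 g fun u v => if a u = a v then 1 else 2 := by
  refine ⟨fun u _ v _ _ => ?_, fun u hu v hv j hj h1 h2 => ?_⟩
  · split_ifs <;> simp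
  · obtain ⟨huv, h3⟩ := (hg u hu v hv).1 h1
    obtain ⟨hvj, h4⟩ := (hg v hv j hj).1 h2
    have h5 := hg u hu j hj
    have h6 : g u j = 0 ↔ ¬ 1 ≤ g u j := by omega
    simp only [Differ, one_ne_zero, false_or, h6, h5]
    by_cases h7 : a u = a v <;> by_cases h8 : a v = a j
    · simp [h7, h8]
      tauto
    · have h9 : b v = b j := h4.resolve_left h8
      have h10 : ¬ b u = b j := fun h => huv (hab u hu v hv h7 (h.trans h9.symm))
      have h11 : ¬ a u = a j := by rwa [h7]
      have h12 : j ≠ u := fun h => h11 (by rw [h])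
      simp [h7, h8, h12, h10]
    · have h9 : b u = b v := h3.resolve_left h7
      have h10 : ¬ b u = b j := fun h => hvj (hab v hv j hj h8 (h9.symm.trans h))
      have h11 : ¬ a u = a j := by rwa [← h8]
      have h12 : j ≠ u := fun h => h11 (by rw [h])
      simp [h8, h12, h10, h11]
    · have h9 : b u = b j := (h3.resolve_left h7).trans (h4.resolve_left h8)
      simp only [h7, h8, if_false, ne_eq, not_true_eq_false, h9, or_true, and_true, not_not,
        false_iff, not_and]
      exact fun h h' => h h'.symm

/-- A line graph of a bipartite graph is coloured according to whether edges meet on the left.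
Conversely, the labels of a colouring are the two ends, and the root graph lives on two copies of
the vertex set. -/
theorem exists_labels_iff : (∃ (W : Type) (_ : Finite W) (R : SimpleGraph W),
    R.IsBipartite ∧ Nonempty (T.fullRealization ≃g R.lineGraph)) ↔
      ∃ f, IsArcColouring n 1 T.code f := by
  classical
  constructor
  · rintro ⟨W, _, R, ⟨c⟩, ⟨φ⟩⟩
    have hends : ∀ e : R.edgeSet, ∃ p : W × W, (e : Sym2 W) = s(p.1, p.2) ∧ c p.1 = 0 ∧ c p.2 = 1 := by
      rintro ⟨e, he⟩
      induction e using Sym2.ind with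
      | _ x y =>
        have hne := c.valid (R.mem_edgeSet.1 he)
        have hx := Fin.exists_fin_two.1 ⟨c x, rfl⟩
        have hy := Fin.exists_fin_two.1 ⟨c y, rfl⟩
        rcases hx with hx | hx <;> rcases hy with hy | hy
        · exact absurd (hx.trans hy.symm) hne
        · exact ⟨(x, y), rfl, hx, hy⟩
        · exact ⟨(y, x), Sym2.eq_swap, hy, hx⟩
        · exact absurd (hx.trans hy.symm) hne
    choose p hp h0 h1 using hends
    -- A left end is never a right end, as the bipartition gives them different colours.
    have hshare : ∀ e e' : R.edgeSet, (∃ v, v ∈ (e : Sym2 W) ∧ v ∈ (e' : Sym2 W)) ↔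
        (p e).1 = (p e').1 ∨ (p e).2 = (p e').2 := by
      intro e e'
      rw [hp e, hp e']
      simp only [Sym2.mem_iff]
      constructor
      · rintro ⟨v, rfl | rfl, h | h⟩
        · exact Or.inl h
        · have := h0 e
          rw [h, h1 e'] at this
          exact absurd this (by decide)
        · have := h1 e
          rw [h, h0 e'] at this
          exact absurd this (by decide)
        · exact Or.inr h
      · rintro (h | h)
        · exact ⟨_, Or.inl rfl, Or.inl h⟩
        · exact ⟨_, Or.inr rfl, Or.inr h⟩
    -- The labels take values in `Option W` merely to be defined on all natural numbers.
    refine ⟨_, isArcColouring_of_labels (α := Option W) (β := Option W)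
      (fun u => if h : u < n then some (p (φ ⟨u, h⟩)).1 else none)
      (fun u => if h : u < n then some (p (φ ⟨u, h⟩)).2 else none) ?_ ?_⟩
    · intro u hu v hv h2 h3
      simp only [hu, hv, dif_pos, Option.some.injEq] at h2 h3
      have h4 : φ ⟨u, hu⟩ = φ ⟨v, hv⟩ := Subtype.ext (by rw [hp, hp (φ ⟨v, hv⟩), h2, h3])
      exact congrArg Fin.val (φ.injective h4)
    · intro u hu v hv
      simp only [hu, hv, dif_pos, Option.some.injEq]
      rw [← hshare]
      have h2 := φ.map_adj_iff (v := ⟨u, hu⟩) (w := ⟨v, hv⟩)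
      rw [SimpleGraph.lineGraph_adj_iff_exists, φ.injective.ne_iff, ne_eq, Fin.mk.injEq] at h2
      rw [ne_eq, h2]
      exact one_le_code_iff (u := ⟨u, hu⟩) (v := ⟨v, hv⟩)
  · rintro ⟨f, hf⟩
    obtain ⟨la, hla⟩ := exists_isLabel n T.code f 1
    obtain ⟨lb, hlb⟩ := exists_isLabel n T.code f 2
    have hlt : ∀ v : Fin n, la v < n ∧ lb v < n := fun v =>
      ⟨(hla v v.2).2.1.trans_lt v.2, (hlb v v.2).2.1.trans_lt v.2⟩
    have hsym : ∀ u < n, ∀ v < n, T.code u v = T.code v u := fun u _ v _ => code_symm u v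
    have hadj : ∀ u v : Fin n, T.Adjacent u v ↔ u ≠ v ∧ (la u = la v ∨ lb u = lb v) := by
      intro u v
      by_cases huv : u = v
      · subst huv
        rw [← one_le_code_iff, code_self]
        simp
      · have h := hf.adj_iff_label hsym hla hlb u.2 v.2 (fun h => huv (Fin.ext h))
        rw [← one_le_code_iff, h]
        simp [huv]
    set e : Fin n → Sym2 (Fin n ⊕ Fin n) := fun v =>
      s(Sum.inl ⟨la v, (hlt v).1⟩, Sum.inr ⟨lb v, (hlt v).2⟩) with he
    have hmem : ∀ v, e v ∈ (SimpleGraph.fromEdgeSet (Set.range e)).edgeSet := by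
      intro v
      rw [SimpleGraph.edgeSet_fromEdgeSet]
      exact ⟨⟨v, rfl⟩, by simp [he]⟩
    -- If two vertices agreed in both labels, the arc between them would have both colours.
    have hinj : Function.Injective e := by
      intro u v h
      simp only [he, Sym2.eq_iff, Sum.inl.injEq, Sum.inr.injEq, reduceCtorEq, and_false, or_false,
        Fin.mk.injEq] at h
      by_contra huv
      have huv' : (u : ℕ) ≠ v := fun h => huv (Fin.ext h)
      have h1 := ((hf.label_eq_iff hsym hla u.2 v.2 huv').1 h.1).2
      have h2 := ((hf.label_eq_iff hsym hlb u.2 v.2 huv').1 h.2).2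
      omega
    refine ⟨Fin n ⊕ Fin n, inferInstance, SimpleGraph.fromEdgeSet (Set.range e),
      ⟨SimpleGraph.Coloring.mk (fun x => if x.isLeft then 0 else 1) ?_⟩, ⟨⟨Equiv.ofBijective
        (fun v => ⟨e v, hmem v⟩) ⟨fun u v h => hinj (congrArg Subtype.val h), ?_⟩, ?_⟩⟩⟩
    · intro x y h
      obtain ⟨⟨v, hv⟩, -⟩ := (SimpleGraph.fromEdgeSet_adj _).1 h
      rcases Sym2.eq_iff.1 hv with ⟨rfl, rfl⟩ | ⟨rfl, rfl⟩ <;> simp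
    · rintro ⟨x, hx⟩
      rw [SimpleGraph.edgeSet_fromEdgeSet] at hx
      obtain ⟨⟨v, rfl⟩, -⟩ := hx
      exact ⟨v, rfl⟩
    · intro u v
      rw [SimpleGraph.lineGraph_adj_iff_exists]
      change _ ↔ T.Adjacent u v
      rw [hadj]
      refine and_congr (Equiv.injective _).ne_iff ?_
      simp only [Equiv.ofBijective_apply, he, Sym2.mem_iff]
      constructor
      · rintro ⟨x, rfl | rfl, h | h⟩ <;> simp at h
        · exact Or.inl h
        · exact Or.inr h
      · rintro (h | h)
        · exact ⟨_, Or.inl rfl, Or.inl (by simp [h])⟩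
        · exact ⟨_, Or.inr rfl, Or.inr (by simp [h])⟩

/-- Any two vertices of a clique with at least three vertices lie in a triangle inside it, so the
condition on cliques concerns triangles only. -/
theorem isLine_iff :
    T.IsLine ↔ (∃ f, IsArcColouring n 1 T.code f) ∧ StrongTriangles n T.code := by
  unfold IsLine
  rw [exists_labels_iff]
  refine and_congr_right fun _ => ⟨fun h u hu v hv w hw h1 h2 h3 => ?_, fun h X hX h3 u hu v hv huv => ?_⟩
  · lift u to Fin n using hu
    lift v to Fin n using hv
    lift w to Fin n using hw
    have huw := one_le_code_iff.1 h1
    have hvw := one_le_code_iff.1 h2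
    have huv : T.Adjacent u v := one_le_code_iff.1 h3.ge
    have hne : ∀ {x y : Fin n}, T.Adjacent x y → x ≠ y := fun h => h.elim (·.1) (·.1)
    have hs : ∀ {u v : Fin n}, T.Adjacent u v → T.Adjacent v u := fun {u v} h1 => by
      rw [← one_le_code_iff, code_symm]
      exact one_le_code_iff.2 h1
    have := h {u, v, w} ?_ ?_ (by simp : u ∈ _) (by simp : v ∈ _) (hne huv)
    · rw [← code_eq_two_iff] at this
      omega
    · rintro x (rfl | rfl | rfl) y (rfl | rfl | rfl) hxy
      all_goals first | exact absurd rfl hxy | assumption | exact hs (by assumption)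
    · rw [Set.encard_insert_of_notMem, Set.encard_pair (hne hvw)]
      · norm_num
      · simp [hne huv, hne huw]
  · obtain ⟨w, hw, hwu, hwv⟩ : ∃ w ∈ X, w ≠ u ∧ w ≠ v := by
      by_contra h4
      push Not at h4
      have h5 : X ⊆ {u, v} := fun w hw => by
        by_cases h6 : w = u
        · exact Or.inl h6
        · exact Or.inr (h4 w hw h6)
      have := h3.trans (Set.encard_le_encard h5)
      rw [Set.encard_pair huv] at this
      exact absurd this (by norm_num)
    have h4 := h u u.2 v v.2 w w.2 (one_le_code_iff.2 (hX hu hw hwu.symm))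
      (one_le_code_iff.2 (hX hv hw hwv.symm))
    have h5 := one_le_code_iff.2 (hX hu hv huv)
    rw [← code_eq_two_iff]
    have := T.code_le u v
    omega

theorem isMaxStrongStableWeight_iff {K : Type*} [AddCommGroup K] [LinearOrder K] {w : Fin n → K}
    {w' : ℕ → K} (hw : ∀ v : Fin n, w' v = w v) {a : K} :
    T.IsMaxStrongStableWeight w a ↔ IsMaxStableWeight n T.code w' a := by
  unfold IsMaxStrongStableWeight IsMaxStableWeight
  have : {x | ∃ S : Finset (Fin n), T.IsStrongStable (S : Set (Fin n)) ∧ x = ∑ v ∈ S, w v} =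
      {x | ∃ S ⊆ Finset.range n, (∀ u ∈ S, ∀ v ∈ S, u ≠ v → T.code u v = 0) ∧
        x = ∑ v ∈ S, w' v} := by
    ext x
    constructor
    · rintro ⟨S, hS, rfl⟩
      refine ⟨S.map Fin.valEmbedding, ?_, ?_, ?_⟩
      · intro v hv
        obtain ⟨u, -, rfl⟩ := Finset.mem_map.1 hv
        exact Finset.mem_range.2 u.2
      · intro u hu v hv huv
        obtain ⟨u, hu', rfl⟩ := Finset.mem_map.1 hu
        obtain ⟨v, hv', rfl⟩ := Finset.mem_map.1 hv
        have hne : u ≠ v := fun h => huv (by rw [h])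
        exact (code_eq_zero_iff hne).2 (hS hu' hv' hne)
      · rw [Finset.sum_map]
        exact Finset.sum_congr rfl fun v _ => (hw v).symm
    · rintro ⟨S, hS, hst, rfl⟩
      refine ⟨Finset.univ.filter fun v : Fin n => (v : ℕ) ∈ S, ?_, ?_⟩
      · intro u hu v hv huv
        have hu' := (Finset.mem_filter.1 hu).2
        have hv' := (Finset.mem_filter.1 hv).2
        exact (code_eq_zero_iff huv).1 (hst u hu' v hv' fun h => huv (Fin.ext h))
      · symm
        refine Finset.sum_bij (fun v _ => (v : ℕ)) (fun v hv => (Finset.mem_filter.1 hv).2)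
          (fun u _ v _ h => Fin.ext h) (fun v hv => ?_) fun v _ => (hw v).symm
        exact ⟨⟨v, Finset.mem_range.1 (hS hv)⟩, Finset.mem_filter.2 ⟨Finset.mem_univ _, hv⟩, rfl⟩
  rw [this]

end RAM

namespace RAM

variable {n : ℕ} {g : ℕ → ℕ → ℕ}

/-! ### The good partitions of a doubled trigraph are found -/

/-- In a graph whose vertices can be partitioned into a clique and a stable set, the degrees give
such a partition. -/
theorem exists_degree_threshold (hn : 0 < n) (hg : ∀ u < n, ∀ v < n, g u v = g v u)
    (hloop : ∀ u < n, g u u = 0) {X : ℕ → Prop}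
    (hX : ∀ u < n, ∀ v < n, u ≠ v → X u → X v → g u v = 0)
    (hY : ∀ u < n, ∀ v < n, u ≠ v → ¬ X u → ¬ X v → 1 ≤ g u v) :
    ∃ t < n, (∀ u < n, ∀ v < n, u ≠ v → degree n g u < t → degree n g v < t → g u v = 0) ∧
      ∀ u < n, ∀ v < n, u ≠ v → t ≤ degree n g u → t ≤ degree n g v → 1 ≤ g u v := by
  classical
  set N : ℕ → Finset ℕ := fun v => (Finset.range n).filter fun u => 1 ≤ g v u with hN
  have hdeg : ∀ v, degree n g v = (N v).card := fun v => rfl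
  have hNm : ∀ v u, u ∈ N v ↔ u < n ∧ 1 ≤ g v u := by simp [hN]
  set F := (Finset.range n).powerset.filter fun Y =>
    (∀ u ∈ Y, ∀ v ∈ Y, u ≠ v → 1 ≤ g u v) ∧
      ∀ u < n, ∀ v < n, u ∉ Y → v ∉ Y → u ≠ v → g u v = 0 with hF
  have hFm : ∀ Y, Y ∈ F ↔ (∀ u ∈ Y, u < n) ∧ (∀ u ∈ Y, ∀ v ∈ Y, u ≠ v → 1 ≤ g u v) ∧
      ∀ u < n, ∀ v < n, u ∉ Y → v ∉ Y → u ≠ v → g u v = 0 := by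
    intro Y
    simp [hF, Finset.subset_iff]
  have hne : F.Nonempty := by
    refine ⟨(Finset.range n).filter fun u => ¬ X u, (hFm _).2 ⟨by simp +contextual, ?_, ?_⟩⟩
    · intro u hu v hv huv
      simp only [Finset.mem_filter, Finset.mem_range] at hu hv
      exact hY u hu.1 v hv.1 huv hu.2 hv.2
    · intro u hu v hv h1 h2 huv
      simp only [Finset.mem_filter, Finset.mem_range, not_and, not_not] at h1 h2
      exact hX u hu v hv huv (h1 hu) (h2 hv)
  -- The clique `Y` with stable complement is chosen as large as possible, so that no outside vertex
  -- is adjacent to all of `Y`: outside degrees are below `Y.card`, while degrees in `Y` are at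
  -- least `Y.card - 1`.
  obtain ⟨Y, hYF, hmax⟩ := F.exists_max_image Finset.card hne
  obtain ⟨hYn, hYc, hYs⟩ := (hFm Y).1 hYF
  have hsub : ∀ x < n, x ∉ Y → N x ⊆ Y := by
    intro x hx hxY u hu
    obtain ⟨h1, h2⟩ := (hNm x u).1 hu
    by_contra h3
    by_cases h4 : x = u
    · subst h4
      rw [hloop x hx] at h2
      omega
    · rw [hYs x hx u h1 hxY h3 h4] at h2
      omega
  have hsup : ∀ y ∈ Y, Y.erase y ⊆ N y := by
    intro y hy u hu
    rw [Finset.mem_erase] at hu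
    exact (hNm y u).2 ⟨hYn u hu.2, hYc y hy u hu.2 hu.1.symm⟩
  have hout : ∀ x < n, x ∉ Y → (N x).card < Y.card := by
    intro x hx hxY
    refine Finset.card_lt_card ⟨hsub x hx hxY, fun h => ?_⟩
    have h1 : insert x Y ∈ F := by
      refine (hFm _).2 ⟨?_, ?_, ?_⟩
      · intro u hu
        rcases Finset.mem_insert.1 hu with rfl | hu
        · exact hx
        · exact hYn u hu
      · have hxu : ∀ u ∈ Y, 1 ≤ g x u := fun u hu => ((hNm x u).1 (h hu)).2
        intro u hu v hv huv
        rcases Finset.mem_insert.1 hu with rfl | hu' <;>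
          rcases Finset.mem_insert.1 hv with rfl | hv'
        · exact absurd rfl huv
        · exact hxu v hv'
        · rw [hg u (hYn u hu') _ hx]
          exact hxu u hu'
        · exact hYc u hu' v hv' huv
      · intro u hu v hv h2 h3
        exact hYs u hu v hv (fun h4 => h2 (Finset.mem_insert_of_mem h4))
          fun h4 => h3 (Finset.mem_insert_of_mem h4)
    have h2 := hmax _ h1
    rw [Finset.card_insert_of_notMem hxY] at h2
    omega
  have hlow : ∀ y ∈ Y, (N y).card < Y.card → ∀ x < n, x ∉ Y → g y x = 0 := by
    intro y hy h1 x hx hxY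
    have h2 : Y.erase y = N y := Finset.eq_of_subset_of_card_le (hsup y hy) (by
      rw [Finset.card_erase_of_mem hy]
      omega)
    by_contra h3
    have h4 : x ∈ N y := (hNm y x).2 ⟨hx, by omega⟩
    rw [← h2] at h4
    exact hxY (Finset.mem_of_mem_erase h4)
  have hYle : Y.card ≤ n := by
    have := Finset.card_le_card (show Y ⊆ Finset.range n from fun u hu =>
      Finset.mem_range.2 (hYn u hu))
    rwa [Finset.card_range] at this
  simp only [hdeg]
  -- If two vertices of `Y` have degree `Y.card - 1`, then they have no neighbour outside. Outside
  -- vertices miss both, so their degrees are below `Y.card - 1`, and this threshold separates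
  -- exactly `Y`.
  by_cases hB : ∃ y ∈ Y, ∃ z ∈ Y, y ≠ z ∧ (N y).card < Y.card ∧ (N z).card < Y.card
  · obtain ⟨y, hy, z, hz, hyz, hy1, hz1⟩ := hB
    have hpos : 0 < Y.card := Finset.card_pos.2 ⟨y, hy⟩
    have hin : ∀ u < n, Y.card - 1 ≤ (N u).card ↔ u ∈ Y := by
      intro u hu
      constructor
      · intro h1
        by_contra h2
        have h3 : N u ⊆ (Y.erase y).erase z := by
          intro v hv
          have h4 := (hNm u v).1 hv
          refine Finset.mem_erase.2 ⟨?_, Finset.mem_erase.2 ⟨?_, hsub u hu h2 hv⟩⟩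
          · rintro rfl
            have := hlow v hz hz1 u hu h2
            rw [hg v (hYn v hz) u hu] at this
            omega
          · rintro rfl
            have := hlow v hy hy1 u hu h2
            rw [hg v (hYn v hy) u hu] at this
            omega
        have h4 := Finset.card_le_card h3
        have h5 : z ∈ Y.erase y := Finset.mem_erase.2 ⟨hyz.symm, hz⟩
        have h6 := Finset.card_pos.2 ⟨z, h5⟩
        rw [Finset.card_erase_of_mem h5] at h4
        rw [Finset.card_erase_of_mem hy] at h4 h6
        omega
      · intro h1
        have := Finset.card_le_card (hsup u h1)
        rwa [Finset.card_erase_of_mem h1] at this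
    refine ⟨Y.card - 1, by omega, fun u hu v hv huv h1 h2 => ?_, fun u hu v hv huv h1 h2 => ?_⟩
    · exact hYs u hu v hv (fun h3 => absurd ((hin u hu).2 h3) (by omega))
        (fun h3 => absurd ((hin v hv).2 h3) (by omega)) huv
    · exact hYc u ((hin u hu).1 h1) v ((hin v hv).1 h2) huv
  · push Not at hB
    -- Now at most one vertex of `Y` has degree below `Y.card`. It has no neighbour outside, so the
    -- threshold `Y.card` may move it to the stable side. If `Y` is everything, the threshold `0` is
    -- used to keep `t < n`.
    by_cases hYn' : Y.card < n
    · refine ⟨Y.card, hYn', fun u hu v hv huv h1 h2 => ?_, fun u hu v hv huv h1 h2 => ?_⟩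
      · by_cases h3 : u ∈ Y <;> by_cases h4 : v ∈ Y
        · have := hB u h3 v h4 huv h1
          omega
        · exact hlow u h3 h1 v hv h4
        · rw [hg u hu v hv]
          exact hlow v h4 h2 u hu h3
        · exact hYs u hu v hv h3 h4 huv
      · refine hYc u ?_ v ?_ huv
        · by_contra h3
          have := hout u hu h3
          omega
        · by_contra h3
          have := hout v hv h3
          omega
    · have hall : ∀ u < n, u ∈ Y := by
        intro u hu
        have : Y = Finset.range n := Finset.eq_of_subset_of_card_le
          (fun u hu => Finset.mem_range.2 (hYn u hu)) (by rw [Finset.card_range]; omega)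
        rw [this]
        exact Finset.mem_range.2 hu
      exact ⟨0, hn, fun u hu v hv huv h1 => absurd h1 (Nat.not_lt_zero _),
        fun u hu v hv huv _ _ => hYc u (hall u hu) v (hall v hv) huv⟩

/-- Let `u` and `v` be mates in the first part. Its other vertices are antiadjacent to both, since
mates are unique, whereas a vertex of the second part is adjacent to exactly one of them; so `u` and
`v` determine the partition. Mates in the second part are treated symmetrically. Without mates there
are no switchable pairs and the graph splits into a stable set and a clique. The degree partition
then has no mates either and is good, though it need not be the given one. -/
theorem GoodSide.exists_candidate (hn : 0 < n) (hg : ∀ u < n, ∀ v < n, g u v = g v u)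
    (hloop : ∀ u < n, g u u = 0) (hle : ∀ u < n, ∀ v < n, g u v ≤ 2) {X : ℕ → Prop}
    (H : GoodSide n g X) : ∃ a < n, ∃ b < n,
      GoodSide n g (EdgeSide g a b) ∨ GoodSide n g (fun v => ¬ AntiedgeSide g a b v) ∨
      GoodSide n g (fun v => ¬ a ≤ degree n g v) := by
  by_cases h1 : ∃ u < n, ∃ v < n, Mate g X u v
  · obtain ⟨u, hu, v, hv, h2⟩ := h1
    have h3 : Mate g X v u := h2.symm (hg u hu v hv)
    have hm := H.mate_unique
    refine ⟨u, hu, v, hv, ?_⟩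
    by_cases hXu : X u
    · have hXv : X v := by
        rcases h2.2 with h | h
        · exact h.2.1
        · exact absurd hXu h.1
      refine Or.inl ((GoodSide.congr fun w hw => ?_).1 H)
      unfold EdgeSide
      by_cases hwu : w = u
      · subst hwu; simp [hXu]
      by_cases hwv : w = v
      · subst hwv; simp [hXv]
      simp only [hwu, hwv, false_or]
      rw [hg w hw u hu, hg w hw v hv]
      constructor
      · intro hXw
        constructor
        · by_contra h4
          exact hwv (hm u hu w hw v hv ⟨Ne.symm hwu, Or.inl ⟨hXu, hXw, by omega⟩⟩ h2)
        · by_contra h4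
          exact hwu (hm v hv w hw u hu ⟨Ne.symm hwv, Or.inl ⟨hXv, hXw, by omega⟩⟩ h3)
      · intro h4
        by_contra h5
        exact H.differ u hu v hv w hw h2 ⟨fun _ => h5, fun _ => hXu⟩ (by rw [h4.1, h4.2])
    · have hXv : ¬ X v := by
        rcases h2.2 with h | h
        · exact absurd h.1 hXu
        · exact h.2.1
      refine Or.inr (Or.inl ((GoodSide.congr fun w hw => ?_).1 H))
      unfold AntiedgeSide
      by_cases hwu : w = u
      · subst hwu; simp [hXu]
      by_cases hwv : w = v
      · subst hwv; simp [hXv]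
      simp only [hwu, hwv, false_or]
      rw [hg w hw u hu, hg w hw v hv]
      constructor
      · intro hXw h4
        exact H.differ u hu v hv w hw h2 ⟨fun h => absurd h hXu, fun h => absurd hXw h⟩
          (by rw [h4.1, h4.2])
      · intro h4
        by_contra hXw
        refine h4 ⟨?_, ?_⟩
        · by_contra h5
          have := hle u hu w hw
          exact hwv (hm u hu w hw v hv ⟨Ne.symm hwu, Or.inr ⟨hXu, hXw, by omega⟩⟩ h2)
        · by_contra h5
          have := hle v hv w hw
          exact hwu (hm v hv w hw u hu ⟨Ne.symm hwv, Or.inr ⟨hXv, hXw, by omega⟩⟩ h3)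
  · push Not at h1
    have hX : ∀ u < n, ∀ v < n, u ≠ v → X u → X v → g u v = 0 := by
      intro u hu v hv huv h2 h3
      by_contra h4
      exact h1 u hu v hv ⟨huv, Or.inl ⟨h2, h3, by omega⟩⟩
    have hY : ∀ u < n, ∀ v < n, u ≠ v → ¬ X u → ¬ X v → g u v = 2 := by
      intro u hu v hv huv h2 h3
      by_contra h4
      have := hle u hu v hv
      exact h1 u hu v hv ⟨huv, Or.inr ⟨h2, h3, by omega⟩⟩
    have hne : ∀ u < n, ∀ v < n, g u v ≠ 1 := by
      intro u hu v hv h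
      by_cases huv : u = v
      · subst huv
        rw [hloop u hu] at h
        omega
      by_cases h2 : X u <;> by_cases h3 : X v
      · rw [hX u hu v hv huv h2 h3] at h
        omega
      · exact H.no_semi u hu v hv h2 h3 h
      · exact H.no_semi v hv u hu h3 h2 (by rw [hg v hv u hu, h])
      · rw [hY u hu v hv huv h2 h3] at h
        omega
    obtain ⟨t, ht, h2, h3⟩ := exists_degree_threshold hn hg hloop hX
      fun u hu v hv huv h4 h5 => by rw [hY u hu v hv huv h4 h5]; omega
    have hno : ∀ u < n, ∀ v < n, ¬ Mate g (fun v => ¬ t ≤ degree n g v) u v := by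
      rintro u hu v hv ⟨huv, ⟨h4, h5, h6⟩ | ⟨h4, h5, h6⟩⟩
      · have := h2 u hu v hv huv (not_le.1 h4) (not_le.1 h5)
        omega
      · have := h3 u hu v hv huv (not_not.1 h4) (not_not.1 h5)
        have := hne u hu v hv
        omega
    exact ⟨t, ht, 0, hn, Or.inr (Or.inr ⟨fun u hu v hv w hw h => absurd h (hno u hu v hv),
      fun u hu v hv _ _ => hne u hu v hv, fun u hu v hv y hy h => absurd h (hno u hu v hv)⟩)⟩

/-! ### Components with at most two vertices -/

section Component

variable {V : Type*} {H : SimpleGraph V} {X C : Set V}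

theorem exists_component [Finite V] {D : Set V} (hD : D ⊆ X) (h : (H.induce D).Connected) :
    ∃ C, D ⊆ C ∧ Maximal (fun D => D ⊆ X ∧ (H.induce D).Connected) C :=
  (Set.toFinite {D | D ⊆ X ∧ (H.induce D).Connected}).exists_le_maximal ⟨hD, h⟩

theorem connected_induce_triple {u v w : V} (huv : H.Adj u v) (huw : H.Adj u w) :
    (H.induce {u, v, w}).Connected := by
  have h : ({u, v, w} : Set V) = {u, v} ∪ {u, w} := by
    ext x
    simp
    tauto
  rw [h]
  exact SimpleGraph.induce_union_connected
    (SimpleGraph.induce_pair_connected_of_adj huv).preconnected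
    (SimpleGraph.induce_pair_connected_of_adj huw).preconnected ⟨u, by simp, by simp⟩

/-- In `X` every vertex has at most one neighbour. -/
def IsMatchingOn (H : SimpleGraph V) (X : Set V) : Prop :=
  ∀ u ∈ X, ∀ v ∈ X, ∀ w ∈ X, H.Adj u v → H.Adj u w → v = w

/-- By induction along a walk: the only neighbour of a neighbour of `y` is `y` itself, so a walk
never gets farther from its end than distance one. -/
theorem IsMatchingOn.adj (hX : IsMatchingOn H X) (hC : C ⊆ X) (h : (H.induce C).Connected)
    {u v : V} (hu : u ∈ C) (hv : v ∈ C) (huv : u ≠ v) : H.Adj u v := by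
  obtain ⟨p⟩ := h.preconnected ⟨u, hu⟩ ⟨v, hv⟩
  have key : ∀ (x y : C), (H.induce C).Walk x y → (x : V) = y ∨ H.Adj x y := by
    intro x y p
    induction p with
    | nil => exact Or.inl rfl
    | @cons x z y hxz p ih =>
      have h1 : H.Adj x z := hxz
      rcases ih with h2 | h2
      · exact Or.inr (h2 ▸ h1)
      · exact Or.inl (hX z (hC z.2) x (hC x.2) y (hC y.2) h1.symm h2)
  exact (key _ _ p).resolve_left huv

theorem IsMatchingOn.encard_le (hX : IsMatchingOn H X) (hC : C ⊆ X)
    (h : (H.induce C).Connected) : C.encard ≤ 2 := by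
  obtain ⟨⟨u, hu⟩⟩ := h.nonempty
  by_cases h1 : ∃ v ∈ C, v ≠ u
  · obtain ⟨v, hv, hvu⟩ := h1
    rw [← Set.encard_pair hvu.symm]
    refine Set.encard_le_encard fun w hw => ?_
    by_cases h2 : w = u
    · exact Or.inl h2
    · exact Or.inr (hX u (hC hu) w (hC hw) v (hC hv) (hX.adj hC h hu hw (Ne.symm h2))
        (hX.adj hC h hu hv hvu.symm))
  · push Not at h1
    rw [show C = {u} from Set.eq_singleton_iff_unique_mem.2 ⟨hu, h1⟩, Set.encard_singleton]
    norm_num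

/-- Two neighbours of a vertex would form with it a connected set of three vertices, which extends
to a component. -/
theorem isMatchingOn_of_encard_le [Finite V]
    (h : ∀ C, Maximal (fun D => D ⊆ X ∧ (H.induce D).Connected) C → C.encard ≤ 2) :
    IsMatchingOn H X := by
  intro u hu v hv w hw huv huw
  by_contra hvw
  obtain ⟨C, hDC, hC⟩ := exists_component (X := X) (D := {u, v, w})
    (by rintro x (rfl | rfl | rfl) <;> assumption) (connected_induce_triple huv huw)
  have h1 := (Set.encard_le_encard hDC).trans (h C hC)
  rw [Set.encard_insert_of_notMem, Set.encard_pair hvw] at h1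
  · exact absurd h1 (by norm_num)
  · simp [huv.ne, huw.ne]

end Component

/-! ### Good partitions in terms of mates. -/

section Doubled

open Trigraph

variable {T : Trigraph (Fin n)}

/-- Complementation commutes with taking induced subgraphs, so anticomponents are components of
another graph and the preceding lemmas apply to both. -/
theorem isAnticomponent_iff {X C : Set (Fin n)} : T.IsAnticomponent X C ↔
    Maximal (fun D => D ⊆ X ∧ (T.strongRealizationᶜ.induce D).Connected) C := by
  have h : ∀ D, T.IsAnticonnectedSet D ↔ (T.strongRealizationᶜ.induce D).Connected := by
    intro D
    unfold IsAnticonnectedSet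
    have : (T.strongRealization.induce D)ᶜ = T.strongRealizationᶜ.induce D := by
      ext u v
      simp [SimpleGraph.compl_adj, Subtype.ext_iff]
    rw [this]
  unfold IsAnticomponent
  simp only [h]

theorem full_adj_iff {u v : Fin n} : T.fullRealization.Adj u v ↔ 1 ≤ T.code u v :=
  one_le_code_iff.symm

theorem anti_adj_iff {u v : Fin n} :
    T.strongRealizationᶜ.Adj u v ↔ u ≠ v ∧ T.code u v ≤ 1 := by
  rw [SimpleGraph.compl_adj]
  refine and_congr_right fun _ => ?_
  have h : T.strongRealization.Adj u v ↔ T.code u v = 2 := code_eq_two_iff.symm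
  rw [h]
  have := T.code_le u v
  omega

theorem mate_code_iff {X : ℕ → Prop} {u v : Fin n} : Mate T.code X u v ↔
    (X u ∧ X v ∧ T.fullRealization.Adj u v) ∨ (¬ X u ∧ ¬ X v ∧ T.strongRealizationᶜ.Adj u v) := by
  rw [full_adj_iff, anti_adj_iff]
  unfold Mate
  have h1 : 1 ≤ T.code u v → u ≠ v := by
    rintro h rfl
    rw [code_self] at h
    omega
  have h2 : (u : ℕ) ≠ v ↔ u ≠ v := Fin.val_injective.ne_iff
  rw [h2]
  tauto

/-- Bounded components mean that mates are unique, and two distinct vertices of a component or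
anticomponent are mates. As there are no switchable pairs across, the conditions at a vertex on
strong edges and on strong antiedges say together that its pairs with two mates have different
values. -/
theorem isGoodPartition_iff {X : ℕ → Prop} :
    T.IsGoodPartition {v | X v} {v | ¬ X v} ↔ GoodSide n T.code X := by
  set A : Set (Fin n) := {v | X v} with hA
  set B : Set (Fin n) := {v | ¬ X v} with hB
  have hAB : IsCompl A B := by
    rw [show B = Aᶜ from rfl]
    exact isCompl_compl
  have single : ∀ (H : SimpleGraph (Fin n)) (v : Fin n), (H.induce {v}).Connected := by
    intro H v
    have : Subsingleton ({v} : Set (Fin n)) := Set.subsingleton_singleton.coe_sort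
    have : Nonempty ({v} : Set (Fin n)) := ⟨⟨v, rfl⟩⟩
    exact SimpleGraph.Connected.of_subsingleton
  constructor
  · intro h
    have hmA : IsMatchingOn T.fullRealization A := isMatchingOn_of_encard_le h.component_le
    have hmB : IsMatchingOn T.strongRealizationᶜ B :=
      isMatchingOn_of_encard_le fun C hC => h.anticomponent_le C (isAnticomponent_iff.2 hC)
    have hno : ∀ x ∈ A, ∀ y ∈ B, T.code x y ≠ 1 := fun x hx y hy h1 =>
      h.no_switchable x hx y hy (code_eq_one_iff.1 h1)
    have key : ∀ C D, T.IsComponent A C → T.IsAnticomponent B D → ∀ v u u' : Fin n, u ≠ u' →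
        Between C D v u → Between C D v u' → T.code u v ≠ T.code u' v := by
      intro C D hC hD v u u' hne h1 h2 h3
      have hCA : C ⊆ A := hC.1.1
      have hDB : D ⊆ B := hD.1.1
      have hv : v ∈ C ∪ D := h1.elim (fun h => Or.inl h.1) fun h => Or.inr h.1
      have huv : T.code v u ≠ 1 := by
        rcases h1 with h1 | h1
        · exact hno v (hCA h1.1) u (hDB h1.2)
        · rw [code_symm]
          exact hno u (hCA h1.2) v (hDB h1.1)
      have hvu : v ≠ u := by
        rintro rfl
        rcases h1 with h1 | h1
        · exact hDB h1.2 (hCA h1.1)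
        · exact hDB h1.1 (hCA h1.2)
      have hvu' : v ≠ u' := by
        rintro rfl
        rcases h2 with h1 | h1
        · exact hDB h1.2 (hCA h1.1)
        · exact hDB h1.1 (hCA h1.2)
      rw [code_symm (u := (u : ℕ)), code_symm (u := (u' : ℕ))] at h3
      by_cases h4 : T.code v u = 2
      · exact hne (h.strong_edge C D hC hD v hv ⟨h1, code_eq_two_iff.1 h4⟩
          ⟨h2, code_eq_two_iff.1 (h3 ▸ h4)⟩)
      · have h5 : T.code v u = 0 := by
          have := T.code_le v u
          omega
        exact hne (h.strong_antiedge C D hC hD v hv ⟨h1, (code_eq_zero_iff hvu).1 h5⟩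
          ⟨h2, (code_eq_zero_iff hvu').1 (h3 ▸ h5)⟩)
    refine ⟨fun u hu v hv w hw h1 h2 => ?_, fun u hu v hv h1 h2 => ?_,
      fun u hu v hv y hy h1 h2 => ?_⟩
    · lift u to Fin n using hu
      lift v to Fin n using hv
      lift w to Fin n using hw
      rw [mate_code_iff] at h1 h2
      rcases h1 with h1 | h1 <;> rcases h2 with h2 | h2
      · exact congrArg Fin.val (hmA u h1.1 v h1.2.1 w h2.2.1 h1.2.2 h2.2.2)
      · exact absurd h1.1 h2.1
      · exact absurd h2.1 h1.1
      · exact congrArg Fin.val (hmB u h1.1 v h1.2.1 w h2.2.1 h1.2.2 h2.2.2)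
    · exact hno ⟨u, hu⟩ h1 ⟨v, hv⟩ h2
    · lift u to Fin n using hu
      lift v to Fin n using hv
      lift y to Fin n using hy
      have huv : u ≠ v := fun h3 => h1.1 (congrArg Fin.val h3)
      rcases mate_code_iff.1 h1 with h3 | h3
      · have hXy : y ∈ B := h2.1 h3.1
        obtain ⟨C, hC1, hC⟩ := exists_component (X := A)
          (by rintro x (rfl | rfl); exacts [h3.1, h3.2.1])
          (SimpleGraph.induce_pair_connected_of_adj h3.2.2)
        -- The vertex `y` may have no mate; the singleton is connected and yields the anticomponent
        -- that contains it.
        obtain ⟨D, hD1, hD⟩ := exists_component (X := B) (by rintro x rfl; exact hXy)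
          (single T.strongRealizationᶜ y)
        exact key C D hC (isAnticomponent_iff.2 hD) y u v huv
          (Or.inr ⟨hD1 rfl, hC1 (Or.inl rfl)⟩) (Or.inr ⟨hD1 rfl, hC1 (Or.inr rfl)⟩)
      · have hXy : y ∈ A := by
          by_contra h4
          exact h3.1 (h2.2 h4)
        obtain ⟨D, hD1, hD⟩ := exists_component (X := B)
          (by rintro x (rfl | rfl); exacts [h3.1, h3.2.1])
          (SimpleGraph.induce_pair_connected_of_adj h3.2.2)
        obtain ⟨C, hC1, hC⟩ := exists_component (X := A) (by rintro x rfl; exact hXy)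
          (single T.fullRealization y)
        exact key C D hC (isAnticomponent_iff.2 hD) y u v huv
          (Or.inl ⟨hC1 rfl, hD1 (Or.inl rfl)⟩) (Or.inl ⟨hC1 rfl, hD1 (Or.inr rfl)⟩)
  · intro h
    have hmA : IsMatchingOn T.fullRealization A := fun u hu v hv w hw h1 h2 =>
      Fin.ext (h.mate_unique u u.2 v v.2 w w.2 (mate_code_iff.2 (Or.inl ⟨hu, hv, h1⟩))
        (mate_code_iff.2 (Or.inl ⟨hu, hw, h2⟩)))
    have hmB : IsMatchingOn T.strongRealizationᶜ B := fun u hu v hv w hw h1 h2 =>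
      Fin.ext (h.mate_unique u u.2 v v.2 w w.2 (mate_code_iff.2 (Or.inr ⟨hu, hv, h1⟩))
        (mate_code_iff.2 (Or.inr ⟨hu, hw, h2⟩)))
    have key : ∀ C D, T.IsComponent A C → T.IsAnticomponent B D → ∀ v u u' : Fin n,
        Between C D v u → Between C D v u' → T.code v u = T.code v u' → u = u' := by
      intro C D hC hD v u u' h1 h2 h3
      have hD' := isAnticomponent_iff.1 hD
      have hCA : C ⊆ A := hC.1.1
      have hDB : D ⊆ B := hD.1.1
      by_contra hne
      rw [code_symm (v := (u : ℕ)), code_symm (v := (u' : ℕ))] at h3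
      rcases h1 with h1 | h1 <;> rcases h2 with h2 | h2
      · have h4 := hmB.adj hDB hD'.1.2 h1.2 h2.2 hne
        refine h.differ u u.2 u' u'.2 v v.2
          (mate_code_iff.2 (Or.inr ⟨hDB h1.2, hDB h2.2, h4⟩)) ?_ h3
        exact ⟨fun h5 => absurd h5 (hDB h1.2), fun h5 => absurd (hCA h1.1) h5⟩
      · exact hDB h2.1 (hCA h1.1)
      · exact hDB h1.1 (hCA h2.1)
      · have h4 := hmA.adj hCA hC.1.2 h1.2 h2.2 hne
        refine h.differ u u.2 u' u'.2 v v.2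
          (mate_code_iff.2 (Or.inl ⟨hCA h1.2, hCA h2.2, h4⟩)) ?_ h3
        exact ⟨fun _ => hDB h1.1, fun _ => hCA h1.2⟩
    refine ⟨hAB, fun C hC => hmA.encard_le hC.1.1 hC.1.2, fun D hD => ?_, fun x hx y hy h1 => ?_,
      fun C D hC hD v hv u hu u' hu' => ?_, fun C D hC hD v hv u hu u' hu' => ?_⟩
    · have hD' := isAnticomponent_iff.1 hD
      exact hmB.encard_le hD'.1.1 hD'.1.2
    · exact h.no_semi x x.2 y y.2 hx hy (code_eq_one_iff.2 h1)
    · exact key C D hC hD v u u' hu.1 hu'.1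
        ((code_eq_two_iff.2 hu.2).trans (code_eq_two_iff.2 hu'.2).symm)
    · exact key C D hC hD v u u' hu.1 hu'.1 (((code_eq_zero_iff hu.2.1).2 hu.2).trans
        ((code_eq_zero_iff hu'.2.1).2 hu'.2).symm)

theorem isDoubled_iff : T.IsDoubled ↔ ∃ X, GoodSide n T.code X := by
  constructor
  · rintro ⟨X, Y, h⟩
    refine ⟨fun u => ∃ h : u < n, (⟨u, h⟩ : Fin n) ∈ X, isGoodPartition_iff.1 ?_⟩
    convert h using 1
    · ext v
      simp
    · rw [← h.partition.compl_eq]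
      ext v
      simp
  · rintro ⟨X, h⟩
    exact ⟨_, _, isGoodPartition_iff.2 h⟩

end Doubled

end RAM

namespace RAM

open Cmd IExp Test Trigraph

variable {K : Type*} [AddCommGroup K] [LinearOrder K] {n : ℕ} {s : Store K}

/-! ### The algorithm -/

/-- Write the graph into array `4`; the program `q` writes one entry. -/
def fillGraph (q : Cmd) : Cmd := each 10 (each 11 q)

/-- Copy the adjacency matrix. -/
def copyGraph : Cmd :=
  fillGraph (iset 4 (entry (reg 10) (reg 11)) (get 1 (entry (reg 10) (reg 11))))

/-- Write the adjacency matrix of the complement. -/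
def complGraph : Cmd :=
  fillGraph (.ite (ieq (reg 10) (reg 11)) (iset 4 (entry (reg 10) (reg 11)) 0)
    (iset 4 (entry (reg 10) (reg 11)) (2 - get 1 (entry (reg 10) (reg 11)))))

/-- Try to colour the arcs in the given mode. -/
def colourMode (mode : ℕ) : Cmd := rset 5 (.lit mode) ;; colourArcs

/-- Decide whether the graph belongs to a line trigraph, by the flag in register `8`. -/
def testLine : Cmd := colourMode 1 ;; checkTriangles

/-- The algorithm. -/
def solveBasic : Cmd :=
  copyGraph ;; colourMode 0 ;;
  .ite (ieq (reg 8) 0) (rset 2 1 ;; solveBipartite)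
  (testLine ;; .ite (ieq (reg 8) 0) (rset 2 3 ;; solveLine)
  (complGraph ;; colourMode 0 ;; .ite (ieq (reg 8) 0) (rset 2 2 ;; solvePairs)
  (testLine ;; .ite (ieq (reg 8) 0) (rset 2 4 ;; solvePairs)
  (copyGraph ;; findSide ;; .ite (ile 1 (reg 46)) (rset 2 5 ;; solveDoubled) (rset 2 0)))))

theorem wf_solveBasic : solveBasic.wf = true := by decide

/-- The exponent is attained by the arc colouring and by the search for a good partition, both with
about `n ^ 2` rounds of quadratic work, and by the preflow algorithm, with `(n + 1) ^ 3` rounds of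
linear work. -/
theorem deg_solveBasic : solveBasic.deg = 4 := by decide

theorem fillGraph_spec {q : Cmd} {f : ℕ → ℕ → ℕ} (hm : ∀ a ∈ q.imods, a = 4)
    (hn : s.int 0 0 = n)
    (hq : ∀ s' : Store K, ∀ u < n, ∀ v < n, s'.int 0 0 = n → s'.int 10 0 = u → s'.int 11 0 = v →
      (∀ i, s'.int 1 i = s.int 1 i) →
      ∀ i, (q.run n s').int 4 i = if i = u * n + v then f u v else s'.int 4 i) :
    HoldsGraph n f ((fillGraph q).run n s) := by
  have hm' : ∀ a, a ≠ 4 → a ∉ q.imods := fun a ha h => ha (hm a h)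
  have key := run_each_each_invariant (n := n) (s := s) (x := 10) (y := 11) (p := q)
    (by simpa using hm' 10 (by decide))
    (fun k l s' => ∀ u < n, ∀ v < n, u < k ∨ (u = k ∧ v < l) → s'.int 4 (u * n + v) = f u v)
    (by simp) (by simp) (by simp) ?_ ?_
  · refine ⟨?_, fun u hu v hv => key u hu v hv (Or.inl hu)⟩
    rw [int_run_of_notMem _ _ _ _ (by simpa [fillGraph, imods] using hm' 0 (by decide)), hn]
  · intro k s' hk hP u hu v hv h
    exact hP u hu v hv (by omega)
  · intro k l s' hk hl hx hy hi hw hP u hu v hv h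
    have h0 : s'.int 0 0 = n := by rw [hi 0 (by simpa using hm' 0 (by decide)), hn]
    rw [hq s' k hk l hl h0 hx hy (hi 1 (by simpa using hm' 1 (by decide)))]
    simp only [entry_inj hv hl]
    split_ifs with h1
    · rw [h1.1, h1.2]
    · exact hP u hu v hv (by omega)

/-- The memory holds the input. -/
structure HoldsInput (T : Trigraph (Fin n)) (w : Fin n → K) (s : Store K) : Prop where
  size : s.int 0 0 = n
  matrix : ∀ u < n, ∀ v < n, s.int 1 (u * n + v) = T.code u v
  weight : ∀ v : Fin n, s.wt 0 v = w v

variable {T : Trigraph (Fin n)} {w : Fin n → K}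

omit [LinearOrder K] in
theorem holdsInput_inputStore : HoldsInput T w (inputStore T w) := by
  refine ⟨by simp [inputStore], fun u hu v hv => ?_, fun v => by simp [inputStore]⟩
  have h1 : u * n + v < n * n := by
    calc u * n + v < u * n + n := by omega
      _ = (u + 1) * n := by ring
      _ ≤ n * n := Nat.mul_le_mul_right n hu
  have h2 : (u * n + v) / n = u := by
    rw [mul_comm, Nat.mul_add_div (by omega), Nat.div_eq_of_lt hv, add_zero]
  have h3 : (u * n + v) % n = v := by
    rw [mul_comm, Nat.mul_add_mod, Nat.mod_eq_of_lt hv]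
  simp [inputStore, h1, code, hu, hv, h2, h3]

omit [AddCommGroup K] [LinearOrder K] in
theorem HoldsInput.congr {s' : Store K} (h : HoldsInput T w s) (h0 : ∀ i, s'.int 0 i = s.int 0 i)
    (h1 : ∀ i, s'.int 1 i = s.int 1 i) (hw : ∀ i, s'.wt 0 i = s.wt 0 i) : HoldsInput T w s' :=
  ⟨by rw [h0, h.size], fun u hu v hv => by rw [h1, h.matrix u hu v hv],
    fun v => by rw [hw, h.weight]⟩

theorem copyGraph_spec (h : HoldsInput T w s) : HoldsGraph n T.code (copyGraph.run n s) := by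
  refine fillGraph_spec (by decide) h.size ?_
  intro s' u hu v hv h0 hx hy h1 i
  have := h.matrix u hu v hv
  simp [h0, hx, hy, h1, this]

theorem complGraph_spec (h : HoldsInput T w s) : HoldsGraph n T.compl.code (complGraph.run n s) := by
  refine fillGraph_spec (by decide) h.size ?_
  intro s' u hu v hv h0 hx hy h1 i
  have := h.matrix u hu v hv
  rw [code_compl hu hv, run_ite]
  by_cases huv : u = v
  · rw [if_pos (by simpa [hx, hy] using huv)]
    simp [h0, hx, hy, huv]
  · rw [if_neg (by simpa [hx, hy] using huv)]
    simp [h0, hx, hy, huv, h1, this]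

theorem colourMode_spec {mode : ℕ} (h : HoldsGraph n T.code s) :
    (((colourMode mode).run n s).int 8 0 = 0 ↔ ∃ f, IsArcColouring n mode T.code f) ∧
    (((colourMode mode).run n s).int 8 0 = 0 →
      IsArcColouring n mode T.code fun u v => ((colourMode mode).run n s).int 6 (u * n + v)) := by
  have h1 : HoldsGraph n T.code (Cmd.run n (rset 5 (.lit mode)) s) :=
    h.congr (fun i => by simp) (fun i => by simp)
  have h2 := colourArcs_spec h1 fun u _ v _ => code_symm u v
  have h3 : (Cmd.run n (rset 5 (.lit mode)) s).int 5 0 = mode := by simp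
  rw [h3] at h2
  exact h2

theorem HoldsGraph.colourMode {mode : ℕ} (h : HoldsGraph n T.code s) :
    HoldsGraph n T.code ((colourMode mode).run n s) :=
  h.congr
    (int_run_of_notMem _ _ _ _ (show 0 ∉ (rset 5 0 ;; colourArcs).imods by decide))
    (int_run_of_notMem _ _ _ _ (show 4 ∉ (rset 5 0 ;; colourArcs).imods by decide))

theorem HoldsGraph.testLine (h : HoldsGraph n T.code s) :
    HoldsGraph n T.code (testLine.run n s) :=
  h.congr (int_run_of_notMem _ _ _ _ (by decide)) (int_run_of_notMem _ _ _ _ (by decide))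

theorem testLine_spec (h : HoldsGraph n T.code s) :
    ((testLine.run n s).int 8 0 = 0 ↔ T.IsLine) ∧ ((testLine.run n s).int 8 0 = 0 →
      IsArcColouring n 1 T.code fun u v => (testLine.run n s).int 6 (u * n + v)) := by
  have h1 := colourMode_spec (mode := 1) h
  have h2 := checkTriangles_spec (h.colourMode (mode := 1))
  rw [isLine_iff, ← h1.1, ← h2]
  refine ⟨Iff.rfl, fun h3 => ?_⟩
  have h4 : ∀ i, (testLine.run n s).int 6 i = ((colourMode 1).run n s).int 6 i :=
    int_run_of_notMem n checkTriangles _ 6 (by decide)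
  simp only [h4]
  exact h1.2 (h2.1 h3).1

theorem HoldsInput.run {c : Cmd} (h : HoldsInput T w s) (h0 : 0 ∉ c.imods) (h1 : 1 ∉ c.imods)
    (hw : 0 ∉ c.wmods) : HoldsInput T w (c.run n s) :=
  h.congr (int_run_of_notMem _ _ _ _ h0) (int_run_of_notMem _ _ _ _ h1)
    (wt_run_of_notMem _ _ _ _ hw)

theorem HoldsInput.nonneg (h : HoldsInput T w s) (hw : ∀ v, 0 ≤ w v) : ∀ u < n, 0 ≤ s.wt 0 u := by
  intro u hu
  rw [h.weight ⟨u, hu⟩]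
  exact hw _

/-- The answer that names the class `N` is correct, if `solve` computes the maximum weight of a
stable set. -/
theorem isCorrectOutput_of_solve {solve : Cmd} {x : IExp} (N : BasicClass) (hN : T.InClass N)
    (hx : x.eval s = N.code) (h2 : 2 ∉ solve.imods) (h : HoldsInput T w s)
    (hs : ∀ s' : Store K, (∀ a, a ≠ 2 → ∀ i, s'.int a i = s.int a i) → s'.wt = s.wt →
      IsMaxStableWeight n T.code (fun u => s'.wt 0 u) ((solve.run n s').wt 1 0)) :
    IsCorrectOutput T w ((rset 2 x ;; solve).run n s) := by
  refine Or.inr ⟨N, ?_, hN, ?_⟩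
  · rw [run_seq, int_run_of_notMem _ _ _ _ h2]
    simp [hx]
  · have h3 := hs (Cmd.run n (rset 2 x) s) (fun a ha i => by simp [ha]) rfl
    exact (isMaxStrongStableWeight_iff fun v => h.weight v).2 h3

/-- Each class is tested in turn, and a failed test proves that `T` is outside the class; if all
five fail, then `T` is not basic. The graph array holds `T` or its complement as the current test
requires, while the input is never overwritten. -/
theorem solveBasic_spec [IsOrderedAddMonoid K] (hw : ∀ v, 0 ≤ w v) (h : HoldsInput T w s) :
    IsCorrectOutput T w (solveBasic.run n s) := by
  have hsymm : ∀ (T : Trigraph (Fin n)), ∀ u < n, ∀ v < n, T.code u v = T.code v u :=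
    fun T u _ v _ => code_symm u v
  have hle : ∀ (T : Trigraph (Fin n)), ∀ u < n, ∀ v < n, T.code u v ≤ 2 :=
    fun T u _ v _ => code_le u v
  have hloop : ∀ (T : Trigraph (Fin n)), ∀ u < n, T.code u u = 0 := fun T u _ => code_self u
  have hcompl : ∀ u < n, ∀ v < n, u ≠ v → (T.code u v = 0 ↔ T.compl.code u v = 2) := by
    intro u hu v hv huv
    rw [code_compl hu hv, if_neg huv]
    have := hle T u hu v hv
    omega
  -- Both co-classes use the same algorithm: strong stable sets of `T` are strong cliques of the
  -- complement, for which only the absence of diamonds and strength of triangles matter.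
  have hpairs : ∀ {mode : ℕ} {f : ℕ → ℕ → ℕ} {s' : Store K}, HoldsInput T w s' →
      IsArcColouring n mode T.compl.code f → StrongTriangles n T.compl.code →
      HoldsGraph n T.compl.code s' →
      IsMaxStableWeight n T.code (fun u => s'.wt 0 u) ((solvePairs.run n s').wt 1 0) := by
    intro mode f s' h1 h2 h3 h4
    exact solvePairs_spec (hsymm _) (hloop _) (hle _) h3 (h2.diamondFree (hsymm _)) (h1.nonneg hw) h4
      hcompl
  unfold solveBasic
  rw [run_seq, run_seq, run_ite]
  set s1 := Cmd.run n copyGraph s with hs1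
  have I1 : HoldsInput T w s1 := h.run (by decide) (by decide) (by decide)
  have G1 : HoldsGraph n T.code s1 := copyGraph_spec h
  have c1 := colourMode_spec (mode := 0) G1
  have G2 := G1.colourMode (mode := 0)
  have I2 : HoldsInput T w ((colourMode 0).run n s1) := I1.run (by decide) (by decide) (by decide)
  set s2 := (colourMode 0).run n s1 with hs2
  clear_value s1 s2
  by_cases t1 : s2.int 8 0 = 0
  · rw [if_pos (by simpa using t1)]
    refine isCorrectOutput_of_solve .bipartite (isBipartite_iff.2 (c1.1.1 t1)) rfl (by decide) I2
      fun s' hi hw' => ?_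
    have I : HoldsInput T w s' := I2.congr (hi 0 (by decide)) (hi 1 (by decide)) fun i => by rw [hw']
    refine solveBipartite_spec (hsymm T) (I.nonneg hw)
      (G2.congr (hi 0 (by decide)) (hi 4 (by decide))) ?_
    simp only [hi 6 (by decide)]
    exact c1.2 t1
  rw [if_neg (by simpa using t1), run_seq, run_ite]
  have n1 : ¬ T.IsBipartite := fun h1 => t1 (c1.1.2 (isBipartite_iff.1 h1))
  have c3 := testLine_spec G2
  have G3 := G2.testLine
  have I3 : HoldsInput T w (testLine.run n s2) := I2.run (by decide) (by decide) (by decide)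
  set s3 := testLine.run n s2 with hs3
  clear_value s3
  by_cases t3 : s3.int 8 0 = 0
  · rw [if_pos (by simpa using t3)]
    refine isCorrectOutput_of_solve .line (c3.1.1 t3) rfl (by decide) I3
      fun s' hi hw' => ?_
    have I : HoldsInput T w s' := I3.congr (hi 0 (by decide)) (hi 1 (by decide)) fun i => by rw [hw']
    refine solveLine_spec (I.nonneg hw) (hsymm T)
      (G3.congr (hi 0 (by decide)) (hi 4 (by decide))) ?_
    simp only [hi 6 (by decide)]
    exact c3.2 t3
  rw [if_neg (by simpa using t3), run_seq, run_seq, run_ite]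
  have n3 : ¬ T.IsLine := fun h1 => t3 (c3.1.2 h1)
  have G4 : HoldsGraph n T.compl.code (complGraph.run n s3) := complGraph_spec I3
  have I4 : HoldsInput T w (complGraph.run n s3) := I3.run (by decide) (by decide) (by decide)
  set s4 := complGraph.run n s3 with hs4
  have c5 := colourMode_spec (mode := 0) G4
  have G5 := G4.colourMode (mode := 0)
  have I5 : HoldsInput T w ((colourMode 0).run n s4) := I4.run (by decide) (by decide) (by decide)
  set s5 := (colourMode 0).run n s4 with hs5
  clear_value s4 s5
  by_cases t5 : s5.int 8 0 = 0
  · rw [if_pos (by simpa using t5)]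
    refine isCorrectOutput_of_solve .coBipartite (isBipartite_iff.2 (c5.1.1 t5)) rfl (by decide) I5
      fun s' hi hw' => ?_
    have I : HoldsInput T w s' := I5.congr (hi 0 (by decide)) (hi 1 (by decide)) fun i => by rw [hw']
    exact hpairs I (c5.2 t5) ((c5.2 t5).strongTriangles (hsymm _))
      (G5.congr (hi 0 (by decide)) (hi 4 (by decide)))
  rw [if_neg (by simpa using t5), run_seq, run_ite]
  have n5 : ¬ T.compl.IsBipartite := fun h1 => t5 (c5.1.2 (isBipartite_iff.1 h1))
  have c6 := testLine_spec G5
  have G6 := G5.testLine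
  have I6 : HoldsInput T w (testLine.run n s5) := I5.run (by decide) (by decide) (by decide)
  set s6 := testLine.run n s5 with hs6
  clear_value s6
  by_cases t6 : s6.int 8 0 = 0
  · rw [if_pos (by simpa using t6)]
    refine isCorrectOutput_of_solve .coLine (c6.1.1 t6) rfl (by decide) I6
      fun s' hi hw' => ?_
    have I : HoldsInput T w s' := I6.congr (hi 0 (by decide)) (hi 1 (by decide)) fun i => by rw [hw']
    exact hpairs I (c6.2 t6) (isLine_iff.1 (c6.1.1 t6)).2
      (G6.congr (hi 0 (by decide)) (hi 4 (by decide)))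
  rw [if_neg (by simpa using t6), run_seq, run_seq, run_ite]
  have n6 : ¬ T.compl.IsLine := fun h1 => t6 (c6.1.2 h1)
  have G7 : HoldsGraph n T.code (copyGraph.run n s6) := copyGraph_spec I6
  have I7 : HoldsInput T w (copyGraph.run n s6) := I6.run (by decide) (by decide) (by decide)
  set s7 := copyGraph.run n s6 with hs7
  have c8 := findSide_spec G7 _ rfl
  have G8 : HoldsGraph n T.code (findSide.run n s7) := G7.congr
    (int_run_of_notMem _ _ _ _ (by decide)) (int_run_of_notMem _ _ _ _ (by decide))
  have I8 : HoldsInput T w (findSide.run n s7) := I7.run (by decide) (by decide) (by decide)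
  set s8 := findSide.run n s7 with hs8
  clear_value s7 s8
  by_cases t8 : s8.int 46 0 = 0
  · rw [if_neg (by simp [t8])]
    refine Or.inl ⟨by simp, ?_⟩
    have n8 : ¬ T.IsDoubled := by
      intro h1
      obtain ⟨X, hX⟩ := isDoubled_iff.1 h1
      -- The candidates are indexed by vertices, so an empty vertex set would offer none; but the
      -- empty trigraph is bipartite and was accepted before.
      have hn : 0 < n := by
        rcases Nat.eq_zero_or_pos n with rfl | hn
        · exact absurd ⟨Set.univ, ∅, isCompl_top_bot, fun u => u.elim0, fun u => u.elim0⟩ n1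
        · exact hn
      obtain ⟨a, ha, b, hb, h2⟩ := hX.exists_candidate hn (hsymm T) (hloop T) (hle T)
      obtain ⟨h3, h4, h5⟩ := c8.2 t8 a ha b hb
      rcases h2 with h2 | h2 | h2
      · exact h3 h2
      · exact h4 h2
      · exact h5 h2
    rintro ⟨N, hN⟩
    cases N
    · exact n1 hN
    · exact n5 hN
    · exact n3 hN
    · exact n6 hN
    · exact n8 hN
  · rw [if_pos (by simpa [Nat.one_le_iff_ne_zero] using t8)]
    have H8 := c8.1 t8
    refine isCorrectOutput_of_solve .doubled (isDoubled_iff.2 ⟨_, H8.good⟩) rfl (by decide) I8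
      fun s' hi hw' => ?_
    have I : HoldsInput T w s' := I8.congr (hi 0 (by decide)) (hi 1 (by decide)) fun i => by rw [hw']
    refine solveDoubled_spec (hsymm T) (I.nonneg hw)
      (G8.congr (hi 0 (by decide)) (hi 4 (by decide))) ⟨?_, ?_⟩
    · simp only [hi 40 (by decide)]
      exact H8.good
    · have f : ∀ a, a ≠ 2 → s'.int a = s8.int a := fun a ha => funext (hi a ha)
      rw [f 40 (by decide), f 41 (by decide), f 42 (by decide)]
      exact H8.mates

end RAM

/-- One program and one constant `c` work for all inputs, and for all ordered abelian groups `K`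
of weights, such as `ℤ` and `ℝ`. The bound `c * (n ^ 4 + 1)` is `O(n ^ 4)` and leaves room for some
steps when `n = 0`. -/
theorem mainTheorem10 :
    ∃ (P : RAM.Program) (c : ℕ),
      ∀ (K : Type) [AddCommGroup K] [LinearOrder K] [IsOrderedAddMonoid K]
        (n : ℕ) (T : Trigraph (Fin n)) (w : Fin n → K), (∀ v, 0 ≤ w v) →
        ∃ (t : ℕ) (s : RAM.Store K),
          t ≤ c * (n ^ 4 + 1) ∧
          RAM.Exec (c * (n ^ 4 + 1)) P (inputStore T w) t s ∧
          IsCorrectOutput T w s := by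
  -- The `16` comes from `n + 1 ≤ 2 * n`, and `21 = 16 + 5` makes room for the largest loop counter
  -- `(n + 1) ^ 3` and the constant `5` in the bound for the integers.
  refine ⟨RAM.solveBasic.compile, 16 * RAM.solveBasic.factor + 21, ?_⟩
  intro K _ _ _ n T w hw
  have hpow : (n + 1) ^ 4 ≤ 16 * (n ^ 4 + 1) := by
    rcases Nat.eq_zero_or_pos n with rfl | hn
    · norm_num
    · calc (n + 1) ^ 4 ≤ (2 * n) ^ 4 := Nat.pow_le_pow_left (by omega) 4
        _ = 16 * n ^ 4 := by ring
        _ ≤ 16 * (n ^ 4 + 1) := by omega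
  have hV : (n + 1) ^ 3 + 5 ≤ (16 * RAM.solveBasic.factor + 21) * (n ^ 4 + 1) := by
    have h1 : (n + 1) ^ 3 ≤ (n + 1) ^ 4 := Nat.pow_le_pow_right (by omega) (by omega)
    have h2 : 21 * (n ^ 4 + 1) ≤ (16 * RAM.solveBasic.factor + 21) * (n ^ 4 + 1) :=
      Nat.mul_le_mul_right _ (by omega)
    omega
  have hinput := RAM.holdsInput_inputStore (T := T) (w := w)
  have hcells : ∀ a i, (inputStore T w).int a i ≤ (16 * RAM.solveBasic.factor + 21) * (n ^ 4 + 1) := by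
    intro a i
    have hn : n ≤ (n + 1) ^ 3 := by
      calc n ≤ (n + 1) ^ 1 := by rw [pow_one]; omega
        _ ≤ (n + 1) ^ 3 := Nat.pow_le_pow_right (by omega) (by omega)
    have h2 : (inputStore T w).int a i ≤ n + 2 := by
      simp only [inputStore]
      split_ifs
      · omega
      · generalize T.adj _ _ = x
        cases x <;> simp [signCode]
      · omega
    omega
  obtain ⟨⟨t, ht, he⟩, -⟩ := RAM.Cmd.exec_compile hV le_rfl RAM.solveBasic RAM.wf_solveBasic
    (inputStore T w) hinput.size hcells
  refine ⟨t, _, ht.trans ?_, he, RAM.solveBasic_spec hw hinput⟩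
  rw [RAM.deg_solveBasic]
  calc RAM.solveBasic.factor * (n + 1) ^ 4 ≤ RAM.solveBasic.factor * (16 * (n ^ 4 + 1)) :=
        Nat.mul_le_mul_left _ hpow
    _ = 16 * RAM.solveBasic.factor * (n ^ 4 + 1) := by ring
    _ ≤ _ := Nat.mul_le_mul_right _ (by omega)
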